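/- **Setting.** Let $d\in\mathbb N$, $\sigma>0$, $T>0$, $\mathbb T^d=\mathbb R^d/\mathbb Z^d$. For a compact metric space $E$ let $\mathcal P(E)$ be the space of Borel probability measures on $E$ with the topology of weak convergence (equivalently, with the Monge–Kantorovich distance $\mathbf d_1$). Let $H:\mathbb T^d\times\mathbb R^d\to\mathbb R$ be smooth, convex in $p$, and globally Lipschitz continuous in $p$ uniformly in $x$. Let $\alpha\in(0,1]$, let $f$ be continuous from $\mathcal P(\mathbb T^d)$ to $\mathcal C^{\alpha}(\mathbb T^d)$ and $U_0$ continuous from $\mathcal P(\mathbb T^d)$ to $\mathcal C^{2,\alpha}(\mathbb T^d)$. For $\mu\in\mathcal P(\mathcal P(\mathbb T^d))$ put $$\tilde f(\mu)(x)=\int_{\mathcal P(\mathbb T^d)}f(m)(x)\,\mu(dm),\qquad \tilde U_0(\mu)(x)=\int_{\mathcal P(\mathbb T^d)}U_0(m)(x)\,\mu(dm),$$ and extend both linearly to differences $\mu_1-\mu_2$. Fix $\mu_0\in\mathcal P(\mathcal P(\mathbb T^d))$. The blind MFG system for $(u,(\mu_t)_{t\in[0,T]})$ is $$\begin{aligned}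 &-\partial_tu-\sigma\Delta u+H(x,\nabla_x u)=\tilde f(\mu_t)(x)\ \text{ in }[0,T]\times\mathbb T^d,\qquad u(T,\cdot)=\tilde U_0(\mu_T)\ \text{ in }\mathbb T^d,\\ &\partial_t\mu+\nabla_m\cdot\big((\sigma\Delta m-\mathrm{div}(mb))\,\mu\big)=0\ \text{ in }(0,T)\times\mathcal P(\mathbb T^d),\qquad \mu|_{t=0}=\mu_0,\qquad b(t,x)=-D_pH(x,\nabla_xu(t,x)). \end{aligned}$$ A solution is a pair $(u,\mu)$ with $u\in\mathcal C^{1,2}([0,T]\times\mathbb T^d)$ satisfying the first equation and the terminal condition pointwise, and $\mu\in\mathcal C([0,T],\mathcal P(\mathcal P(\mathbb T^d)))$ with $\mu|_{t=0}=\mu_0$ satisfying the second equation in the following weak sense: for every smooth $\phi:[0,T]\times\mathcal P(\mathbb T^d)\to\mathbb R$ with $\phi(T,\cdot)=0$, $$\int_0^T\!\!\int_{\mathcal P(\mathbb T^d)}\Big(-\partial_t\phi(t,m)-\int_{\mathbb T^d}\big(\sigma\Delta_x\nabla_m\phi(t,m,x)+b(t,x)\cdot\nabla_x\nabla_m\phi(t,m,x)\big)m(dx)\Big)\mu_t(dm)\,dt-\int_{\mathcal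 P(\mathbb T^d)}\phi(0,m)\,\mu_0(dm)=0 .$$ Here $\nabla_m\phi(t,m,x)=\lim_{\theta\to0^+}\theta^{-1}\big(\phi(t,(1-\theta)m+\theta\delta_x)-\phi(t,m)\big)$, and $\phi$ is smooth if this limit exists everywhere, $\phi$ is $\mathcal C^\infty$ in $t$, $\nabla_m\phi$ is $\mathcal C^\infty$ in $(t,x)$, and all these derivatives are continuous in all variables including $m$ (smoothness in time on $[0,T]$ meaning that $\phi$ is the restriction of such a function on $\mathbb R\times\mathcal P(\mathbb T^d)$). **Theorem.** Assume that for all $\mu_1,\mu_2\in\mathcal P(\mathcal P(\mathbb T^d))$ $$\int_{\mathcal P(\mathbb T^d)}\int_{\mathbb T^d}\tilde U_0(\mu_1-\mu_2)(x)\,m(dx)\,(\mu_1-\mu_2)(dm)\le0\ \Longrightarrow\ \tilde U_0(\mu_1)=\tilde U_0(\mu_2),$$ $$\int_{\mathcal P(\mathbb T^d)}\int_{\mathbb T^d}\tilde f(\mu_1-\mu_2)(x)\,m(dx)\,(\mu_1-\mu_2)(dm)\le0\ \Longrightarrow\ \tilde f(\mu_1)=\tilde f(\mu_2).$$ Then there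 is at most one solution $(u,\mu)$ of the blind MFG system: if $(u_1,\mu_1)$ and $(u_2,\mu_2)$ are two solutions with the same $\mu_0$, then $u_1=u_2$ on $[0,T]\times\mathbb T^d$ and $\mu_1=\mu_2$ on $[0,T]$. -/

import Mathlib

open Set Filter Topology MeasureTheory
open scoped NNReal ENNReal ContDiff

noncomputable section

namespace BlindMFG

/-! ### The torus and spaces of probability measures -/

/-- The `d`-dimensional flat torus `ℝ^d / ℤ^d`. -/
abbrev Torus (d : ℕ) : Type := Fin d → UnitAddCircle

/-- The Euclidean space `ℝ^d`. -/
abbrev E (d : ℕ) : Type := EuclideanSpace ℝ (Fin d)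

/-- The canonical projection `ℝ^d → 𝕋^d`. -/
def proj {d : ℕ} (y : E d) : Torus d := fun i => (y i : UnitAddCircle)

/-- Over a compact metrizable space, the σ-algebra that Mathlib puts on the space of probability
measures is the Borel σ-algebra of the weak topology. -/
instance instBorelSpaceProbabilityMeasure (X : Type*) [TopologicalSpace X]
    [TopologicalSpace.MetrizableSpace X] [CompactSpace X] [MeasurableSpace X] [BorelSpace X] :
    BorelSpace (ProbabilityMeasure X) := by
  let _ : MetricSpace X := TopologicalSpace.metrizableSpaceMetric X
  let _ : MetricSpace (ProbabilityMeasure X) :=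
    TopologicalSpace.metrizableSpaceMetric (ProbabilityMeasure X)
  have _ : SecondCountableTopology (ProbabilityMeasure X) := inferInstance
  refine ⟨le_antisymm ?_ ?_⟩
  · have key : @Measurable _ _ (borel (ProbabilityMeasure X)) _
        (fun m : ProbabilityMeasure X => (m : Measure X)) := by
      let _ : MeasurableSpace (ProbabilityMeasure X) := borel _
      have _ : BorelSpace (ProbabilityMeasure X) := ⟨rfl⟩
      refine Measurable.measure_of_isPiSystem_of_isProbabilityMeasure
        (S := {s : Set X | IsOpen s}) ?_ isPiSystem_isOpen ?_
      · exact BorelSpace.measurable_eq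
      · intro G hG
        refine LowerSemicontinuous.measurable ?_
        rw [lowerSemicontinuous_iff_le_liminf]
        intro m
        exact ProbabilityMeasure.le_liminf_measure_open_of_tendsto tendsto_id hG
    exact key.comap_le
  · let S : Set (Set (ProbabilityMeasure X)) :=
      {s | ∃ (g : BoundedContinuousFunction X ℝ≥0) (V : Set ℝ≥0∞), IsOpen V ∧
        s = (fun m : ProbabilityMeasure X => ∫⁻ x, g x ∂(m : Measure X)) ⁻¹' V}
    have hS : (inferInstance : TopologicalSpace (ProbabilityMeasure X)) =
        TopologicalSpace.generateFrom S := by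
      refine le_antisymm (le_generateFrom ?_) ?_
      · rintro s ⟨g, V, hV, rfl⟩
        exact hV.preimage (ProbabilityMeasure.continuous_lintegral_boundedContinuousFunction g)
      · refine le_of_nhds_le_nhds fun m => ?_
        change Tendsto id (@nhds _ (TopologicalSpace.generateFrom S) m) (𝓝 m)
        refine ProbabilityMeasure.tendsto_iff_forall_lintegral_tendsto.2 fun g => ?_
        intro V hV
        obtain ⟨W, hWV, hW, hm⟩ := mem_nhds_iff.1 hV
        rw [TopologicalSpace.nhds_generateFrom]
        refine Filter.mem_of_superset (Filter.mem_iInf_of_mem _ (Filter.mem_iInf_of_mem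
          ⟨hm, ⟨g, W, hW, rfl⟩⟩ (Filter.mem_principal_self _))) ?_
        exact fun m' hm' => hWV hm'
    rw [borel_eq_generateFrom_of_subbasis hS]
    refine MeasurableSpace.generateFrom_le ?_
    rintro s ⟨g, V, hV, rfl⟩
    have hg : Measurable fun m : ProbabilityMeasure X => ∫⁻ x, g x ∂(m : Measure X) :=
      (Measure.measurable_lintegral
        (measurable_coe_nnreal_ennreal.comp g.continuous.measurable)).comp measurable_subtype_coe
    exact hg hV.measurableSet

/-- `𝒫(𝕋^d)`, with the topology of weak convergence (the one metrized by `𝐝₁`). -/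
abbrev Distr (d : ℕ) : Type := ProbabilityMeasure (Torus d)

/-- `𝒫(𝒫(𝕋^d))`, with the topology of weak convergence (the one metrized by `𝐝₁`). -/
abbrev Belief (d : ℕ) : Type := ProbabilityMeasure (Distr d)

/-! ### Differential calculus on the torus -/

/-- The periodic function on `ℝ^d` that corresponds to a function on the torus. -/
def lift {d : ℕ} (g : Torus d → ℝ) : E d → ℝ := fun y => g (proj y)

/-- The gradient of a function on the torus, computed in the chart `z ↦ x + z` at `x`. -/
def torusGrad {d : ℕ} (g : Torus d → ℝ) (x : Torus d) : E d :=
  gradient (fun z : E d => g (x + proj z)) 0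

/-- The Laplacian of a function on the torus, computed in the chart `z ↦ x + z` at `x`. -/
def torusLaplacian {d : ℕ} (g : Torus d → ℝ) (x : Torus d) : ℝ :=
  Laplacian.laplacian (fun z : E d => g (x + proj z)) 0

/-- The norm of the Hölder space `𝒞^{k,α}(𝕋^d)`, with values in `[0,∞]`. -/
def holderNorm {d : ℕ} (k : ℕ) (α : ℝ≥0) (g : Torus d → ℝ) : ℝ≥0∞ :=
  (∑ j ∈ Finset.range (k + 1), ⨆ y : E d, ‖iteratedFDeriv ℝ j (lift g) y‖ₑ) +
    eHolderNorm α (iteratedFDeriv ℝ k (lift g))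

/-- The function `F` is continuous from `𝒫(𝕋^d)` to `𝒞^{k,α}(𝕋^d)`. -/
structure ContinuousIntoHolder {d : ℕ} (k : ℕ) (α : ℝ≥0) (F : Distr d → Torus d → ℝ) :
    Prop where
  contDiff : ∀ m, ContDiff ℝ k (lift (F m))
  finite : ∀ m, holderNorm k α (F m) < ⊤
  tendsto : ∀ m, Tendsto (fun m' => holderNorm k α (F m' - F m)) (𝓝 m) (𝓝 0)

/-- The function `u` is of class `𝒞^{1,2}` on `[0,T] × 𝕋^d` (one-sided time derivatives at the
endpoints). -/
structure IsC12 {d : ℕ} (T : ℝ) (u : ℝ → Torus d → ℝ) : Prop where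
  time_diff : ∀ x, DifferentiableOn ℝ (fun t => u t x) (Icc 0 T)
  time_cont : ContinuousOn
    (fun p : ℝ × Torus d => derivWithin (fun s => u s p.2) (Icc 0 T) p.1) (Icc 0 T ×ˢ univ)
  space_diff : ∀ t ∈ Icc 0 T, ContDiff ℝ 2 (lift (u t))
  space_cont : ∀ k ≤ 2, ContinuousOn
    (fun p : ℝ × E d => iteratedFDeriv ℝ k (lift (u p.1)) p.2) (Icc 0 T ×ˢ univ)

/-! ### Differential calculus on `𝒫(𝕋^d)` -/

/-- The measure `(1 - θ) m + θ δ_x`. -/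
def mixDirac {d : ℕ} (m : Distr d) (x : Torus d) (θ : unitInterval) : Distr d :=
  ⟨unitInterval.toNNReal θ • Measure.dirac x +
    unitInterval.toNNReal (unitInterval.symm θ) • (m : Measure (Torus d)), inferInstance⟩

/-- `∇_m ψ(m, x) = a`, that is, `(ψ((1 - θ) m + θ δ_x) - ψ(m)) / θ → a` as `θ → 0⁺`. -/
def HasMeasureDeriv {d : ℕ} (ψ : Distr d → ℝ) (m : Distr d) (x : Torus d) (a : ℝ) : Prop :=
  Tendsto (fun θ : unitInterval => (ψ (mixDirac m x θ) - ψ m) / (θ : ℝ)) (𝓝[≠] 0) (𝓝 a)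

/-- The function `φ(t, m)` is smooth, with derivative `∇_m φ(t, m, x) = Dφ t m x`:
`φ` and `∇_m φ` are of class `𝒞^∞` in `t`, respectively in `(t, x)`, and all these derivatives
are continuous functions of all the variables, including `m`. Smooth functions on the closed time
interval `[0,T]` are taken as restrictions of smooth functions on `ℝ`. -/
structure IsSmoothTest {d : ℕ} (φ : ℝ → Distr d → ℝ) (Dφ : ℝ → Distr d → Torus d → ℝ) :
    Prop where
  hasDeriv : ∀ t m x, HasMeasureDeriv (φ t) m x (Dφ t m x)
  contDiff : ∀ m, ContDiff ℝ ∞ (fun t => φ t m)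
  continuous : ∀ k : ℕ, Continuous
    (fun p : ℝ × Distr d => iteratedDeriv k (fun s => φ s p.2) p.1)
  deriv_contDiff : ∀ m, ContDiff ℝ ∞ (fun q : ℝ × E d => Dφ q.1 m (proj q.2))
  deriv_continuous : ∀ k : ℕ, Continuous
    (fun p : Distr d × (ℝ × E d) =>
      iteratedFDeriv ℝ k (fun q : ℝ × E d => Dφ q.1 p.1 (proj q.2)) p.2)

/-- The process `(μ_t)_{t ∈ [0,T]}` is a weak solution of the continuity equation
`∂_t μ + ∇_m · ((σ Δ m - div (m b)) μ) = 0` on `𝒫(𝕋^d)` with `μ|_{t = 0} = μ₀`. -/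
def IsWeakSolution {d : ℕ} (σ T : ℝ) (b : ℝ → Torus d → E d) (μ₀ : Belief d)
    (μ : ℝ → Belief d) : Prop :=
  ∀ (φ : ℝ → Distr d → ℝ) (Dφ : ℝ → Distr d → Torus d → ℝ), IsSmoothTest φ Dφ →
    (∀ m, φ T m = 0) →
    (∫ t in (0 : ℝ)..T, ∫ m : Distr d,
        (-deriv (fun s => φ s m) t
          - ∫ x, (σ * torusLaplacian (Dφ t m) x + inner ℝ (b t x) (torusGrad (Dφ t m) x))
              ∂(m : Measure (Torus d)))
        ∂(μ t : Measure (Distr d)))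
      - ∫ m, φ 0 m ∂(μ₀ : Measure (Distr d)) = 0

/-! ### The blind mean field game system -/

/-- The averaged coupling `F̃(μ)(x) = ∫ F(m)(x) μ(dm)`. -/
def averaged {d : ℕ} (F : Distr d → Torus d → ℝ) (μ : Belief d) (x : Torus d) : ℝ :=
  ∫ m, F m x ∂(μ : Measure (Distr d))

/-- The pairing `∫ ∫ F̃(μ₁ - μ₂)(x) m(dx) (μ₁ - μ₂)(dm)`, where `F̃` is extended linearly to
differences of elements of `𝒫(𝒫(𝕋^d))`. -/
def pairing {d : ℕ} (F : Distr d → Torus d → ℝ) (μ₁ μ₂ : Belief d) : ℝ :=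
  (∫ m : Distr d, ∫ x, (averaged F μ₁ x - averaged F μ₂ x) ∂(m : Measure (Torus d))
      ∂(μ₁ : Measure (Distr d)))
    - ∫ m : Distr d, ∫ x, (averaged F μ₁ x - averaged F μ₂ x) ∂(m : Measure (Torus d))
      ∂(μ₂ : Measure (Distr d))

/-- The pair `(u, μ)` solves the blind mean field game system: `u` is a classical solution of the
Hamilton–Jacobi–Bellman equation, and `μ`, continuous in time, is a weak solution of the
continuity equation with drift `b = -D_p H(x, ∇_x u)`. -/
structure IsSolution {d : ℕ} (σ T : ℝ) (H : Torus d → E d → ℝ) (f U₀ : Distr d → Torus d → ℝ)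
    (μ₀ : Belief d) (u : ℝ → Torus d → ℝ) (μ : ℝ → Belief d) : Prop where
  regular : IsC12 T u
  hjb : ∀ t ∈ Icc 0 T, ∀ x,
    -derivWithin (fun s => u s x) (Icc 0 T) t - σ * torusLaplacian (u t) x
      + H x (torusGrad (u t) x) = averaged f (μ t) x
  terminal : ∀ x, u T x = averaged U₀ (μ T) x
  continuousOn : ContinuousOn μ (Icc 0 T)
  initial : μ 0 = μ₀
  continuity : IsWeakSolution σ T
    (fun t x => -gradient (H x) (torusGrad (u t) x)) μ₀ μ

end BlindMFG

end

open BlindMFG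

/-!
Let `(u₁, μ₁)` and `(u₂, μ₂)` be two solutions of the blind mean field game system. The energy
`e(t) = ∫ ∫ (u₁ - u₂)(t, x) m(dx) (μ₁(t) - μ₂(t))(dm)` vanishes at `t = 0` because the initial
conditions agree, and `e(T)` is the pairing of `U₀`, which is nonnegative (`pairing_nonneg`). The
two equations and the convexity of `H` give `e' ≤ -pairing f (μ₁ t) (μ₂ t) ≤ 0`, so that `e` is
identically zero. The monotonicity hypotheses then show that the averaged couplings of the two
solutions coincide (`IsSolution.averaged_eq`). Hence `u₁` and `u₂` solve the same
Hamilton–Jacobi–Bellman equation with the same terminal condition, and coincide by the maximum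
principle (`hjb_comparison`); the drifts coincide too, and `μ₁ = μ₂` by uniqueness for the linear
continuity equation (`IsWeakSolution.unique`).

Two facts about the continuity equation on `𝒫(𝕋^d)` are needed. Both start from the ordinary
differential equations satisfied by the moments `∫ ∏ᵢ (∫ e_{nᵢ} dm) μ_t(dm)`, where the `eₙ` are the
Fourier modes (`IsWeakSolution.integral_fourierMoment_eq`), and which come from testing with the
cylindrical functions `c(t) ∏ᵢ ∫ e_{nᵢ} dm`.

* Differentiating the energy requires testing the equation of the mean distribution `∫ m μ_t(dm)`
  with `u₁` and `u₂`, which are only of class `𝒞^{1,2}`. The passage from Fourier modes to such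
  functions is by convolution (`functional_eq_zero_of_modes`, `IsWeakSolution.hasDerivAt_mean`).
* Uniqueness follows from the fact that `∫ m^{⊗k} μ_t(dm)` solves, for every `k`, the Fokker–Planck
  equation of `k` independent particles on the torus of dimension `k d`. These measures determine
  `μ_t` by the Stone–Weierstrass theorem (`span_fourierMoment_topologicalClosure`). Uniqueness for
  the Fokker–Planck equation with a merely continuous drift (`fokkerPlanck_unique`) is proved by
  duality with the backward heat equation. With damping `σ β²`, its solutions with source `Φ`
  satisfy `|∇g| ≤ ‖Φ‖ / (σ β)` (`norm_gradient_le`), so that the drift is a small perturbation for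
  large `β`. Only trigonometric polynomials occur there, and the gradient bound is the maximum
  principle applied to `g(t, x + s eⱼ) - g(t, x - s eⱼ)`.
-/

noncomputable section

open UnitAddTorus

namespace BlindMFG

/-! ### Necessary conditions at a maximum -/

lemma hasDerivWithinAt_nonpos_of_le {f : ℝ → ℝ} {f' a b : ℝ} (hab : a < b)
    (hf : HasDerivWithinAt f f' (Icc a b) a) (hmax : ∀ t ∈ Icc a b, f t ≤ f a) : f' ≤ 0 := by
  rw [hasDerivWithinAt_iff_tendsto_slope] at hf
  have hne : (𝓝[Icc a b \ {a}] a).NeBot := by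
    rw [Icc_sdiff_left]
    exact left_nhdsWithin_Ioc_neBot hab
  refine le_of_tendsto hf ?_
  filter_upwards [self_mem_nhdsWithin] with t ht
  rw [slope_def_field]
  have h1 : a < t := lt_of_le_of_ne ht.1.1 (fun h => ht.2 h.symm)
  exact div_nonpos_of_nonpos_of_nonneg (sub_nonpos.2 (hmax t ht.1)) (sub_pos.2 h1).le

lemma hasDerivAt_re {f : ℝ → ℂ} {f' : ℂ} {r : ℝ} (hf : HasDerivAt f f' r) :
    HasDerivAt (fun r => (f r).re) f'.re r :=
  Complex.reCLM.hasFDerivAt.comp_hasDerivAt r hf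

lemma second_deriv_nonpos_of_isLocalMax {f f' : ℝ → ℝ} {f'' x : ℝ}
    (hf : ∀ᶠ y in 𝓝 x, HasDerivAt f (f' y) y) (hf' : HasDerivAt f' f'' x)
    (hmax : IsLocalMax f x) : f'' ≤ 0 := by
  have hd : deriv f =ᶠ[𝓝 x] f' := hf.mono fun y hy => hy.deriv
  have h2 : deriv (deriv f) x = f'' := by rw [hd.deriv_eq, hf'.deriv]
  by_contra hpos
  push Not at hpos
  have hmin : IsLocalMin f x := isLocalMin_of_deriv_deriv_pos (h2 ▸ hpos) hmax.deriv_eq_zero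
    hf.self_of_nhds.continuousAt
  -- a point that is both a local minimum and a local maximum has vanishing second derivative
  have hconst : f =ᶠ[𝓝 x] fun _ => f x := by
    filter_upwards [hmin, hmax] with y h1 h2 using le_antisymm h2 h1
  have h3 : deriv (deriv f) x = 0 := by
    rw [hconst.deriv.deriv_eq]
    simp
  linarith

/-! ### Fourier modes on the torus -/

section FourierModes

variable {ι : Type*} [Fintype ι]

lemma mFourier_apply_add (n : ι → ℤ) (x y : UnitAddTorus ι) :
    mFourier n (x + y) = mFourier n x * mFourier n y := by
  simp only [mFourier, ContinuousMap.coe_mk, Pi.add_apply, fourier_apply, ← Finset.prod_mul_distrib]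
  refine Finset.prod_congr rfl fun i _ => ?_
  rw [smul_add, AddCircle.toCircle_add, Circle.coe_mul]

variable [DecidableEq ι]

/-- The symbol of the derivative in the direction `i` on the Fourier mode `n`. -/
def modeSymbol (n : ι → ℤ) (i : ι) : ℂ := 2 * Real.pi * Complex.I * n i

lemma mFourier_single_coe (n : ι → ℤ) (i : ι) (r : ℝ) :
    mFourier n (Pi.single i (r : UnitAddCircle)) = Complex.exp (modeSymbol n i * r) := by
  simp only [mFourier, ContinuousMap.coe_mk]
  rw [Finset.prod_eq_single i]
  · rw [Pi.single_eq_same, fourier_coe_apply, modeSymbol]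
    simp
  · intro j _ hj
    rw [Pi.single_eq_of_ne hj]
    simp
  · simp

lemma hasDerivAt_mFourier (n : ι → ℤ) (x : UnitAddTorus ι) (i : ι) (r : ℝ) :
    HasDerivAt (fun r : ℝ => mFourier n (x + Pi.single i (r : UnitAddCircle)))
      (modeSymbol n i * mFourier n (x + Pi.single i (r : UnitAddCircle))) r := by
  simp only [mFourier_apply_add, mFourier_single_coe]
  have h : HasDerivAt (fun r : ℝ => Complex.exp (modeSymbol n i * r))
      (Complex.exp (modeSymbol n i * r) * (modeSymbol n i * 1)) r :=
    ((Complex.hasDerivAt_exp _).comp r (((hasDerivAt_id r).ofReal_comp).const_mul _))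
  exact (h.const_mul (mFourier n x)).congr_deriv (by ring)

lemma hasDerivAt_mFourier_sub (n : ι → ℤ) (x : UnitAddTorus ι) (i : ι) (r : ℝ) :
    HasDerivAt (fun r : ℝ => mFourier n (x - Pi.single i (r : UnitAddCircle)))
      (-(modeSymbol n i * mFourier n (x - Pi.single i (r : UnitAddCircle)))) r := by
  have h := (hasDerivAt_mFourier n x i (-r)).scomp r (hasDerivAt_neg r)
  simpa [Function.comp_def, sub_eq_add_neg, ← Pi.single_neg] using h

/-- The eigenvalue `-4π² ∑ᵢ nᵢ²` of the Laplacian on the Fourier mode `n`. -/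
def modeLaplace (n : ι → ℤ) : ℂ := ∑ i, modeSymbol n i ^ 2

/-! ### The gradient estimate for the backward heat equation -/

/-- Maximum principle with doubling of variables in the direction `j`: the function
`v(t, x, s) = g(t, x + s eⱼ) - g(t, x - s eⱼ)`, where `g` is the real part of the trigonometric
solution `∑ c_q(t) e_q(x)` of `-∂ₜg - σ Δ g + σ β² g = Re ∑ a_q(t) e_q(x)`, vanishes at `s = 0` and,
by periodicity, at `s = 1/2`. The second derivative in the direction `j` is traded for the second
derivative in `s`, and `v` is compared with a concave barrier of slope `2M / (σ β)` at `0`. -/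
lemma re_gradient_le {Q : Type*} [Fintype Q] {σ β T M : ℝ} (hσ : 0 < σ) (hβ : 0 < β)
    (n : Q → ι → ℤ) (c a : Q → ℝ → ℂ)
    (hc : ∀ q t, HasDerivAt (c q) (σ * (β ^ 2 - modeLaplace (n q)) * c q t - a q t) t)
    (hcT : ∀ q, c q T = 0)
    (hM : ∀ t ∈ Icc 0 T, ∀ x, ‖∑ q, a q t * mFourier (n q) x‖ ≤ M) (j : ι) :
    ∀ t ∈ Icc 0 T, ∀ x, (∑ q, c q t * (modeSymbol (n q) j * mFourier (n q) x)).re ≤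
      M / (σ * β) := by
  intro t ht x
  have hM0 : 0 ≤ M := (norm_nonneg _).trans (hM t ht x)
  have hT0 : (0 : ℝ) ≤ T := ht.1.trans ht.2
  set ψ : ℝ → ℝ := fun s => 2 * M / (σ * β ^ 2) * (1 - Real.exp (-(β * s))) with hψ
  set ψ₁ : ℝ → ℝ := fun s => 2 * M / (σ * β) * Real.exp (-(β * s)) with hψ₁
  have hexp : ∀ s, HasDerivAt (fun s : ℝ => Real.exp (-(β * s))) (-β * Real.exp (-(β * s))) s := by
    intro s
    exact (((hasDerivAt_id' s).const_mul β).fun_neg.exp).congr_deriv (by ring)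
  have hψd : ∀ s, HasDerivAt ψ (ψ₁ s) s := by
    intro s
    exact (((hexp s).const_sub 1).const_mul (2 * M / (σ * β ^ 2))).congr_deriv
      (by simp only [hψ₁]; field_simp)
  have hψdd : ∀ s, HasDerivAt ψ₁ (-(2 * M / σ * Real.exp (-(β * s)))) s := by
    intro s
    exact ((hexp s).const_mul (2 * M / (σ * β))).congr_deriv (by field_simp)
  have hψc : Continuous ψ := continuous_iff_continuousAt.2 fun s => (hψd s).continuousAt
  have hψ0 : ψ 0 = 0 := by simp [hψ]
  have hψnn : ∀ s, 0 ≤ s → 0 ≤ ψ s := by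
    intro s hs
    refine mul_nonneg (by positivity) (sub_nonneg.2 (Real.exp_le_one_iff.2 ?_))
    have := mul_nonneg hβ.le hs
    linarith
  have hcc : ∀ q, Continuous (c q) := fun q =>
    continuous_iff_continuousAt.2 fun s => (hc q s).continuousAt
  -- `D q x s` is the doubled Fourier mode
  set D : Q → UnitAddTorus ι → ℝ → ℂ := fun q x s =>
    mFourier (n q) (x + Pi.single j (s : UnitAddCircle))
      - mFourier (n q) (x - Pi.single j (s : UnitAddCircle)) with hD
  set v : ℝ → UnitAddTorus ι → ℝ → ℝ := fun t x s => (∑ q, c q t * D q x s).re with hv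
  have hsing : Continuous fun s : ℝ => (Pi.single j (s : UnitAddCircle) : UnitAddTorus ι) :=
    (continuous_single j).comp (AddCircle.continuous_mk' 1)
  have hvc : Continuous fun p : ℝ × UnitAddTorus ι × ℝ => v p.1 p.2.1 p.2.2 - ψ p.2.2 := by
    refine Continuous.sub (Complex.continuous_re.comp ?_) (by fun_prop)
    refine continuous_finsetSum _ fun q _ => ((hcc q).comp continuous_fst).mul ?_
    have := hsing.comp (continuous_snd.comp (continuous_snd (X := ℝ) (Y := UnitAddTorus ι × ℝ)))
    refine Continuous.sub ?_ ?_
    · exact (mFourier (n q)).continuous.comp ((continuous_fst.comp continuous_snd).add this)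
    · exact (mFourier (n q)).continuous.comp ((continuous_fst.comp continuous_snd).sub this)
  have key : ∀ t ∈ Icc 0 T, ∀ x, ∀ s ∈ Icc (0 : ℝ) (1 / 2), v t x s - ψ s ≤ 0 := by
    obtain ⟨⟨t₀, x₀, s₀⟩, ⟨ht₀, -, hs₀⟩, hmax⟩ :=
      (isCompact_Icc (a := (0 : ℝ)) (b := T)).prod
        ((isCompact_univ (X := UnitAddTorus ι)).prod (isCompact_Icc (a := (0 : ℝ)) (b := 1 / 2)))
        |>.exists_isMaxOn ⟨(0, 0, 0), by simp [hT0]⟩ hvc.continuousOn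
    have hmax' : ∀ t ∈ Icc 0 T, ∀ x, ∀ s ∈ Icc (0 : ℝ) (1 / 2),
        v t x s - ψ s ≤ v t₀ x₀ s₀ - ψ s₀ := fun t ht x s hs =>
      hmax (a := (t, x, s)) ⟨ht, mem_univ _, hs⟩
    simp only at ht₀ hs₀
    suffices v t₀ x₀ s₀ - ψ s₀ ≤ 0 from fun t ht x s hs => (hmax' t ht x s hs).trans this
    have hbdry : v t₀ x₀ s₀ = 0 → v t₀ x₀ s₀ - ψ s₀ ≤ 0 := fun h => by
      have := hψnn s₀ hs₀.1
      linarith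
    rcases eq_or_lt_of_le hs₀.1 with h0 | h0
    · refine hbdry ?_
      simp [hv, hD, ← h0]
    rcases eq_or_lt_of_le hs₀.2 with h1 | h1
    · refine hbdry ?_
      have : x₀ + Pi.single j ((1 / 2 : ℝ) : UnitAddCircle)
          = x₀ - Pi.single j ((1 / 2 : ℝ) : UnitAddCircle) := by
        rw [eq_sub_iff_add_eq, add_assoc, ← Pi.single_add, ← AddCircle.coe_add]
        norm_num
      simp only [hv, hD, h1, this, sub_self, mul_zero, Finset.sum_const_zero, Complex.zero_re]
    rcases eq_or_lt_of_le ht₀.2 with h2 | h2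
    · refine hbdry ?_
      simp [hv, h2, hcT]
    -- the maximum is interior in `s` and is attained before the terminal time
    have hdt : (∑ q, (σ * (β ^ 2 - modeLaplace (n q)) * c q t₀ - a q t₀) * D q x₀ s₀).re ≤ 0 := by
      refine hasDerivWithinAt_nonpos_of_le (f := fun t => v t x₀ s₀) h2
        (HasDerivAt.hasDerivWithinAt ?_) ?_
      · have : HasDerivAt (fun t => ∑ q, c q t * D q x₀ s₀) _ t₀ :=
          HasDerivAt.fun_sum fun q _ => (hc q t₀).mul_const (D q x₀ s₀)
        exact hasDerivAt_re this
      · intro t ht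
        have := hmax' t ⟨ht₀.1.trans ht.1, ht.2⟩ x₀ s₀ hs₀
        linarith
    have hi : ∀ i, i ≠ j → (∑ q, c q t₀ * (modeSymbol (n q) i ^ 2 * D q x₀ s₀)).re ≤ 0 := by
      intro i _
      have hder : ∀ (q : Q) (r : ℝ),
          HasDerivAt (fun r : ℝ => D q (x₀ + Pi.single i (r : UnitAddCircle)) s₀)
          (modeSymbol (n q) i * D q (x₀ + Pi.single i (r : UnitAddCircle)) s₀) r := by
        intro q r
        have h1 := hasDerivAt_mFourier (n q) (x₀ + Pi.single j (s₀ : UnitAddCircle)) i r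
        have h2 := hasDerivAt_mFourier (n q) (x₀ - Pi.single j (s₀ : UnitAddCircle)) i r
        refine ((h1.fun_sub h2).congr_deriv ?_).congr_of_eventuallyEq
          (Eventually.of_forall fun r => ?_)
        · simp only [hD]
          rw [add_right_comm, sub_add_eq_add_sub]
          ring
        · simp only [hD]
          rw [add_right_comm, sub_add_eq_add_sub]
      refine second_deriv_nonpos_of_isLocalMax (x := 0)
        (f := fun r : ℝ => v t₀ (x₀ + Pi.single i (r : UnitAddCircle)) s₀)
        (f' := fun r : ℝ => (∑ q, c q t₀ *
          (modeSymbol (n q) i * D q (x₀ + Pi.single i (r : UnitAddCircle)) s₀)).re)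
        (Eventually.of_forall fun r => ?_) ?_ ?_
      · have : HasDerivAt (fun r : ℝ =>
            ∑ q, c q t₀ * D q (x₀ + Pi.single i (r : UnitAddCircle)) s₀) _ r :=
          HasDerivAt.fun_sum fun q _ => (hder q r).const_mul (c q t₀)
        exact hasDerivAt_re this
      · have : HasDerivAt (fun r : ℝ => ∑ q, c q t₀ * (modeSymbol (n q) i *
            D q (x₀ + Pi.single i (r : UnitAddCircle)) s₀)) _ 0 :=
          HasDerivAt.fun_sum fun q _ =>
            ((hder q 0).const_mul (modeSymbol (n q) i)).const_mul (c q t₀)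
        exact (hasDerivAt_re this).congr_deriv (by simp [pow_two, mul_assoc])
      · refine Eventually.of_forall fun r => ?_
        have := hmax' t₀ ht₀ (x₀ + Pi.single i (r : UnitAddCircle)) s₀ hs₀
        simp only [AddCircle.coe_zero, Pi.single_zero, add_zero]
        linarith
    have hj : (∑ q, c q t₀ * (modeSymbol (n q) j ^ 2 * D q x₀ s₀)).re
        + 2 * M / σ * Real.exp (-(β * s₀)) ≤ 0 := by
      refine second_deriv_nonpos_of_isLocalMax (x := s₀)
        (f := fun s : ℝ => v t₀ x₀ s - ψ s)
        (f' := fun s : ℝ => (∑ q, c q t₀ * (modeSymbol (n q) j *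
          mFourier (n q) (x₀ + Pi.single j (s : UnitAddCircle)) - -(modeSymbol (n q) j *
          mFourier (n q) (x₀ - Pi.single j (s : UnitAddCircle))))).re - ψ₁ s)
        (Eventually.of_forall fun s => ?_) ?_ ?_
      · refine HasDerivAt.sub ?_ (hψd s)
        have : HasDerivAt (fun s : ℝ => ∑ q, c q t₀ * D q x₀ s) _ s :=
          HasDerivAt.fun_sum fun q _ => ((hasDerivAt_mFourier (n q) x₀ j s).sub
            (hasDerivAt_mFourier_sub (n q) x₀ j s)).const_mul (c q t₀)
        exact hasDerivAt_re this
      · have : HasDerivAt (fun s : ℝ => ∑ q, c q t₀ * (modeSymbol (n q) j *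
            mFourier (n q) (x₀ + Pi.single j (s : UnitAddCircle)) - -(modeSymbol (n q) j *
            mFourier (n q) (x₀ - Pi.single j (s : UnitAddCircle))))) _ s₀ :=
          HasDerivAt.fun_sum fun q _ => (((hasDerivAt_mFourier (n q) x₀ j s₀).const_mul _).sub
            ((hasDerivAt_mFourier_sub (n q) x₀ j s₀).const_mul _).neg).const_mul (c q t₀)
        refine ((hasDerivAt_re this).fun_sub (hψdd s₀)).congr_deriv ?_
        rw [sub_neg_eq_add]
        congr 2
        refine Finset.sum_congr rfl fun q _ => ?_
        simp only [hD]
        ring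
      · filter_upwards [Icc_mem_nhds h0 h1] with s hs using hmax' t₀ ht₀ x₀ s hs
    have hsum : ∑ i, (∑ q, c q t₀ * (modeSymbol (n q) i ^ 2 * D q x₀ s₀)).re
        ≤ -(2 * M / σ * Real.exp (-(β * s₀))) := by
      rw [← Finset.add_sum_erase _ _ (Finset.mem_univ j)]
      have := Finset.sum_nonpos (s := Finset.univ.erase j)
        fun i hij => hi i (Finset.ne_of_mem_erase hij)
      linarith
    have ha : (∑ q, a q t₀ * D q x₀ s₀).re ≤ 2 * M := by
      have h1 := hM t₀ ht₀ (x₀ + Pi.single j (s₀ : UnitAddCircle))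
      have h2 := hM t₀ ht₀ (x₀ - Pi.single j (s₀ : UnitAddCircle))
      refine (Complex.re_le_norm _).trans ?_
      simp only [hD, mul_sub, Finset.sum_sub_distrib]
      exact (norm_sub_le _ _).trans (by linarith)
    have hexpand : (∑ q, (σ * (β ^ 2 - modeLaplace (n q)) * c q t₀ - a q t₀) * D q x₀ s₀).re
        = σ * β ^ 2 * v t₀ x₀ s₀
          - σ * ∑ i, (∑ q, c q t₀ * (modeSymbol (n q) i ^ 2 * D q x₀ s₀)).re
          - (∑ q, a q t₀ * D q x₀ s₀).re := by
      have : ∑ q, (σ * (β ^ 2 - modeLaplace (n q)) * c q t₀ - a q t₀) * D q x₀ s₀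
        = ((σ * β ^ 2 : ℝ) : ℂ) * (∑ q, c q t₀ * D q x₀ s₀)
          - (σ : ℂ) * ∑ i, (∑ q, c q t₀ * (modeSymbol (n q) i ^ 2 * D q x₀ s₀))
          - (∑ q, a q t₀ * D q x₀ s₀) := by
        rw [Finset.sum_comm, Finset.mul_sum, Finset.mul_sum, ← Finset.sum_sub_distrib,
          ← Finset.sum_sub_distrib]
        refine Finset.sum_congr rfl fun q _ => ?_
        rw [← Finset.mul_sum, ← Finset.sum_mul, modeLaplace]
        push_cast
        ring
      rw [this, Complex.sub_re, Complex.sub_re, Complex.re_ofReal_mul, Complex.re_ofReal_mul,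
        Complex.re_sum Finset.univ (fun i => ∑ q, c q t₀ * (modeSymbol (n q) i ^ 2 * D q x₀ s₀))]
    rw [hexpand] at hdt
    have h5 : σ * β ^ 2 * (v t₀ x₀ s₀ - ψ s₀) ≤ 0 := by
      have h6 : σ * β ^ 2 * ψ s₀ = 2 * M * (1 - Real.exp (-(β * s₀))) := by
        simp only [hψ]; field_simp
      have h7 := mul_le_mul_of_nonneg_left hsum hσ.le
      have h8 : σ * -(2 * M / σ * Real.exp (-(β * s₀))) = -(2 * M * Real.exp (-(β * s₀))) := by
        field_simp
      rw [h8] at h7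
      rw [mul_sub, h6]
      linarith
    exact nonpos_of_mul_nonpos_right h5 (by positivity)
  -- compare the slopes at `s = 0`
  have hfin := hasDerivWithinAt_nonpos_of_le (f := fun s => v t x s - ψ s) (a := 0) (b := 1 / 2)
    (f' := (∑ q, c q t * (2 * (modeSymbol (n q) j * mFourier (n q) x))).re - ψ₁ 0)
    (by norm_num) (HasDerivAt.hasDerivWithinAt ?_) ?_
  · have h1 : (∑ q, c q t * (2 * (modeSymbol (n q) j * mFourier (n q) x))).re
        = 2 * (∑ q, c q t * (modeSymbol (n q) j * mFourier (n q) x)).re := by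
      have : ∑ q, c q t * (2 * (modeSymbol (n q) j * mFourier (n q) x))
        = ((2 : ℝ) : ℂ) * ∑ q, c q t * (modeSymbol (n q) j * mFourier (n q) x) := by
        rw [Finset.mul_sum]
        refine Finset.sum_congr rfl fun q _ => ?_
        push_cast; ring
      rw [this, Complex.re_ofReal_mul]
    have h2 : ψ₁ 0 = 2 * (M / (σ * β)) := by simp [hψ₁]; ring
    rw [h1, h2] at hfin
    linarith
  · refine HasDerivAt.sub ?_ (hψd 0)
    have : HasDerivAt (fun s : ℝ => ∑ q, c q t * D q x s) _ 0 :=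
      HasDerivAt.fun_sum fun q _ => ((hasDerivAt_mFourier (n q) x j 0).sub
        (hasDerivAt_mFourier_sub (n q) x j 0)).const_mul (c q t)
    exact (hasDerivAt_re this).congr_deriv (by simp [two_mul])
  · intro s hs
    have h1 := key t ht x s hs
    have h2 : v t x 0 = 0 := by simp [hv, hD]
    simp only [h2, hψ0]
    linarith

/-- For `-∂ₜg - σ Δ g + σ β² g = Φ` with `g(T) = 0` and `|Φ| ≤ M`, the gradient of `g` is at most
`M / (σ β)`, which is small compared with `M` when the damping `σ β²` is large. -/
lemma norm_gradient_le {Q : Type*} [Fintype Q] {σ β T M : ℝ} (hσ : 0 < σ) (hβ : 0 < β)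
    (n : Q → ι → ℤ) (c a : Q → ℝ → ℂ)
    (hc : ∀ q t, HasDerivAt (c q) (σ * (β ^ 2 - modeLaplace (n q)) * c q t - a q t) t)
    (hcT : ∀ q, c q T = 0)
    (hM : ∀ t ∈ Icc 0 T, ∀ x, ‖∑ q, a q t * mFourier (n q) x‖ ≤ M) (j : ι) :
    ∀ t ∈ Icc 0 T, ∀ x, ‖∑ q, c q t * (modeSymbol (n q) j * mFourier (n q) x)‖ ≤
      M / (σ * β) := by
  intro t ht x
  set z := ∑ q, c q t * (modeSymbol (n q) j * mFourier (n q) x) with hz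
  -- rotate the value of the gradient to the positive real axis
  obtain ⟨w, hw, hwz⟩ : ∃ w : ℂ, ‖w‖ = 1 ∧ w * z = ‖z‖ := by
    rcases eq_or_ne z 0 with h | h
    · exact ⟨1, by simp, by simp [h]⟩
    · have hz' : (‖z‖ : ℂ) ≠ 0 := by simpa using h
      refine ⟨‖z‖ / z, ?_, ?_⟩
      · rw [norm_div, Complex.norm_real, norm_norm, div_self (norm_ne_zero_iff.2 h)]
      · field_simp
  have := re_gradient_le hσ hβ n (fun q t => w * c q t) (fun q t => w * a q t)
    (fun q t => ((hc q t).const_mul w).congr_deriv (by ring))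
    (fun q => by simp [hcT]) (T := T) (M := M) ?_ j t ht x
  · simp only [mul_assoc, ← Finset.mul_sum, ← hz, hwz, Complex.ofReal_re] at this
    exact this
  · intro t ht x
    simp only [mul_assoc, ← Finset.mul_sum, norm_mul, hw, one_mul]
    exact hM t ht x

end FourierModes

/-! ### Uniqueness for Fokker–Planck equations on the torus -/

/-- A bounded and weakly continuous family of functionals, applied to a continuous curve. -/
lemma continuous_clm_apply_of_norm_le {Z V : Type*} [TopologicalSpace Z] [NormedAddCommGroup V]
    [NormedSpace ℂ V] {ν : Z → V →L[ℂ] ℂ} {C : ℝ} (hC : ∀ z, ‖ν z‖ ≤ C)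
    (hν : ∀ v, Continuous fun z => ν z v) {Φ : Z → V} (hΦ : Continuous Φ) :
    Continuous fun z => ν z (Φ z) := by
  rw [continuous_iff_continuousAt]
  intro z₀
  have h1 : Tendsto (fun z => ν z (Φ z - Φ z₀)) (𝓝 z₀) (𝓝 0) := by
    refine squeeze_zero_norm (a := fun z => C * ‖Φ z - Φ z₀‖) (fun z => ?_) ?_
    · exact (ν z).le_of_opNorm_le (hC z) _
    · have : Tendsto (fun z => C * ‖Φ z - Φ z₀‖) (𝓝 z₀) (𝓝 (C * ‖Φ z₀ - Φ z₀‖)) :=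
        (((hΦ.sub continuous_const).norm).const_mul C).tendsto z₀
      simpa using this
  have h2 := h1.add ((hν (Φ z₀)).tendsto z₀)
  simpa [ContinuousAt] using h2

section FokkerPlanck

variable {ι : Type*}

/-- The value at time `t`, as a function of `x`, of a function on `[0,T] × 𝕋^ι`. -/
def timeSlice {T : ℝ} (hT : 0 ≤ T) (Φ : C(Icc (0 : ℝ) T × UnitAddTorus ι, ℂ)) (t : ℝ) :
    C(UnitAddTorus ι, ℂ) := Φ.curry (projIcc 0 T hT t)

lemma continuous_timeSlice {T : ℝ} (hT : 0 ≤ T) (Φ : C(Icc (0 : ℝ) T × UnitAddTorus ι, ℂ)) :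
    Continuous (timeSlice hT Φ) := Φ.curry.continuous.comp continuous_projIcc

lemma norm_timeSlice_le {T : ℝ} (hT : 0 ≤ T) (Φ : C(Icc (0 : ℝ) T × UnitAddTorus ι, ℂ)) (t : ℝ) :
    ‖timeSlice hT Φ t‖ ≤ ‖Φ‖ :=
  (ContinuousMap.norm_le _ (norm_nonneg _)).2 fun _ => Φ.norm_coe_le_norm _

/-- The functional `Φ ↦ ∫₀ᵀ e^{-lt} ν_t(Φ(t, ·)) dt`. -/
def timeFunctional {T : ℝ} (hT : 0 ≤ T) (l : ℝ) {ν : ℝ → C(UnitAddTorus ι, ℂ) →L[ℂ] ℂ} {C : ℝ}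
    (hC : ∀ t, ‖ν t‖ ≤ C) (hν : ∀ Φ, Continuous fun t => ν t Φ) :
    C(Icc (0 : ℝ) T × UnitAddTorus ι, ℂ) →L[ℂ] ℂ :=
  LinearMap.mkContinuousOfExistsBound
    { toFun := fun Φ => ∫ t in (0 : ℝ)..T, (Real.exp (-(l * t)) : ℂ) * ν t (timeSlice hT Φ t)
      map_add' := by
        intro Φ Ψ
        have h : ∀ Φ, Continuous fun t =>
            (Real.exp (-(l * t)) : ℂ) * ν t (timeSlice hT Φ t) := fun Φ =>
          (Complex.continuous_ofReal.comp (by fun_prop)).mul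
            (continuous_clm_apply_of_norm_le hC hν (continuous_timeSlice hT Φ))
        rw [← intervalIntegral.integral_add ((h Φ).intervalIntegrable _ _)
          ((h Ψ).intervalIntegrable _ _)]
        refine intervalIntegral.integral_congr fun t _ => ?_
        have : timeSlice hT (Φ + Ψ) t = timeSlice hT Φ t + timeSlice hT Ψ t := rfl
        simp only [this, map_add, mul_add]
      map_smul' := by
        intro z Φ
        rw [RingHom.id_apply, smul_eq_mul, ← intervalIntegral.integral_const_mul]
        refine intervalIntegral.integral_congr fun t _ => ?_
        have : timeSlice hT (z • Φ) t = z • timeSlice hT Φ t := rfl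
        simp only [this, map_smul, smul_eq_mul]
        ring }
    ⟨Real.exp (|l| * T) * C * T, by
      intro Φ
      have h : ∀ t ∈ uIoc 0 T, ‖(Real.exp (-(l * t)) : ℂ) * ν t (timeSlice hT Φ t)‖ ≤
          Real.exp (|l| * T) * (C * ‖Φ‖) := by
        intro t ht
        rw [uIoc_of_le hT] at ht
        rw [norm_mul, Complex.norm_real, Real.norm_of_nonneg (Real.exp_pos _).le]
        refine mul_le_mul (Real.exp_le_exp.2 ?_) ?_ (norm_nonneg _) (Real.exp_pos _).le
        · have h1 : -(l * t) ≤ |l| * t := by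
            have := mul_le_mul_of_nonneg_right (neg_le_abs l) ht.1.le
            linarith
          exact h1.trans (mul_le_mul_of_nonneg_left ht.2 (abs_nonneg l))
        · exact ((ν t).le_of_opNorm_le (hC t) _).trans (mul_le_mul_of_nonneg_left
            (norm_timeSlice_le hT Φ t) ((norm_nonneg (ν t)).trans (hC t)))
      refine (intervalIntegral.norm_integral_le_of_norm_le_const h).trans (le_of_eq ?_)
      rw [sub_zero, abs_of_nonneg hT]
      ring⟩

lemma timeFunctional_apply {T : ℝ} (hT : 0 ≤ T) (l : ℝ)
    {ν : ℝ → C(UnitAddTorus ι, ℂ) →L[ℂ] ℂ} {C : ℝ}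
    (hC : ∀ t, ‖ν t‖ ≤ C) (hν : ∀ Φ, Continuous fun t => ν t Φ)
    (Φ : C(Icc (0 : ℝ) T × UnitAddTorus ι, ℂ)) :
    timeFunctional hT l hC hν Φ =
      ∫ t in (0 : ℝ)..T, (Real.exp (-(l * t)) : ℂ) * ν t (timeSlice hT Φ t) := rfl

variable [Fintype ι]

/-- The function `(t, x) ↦ a(t) eₙ(x)` on `[0,T] × 𝕋^ι`. -/
def timeMode (T : ℝ) (a : C(ℝ, ℂ)) (n : ι → ℤ) : C(Icc (0 : ℝ) T × UnitAddTorus ι, ℂ) where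
  toFun p := a p.1 * mFourier n p.2
  continuous_toFun := by fun_prop

lemma span_timeMode_topologicalClosure (T : ℝ) :
    (Submodule.span ℂ (range fun p : C(ℝ, ℂ) × (ι → ℤ) => timeMode T p.1 p.2)).topologicalClosure
      = ⊤ := by
  classical
  set S : Set C(Icc (0 : ℝ) T × UnitAddTorus ι, ℂ) :=
    range fun p : C(ℝ, ℂ) × (ι → ℤ) => timeMode T p.1 p.2 with hS
  let A : StarSubalgebra ℂ C(Icc (0 : ℝ) T × UnitAddTorus ι, ℂ) :=
    { toSubalgebra := Algebra.adjoin ℂ S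
      star_mem' := by
        change Algebra.adjoin ℂ S ≤ star (Algebra.adjoin ℂ S)
        refine Algebra.adjoin_le ?_
        rintro _ ⟨⟨a, n⟩, rfl⟩
        refine Algebra.subset_adjoin ⟨⟨star a, -n⟩, ?_⟩
        ext p
        simp [timeMode, mFourier_neg] }
  have hspan : A.toSubalgebra.toSubmodule = Submodule.span ℂ S := by
    refine Algebra.adjoin_eq_span_of_subset _ (.trans (fun x =>
      Submonoid.closure_induction (fun _ => id) ⟨⟨1, 0⟩, ?_⟩ ?_) Submodule.subset_span)
    · ext p
      simp [timeMode, mFourier_zero]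
    · rintro _ _ _ _ ⟨⟨a, m⟩, rfl⟩ ⟨⟨b, n⟩, rfl⟩
      refine ⟨⟨a * b, m + n⟩, ?_⟩
      ext p
      simp only [timeMode, ContinuousMap.coe_mk, ContinuousMap.mul_apply, mFourier_add]
      ring
  have hsep : A.SeparatesPoints := by
    intro p q hpq
    rcases eq_or_ne p.1 q.1 with h | h
    · have h2 : p.2 ≠ q.2 := fun h' => hpq (Prod.ext h h')
      obtain ⟨i, hi⟩ := Function.ne_iff.1 h2
      refine ⟨_, ⟨timeMode T 1 (Pi.single i 1), Algebra.subset_adjoin ⟨⟨1, _⟩, rfl⟩, rfl⟩, ?_⟩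
      simp only [timeMode, ContinuousMap.coe_mk, ContinuousMap.one_apply, one_mul]
      rw [mFourier_single, mFourier_single, fourier_one, fourier_one, Ne]
      contrapose hi
      exact AddCircle.injective_toCircle one_ne_zero (Subtype.coe_injective hi)
    · refine ⟨_, ⟨timeMode T ⟨fun t => (t : ℂ), Complex.continuous_ofReal⟩ 0,
        Algebra.subset_adjoin ⟨⟨_, _⟩, rfl⟩, rfl⟩, ?_⟩
      simp only [timeMode, ContinuousMap.coe_mk, mFourier_zero, ContinuousMap.one_apply, mul_one,
        ne_eq, Complex.ofReal_inj]
      exact fun h' => h (Subtype.ext h')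
  rw [← hspan]
  exact congr_arg (Subalgebra.toSubmodule <| StarSubalgebra.toSubalgebra ·)
    (ContinuousMap.starSubalgebra_topologicalClosure_eq_top_of_separatesPoints A hsep)

/-- Solution of the backward equation `-c' + κ c = a`, `c(T) = 0`. -/
lemma exists_backward_ode (κ : ℂ) (a : C(ℝ, ℂ)) (T : ℝ) :
    ∃ c : ℝ → ℂ, (∀ t, HasDerivAt c (κ * c t - a t) t) ∧ c T = 0 := by
  have hE : ∀ w : ℂ, ∀ t : ℝ, HasDerivAt (fun t : ℝ => Complex.exp (w * t))
      (w * Complex.exp (w * t)) t := by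
    intro w t
    exact ((Complex.hasDerivAt_exp _).comp t
      (((hasDerivAt_id' t).ofReal_comp).const_mul w)).congr_deriv (by simp; ring)
  have hcont : Continuous fun s : ℝ => Complex.exp (-κ * s) * a s := by fun_prop
  refine ⟨fun t => -(Complex.exp (κ * t) * ∫ s in T..t, Complex.exp (-κ * s) * a s), ?_, by simp⟩
  intro t
  have h1 := intervalIntegral.integral_hasDerivAt_right (hcont.intervalIntegrable T t)
    hcont.stronglyMeasurable.stronglyMeasurableAtFilter hcont.continuousAt
  refine ((hE κ t).mul h1).neg.congr_deriv ?_
  have h2 : Complex.exp (κ * t) * Complex.exp (-κ * t) = 1 := by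
    rw [← Complex.exp_add]; simp
  linear_combination (-a t) * h2

/-- The action on the Fourier mode `n` of the operator `σ Δ + B · ∇`. -/
def modeGenerator (σ : ℝ) (B : ι → C(UnitAddTorus ι, ℂ)) (n : ι → ℤ) : C(UnitAddTorus ι, ℂ) :=
  ((σ : ℂ) * modeLaplace n) • mFourier n + ∑ j, modeSymbol n j • (B j * mFourier n)

/-- Duality for one Fourier mode: integration by parts in time against the solution `c` of the
backward equation. -/
lemma integral_mode_duality {T : ℝ} (hT : 0 ≤ T) (σ l : ℝ)
    {ν : ℝ → C(UnitAddTorus ι, ℂ) →L[ℂ] ℂ} {C : ℝ}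
    (hC : ∀ t, ‖ν t‖ ≤ C) (hν : ∀ Φ, Continuous fun t => ν t Φ)
    {B : ℝ → ι → C(UnitAddTorus ι, ℂ)} (hB : ∀ j, Continuous fun t => B t j) (n : ι → ℤ)
    (hode : ∀ t ∈ Icc 0 T, ν t (mFourier n) = ∫ s in (0 : ℝ)..t, ν s (modeGenerator σ (B s) n))
    (a : C(ℝ, ℂ)) (c : ℝ → ℂ)
    (hc : ∀ t, HasDerivAt c ((l - σ * modeLaplace n) * c t - a t) t) (hcT : c T = 0) :
    ∫ t in (0 : ℝ)..T, (Real.exp (-(l * t)) : ℂ) * (a t * ν t (mFourier n)) =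
      ∫ t in (0 : ℝ)..T, (Real.exp (-(l * t)) : ℂ) *
        (c t * ∑ j, modeSymbol n j * ν t (B t j * mFourier n)) := by
  have hcc : Continuous c := continuous_iff_continuousAt.2 fun s => (hc s).continuousAt
  have hBn : ∀ j, Continuous fun t => ν t (B t j * mFourier n) := fun j =>
    continuous_clm_apply_of_norm_le hC hν ((hB j).mul continuous_const)
  have hgen : ∀ s, ν s (modeGenerator σ (B s) n) = σ * modeLaplace n * ν s (mFourier n)
      + ∑ j, modeSymbol n j * ν s (B s j * mFourier n) := by
    intro s
    simp [modeGenerator, map_add, map_sum]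
  have hRc : Continuous fun s => ν s (modeGenerator σ (B s) n) := by
    simp only [hgen]
    exact (continuous_const.mul (hν _)).add
      (continuous_finsetSum _ fun j _ => continuous_const.mul (hBn j))
  set A : ℝ → ℂ := fun t => ∫ s in (0 : ℝ)..t, ν s (modeGenerator σ (B s) n) with hA
  have hAd : ∀ t, HasDerivAt A (ν t (modeGenerator σ (B t) n)) t := fun t =>
    intervalIntegral.integral_hasDerivAt_right (hRc.intervalIntegrable 0 t)
    hRc.stronglyMeasurable.stronglyMeasurableAtFilter hRc.continuousAt
  have hexp : ∀ t : ℝ, HasDerivAt (fun t : ℝ => (Real.exp (-(l * t)) : ℂ))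
      (-l * (Real.exp (-(l * t)) : ℂ)) t := by
    intro t
    have := (((hasDerivAt_id' t).const_mul l).fun_neg.exp).ofReal_comp
    refine this.congr_deriv ?_
    push_cast; ring
  have hexpc : Continuous fun t : ℝ => (Real.exp (-(l * t)) : ℂ) := by fun_prop
  have hwd : ∀ t, HasDerivAt (fun t => (Real.exp (-(l * t)) : ℂ) * c t)
      (-((Real.exp (-(l * t)) : ℂ) * (a t + σ * modeLaplace n * c t))) t := fun t =>
    ((hexp t).fun_mul (hc t)).congr_deriv (by ring)
  have hibp := intervalIntegral.integral_mul_deriv_eq_deriv_mul (a := 0) (b := T)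
    (fun t _ => hwd t) (fun t _ => hAd t)
    (Continuous.intervalIntegrable (by fun_prop) _ _) (hRc.intervalIntegrable _ _)
  have hA0 : A 0 = 0 := by simp [hA]
  simp only [hcT, hA0, mul_zero, zero_mul, sub_zero, zero_sub, neg_mul,
    intervalIntegral.integral_neg, neg_neg] at hibp
  have hAν : ∀ t ∈ uIcc 0 T, A t = ν t (mFourier n) := fun t ht => by
    rw [uIcc_of_le hT] at ht
    exact (hode t ht).symm
  have hL : Continuous fun t => (Real.exp (-(l * t)) : ℂ) * c t * ν t (mFourier n) :=
    (hexpc.mul hcc).mul (hν _)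
  have hLi : ∀ z : ℂ, IntervalIntegrable
      (fun t => z * ((Real.exp (-(l * t)) : ℂ) * c t * ν t (mFourier n))) volume 0 T := fun z =>
    (continuous_const.mul hL).intervalIntegrable _ _
  have hai : IntervalIntegrable
      (fun t => (Real.exp (-(l * t)) : ℂ) * (a t * ν t (mFourier n))) volume 0 T :=
    (hexpc.mul (a.continuous.mul (hν _))).intervalIntegrable _ _
  have e1 : ∫ t in (0 : ℝ)..T, (Real.exp (-(l * t)) : ℂ) * c t * ν t (modeGenerator σ (B t) n)
      = σ * modeLaplace n * (∫ t in (0 : ℝ)..T, (Real.exp (-(l * t)) : ℂ) * c t * ν t (mFourier n))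
      + ∫ t in (0 : ℝ)..T, (Real.exp (-(l * t)) : ℂ) *
        (c t * ∑ j, modeSymbol n j * ν t (B t j * mFourier n)) := by
    rw [← intervalIntegral.integral_const_mul, ← intervalIntegral.integral_add (hLi _)]
    · refine intervalIntegral.integral_congr fun t _ => ?_
      simp only [hgen]
      ring
    · exact (hexpc.mul (hcc.mul (continuous_finsetSum _ fun j _ =>
        continuous_const.mul (hBn j)))).intervalIntegrable _ _
  have e2 : ∫ t in (0 : ℝ)..T, (Real.exp (-(l * t)) : ℂ) * (a t + σ * modeLaplace n * c t) * A t
      = (∫ t in (0 : ℝ)..T, (Real.exp (-(l * t)) : ℂ) * (a t * ν t (mFourier n)))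
      + σ * modeLaplace n *
        (∫ t in (0 : ℝ)..T, (Real.exp (-(l * t)) : ℂ) * c t * ν t (mFourier n)) := by
    rw [← intervalIntegral.integral_const_mul, ← intervalIntegral.integral_add hai (hLi _)]
    refine intervalIntegral.integral_congr fun t ht => ?_
    simp only [hAν t ht]
    ring
  rw [e1, e2] at hibp
  linear_combination -hibp

variable [DecidableEq ι] in
/-- Uniqueness for the Fokker–Planck equation `∂ₜν = σ Δ ν - div (B ν)`, `ν|_{t = 0} = 0`, with a
continuous drift, among bounded and weakly continuous families of functionals on the continuous
functions. Testing against solutions of the backward heat equation with source `Φ` shows that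
`Λ Φ = ∫₀ᵀ e^{-lt} ν_t(Φ_t) dt` satisfies `Λ Φ = Λ (B · ∇G)`; for `l` large the gradient estimate
gives `|B · ∇G| ≤ ‖Φ‖ / 2`, whence `‖Λ‖ ≤ ‖Λ‖ / 2`. -/
theorem fokkerPlanck_unique {T σ : ℝ} (hT : 0 < T) (hσ : 0 < σ)
    {ν : ℝ → C(UnitAddTorus ι, ℂ) →L[ℂ] ℂ} {C : ℝ}
    (hC : ∀ t, ‖ν t‖ ≤ C) (hν : ∀ Φ, Continuous fun t => ν t Φ)
    {B : ℝ → ι → C(UnitAddTorus ι, ℂ)} (hB : ∀ j, Continuous fun t => B t j)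
    (hode : ∀ n, ∀ t ∈ Icc 0 T,
      ν t (mFourier n) = ∫ s in (0 : ℝ)..t, ν s (modeGenerator σ (B s) n)) :
    ∀ n, ∀ t ∈ Icc 0 T, ν t (mFourier n) = 0 := by
  set Bt : ι → C(Icc (0 : ℝ) T × UnitAddTorus ι, ℂ) := fun j =>
    (⟨fun t : Icc (0 : ℝ) T => B t j, (hB j).comp continuous_subtype_val⟩ :
      C(Icc (0 : ℝ) T, C(UnitAddTorus ι, ℂ))).uncurry with hBt
  set b : ℝ := ∑ j, ‖Bt j‖ with hb
  have hb0 : 0 ≤ b := Finset.sum_nonneg fun j _ => norm_nonneg _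
  -- `b / (σ β) = b / (2 b + 1)` is smaller than `1 / 2`
  set β : ℝ := (2 * b + 1) / σ with hβ
  have hβ0 : 0 < β := by positivity
  have hσβ : σ * β = 2 * b + 1 := by rw [hβ]; field_simp
  set Λ := timeFunctional hT.le (σ * β ^ 2) hC hν with hΛ
  have hslice : ∀ (Φ : C(Icc (0 : ℝ) T × UnitAddTorus ι, ℂ)) (t : ℝ) (ht : t ∈ Icc 0 T),
      ∀ x, timeSlice hT.le Φ t x = Φ (⟨t, ht⟩, x) := by
    intro Φ t ht x
    simp [timeSlice, projIcc_of_mem hT.le ht]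
  have hdense : ∀ Φ ∈ Submodule.span ℂ
      (range fun p : C(ℝ, ℂ) × (ι → ℤ) => timeMode T p.1 p.2), ‖Λ Φ‖ ≤ ‖Λ‖ / 2 * ‖Φ‖ := by
    intro Φ hΦ
    obtain ⟨N, z, g, hg⟩ := Submodule.mem_span_set'.1 hΦ
    choose p hp using fun q => (g q).2
    set n : Fin N → ι → ℤ := fun q => (p q).2
    set a : Fin N → C(ℝ, ℂ) := fun q => z q • (p q).1 with ha
    have hΦa : Φ = ∑ q, timeMode T (a q) (n q) := by
      rw [← hg]
      refine Finset.sum_congr rfl fun q _ => ?_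
      rw [← hp q]
      ext y
      simp [timeMode, ha, n, mul_assoc]
    choose c hc hcT using fun q =>
      exists_backward_ode (σ * (β ^ 2 - modeLaplace (n q))) (a q) T
    have hcc : ∀ q, Continuous (c q) := fun q =>
      continuous_iff_continuousAt.2 fun s => (hc q s).continuousAt
    set D : ι → C(Icc (0 : ℝ) T × UnitAddTorus ι, ℂ) := fun j =>
      ∑ q, modeSymbol (n q) j • timeMode T ⟨c q, hcc q⟩ (n q) with hD
    have hDnorm : ∀ j, ‖D j‖ ≤ ‖Φ‖ / (σ * β) := by
      intro j
      refine (ContinuousMap.norm_le _ (by positivity)).2 fun y => ?_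
      have := norm_gradient_le hσ hβ0 n c (fun q => a q) hc hcT (T := T) (M := ‖Φ‖) ?_ j
        y.1 y.1.2 y.2
      · refine le_of_eq_of_le ?_ this
        simp only [hD, ContinuousMap.sum_apply, ContinuousMap.smul_apply, timeMode,
          ContinuousMap.coe_mk, smul_eq_mul]
        congr 1
        exact Finset.sum_congr rfl fun q _ => by ring
      · intro t ht x
        have h := Φ.norm_coe_le_norm (⟨t, ht⟩, x)
        rw [hΦa] at h ⊢
        simpa [timeMode] using h
    have hdual : Λ Φ = Λ (∑ j, Bt j * D j) := by
      rw [hΛ, timeFunctional_apply, timeFunctional_apply]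
      have l1 : ∀ t ∈ uIcc 0 T, (Real.exp (-(σ * β ^ 2 * t)) : ℂ) * ν t (timeSlice hT.le Φ t)
          = ∑ q, (Real.exp (-(σ * β ^ 2 * t)) : ℂ) * (a q t * ν t (mFourier (n q))) := by
        intro t ht
        rw [uIcc_of_le hT.le] at ht
        have : timeSlice hT.le Φ t = ∑ q, a q t • mFourier (n q) := by
          ext x
          rw [hslice _ t ht, hΦa]
          simp [timeMode]
        simp [this, map_sum, Finset.mul_sum]
      have l2 : ∀ t ∈ uIcc 0 T, (Real.exp (-(σ * β ^ 2 * t)) : ℂ) *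
            ν t (timeSlice hT.le (∑ j, Bt j * D j) t)
          = ∑ q, (Real.exp (-(σ * β ^ 2 * t)) : ℂ) *
            (c q t * ∑ j, modeSymbol (n q) j * ν t (B t j * mFourier (n q))) := by
        intro t ht
        rw [uIcc_of_le hT.le] at ht
        have : timeSlice hT.le (∑ j, Bt j * D j) t
            = ∑ q, c q t • ∑ j, modeSymbol (n q) j • (B t j * mFourier (n q)) := by
          ext x
          rw [hslice _ t ht]
          simp only [hBt, hD, timeMode, ContinuousMap.sum_apply, ContinuousMap.mul_apply,
            ContinuousMap.smul_apply, ContinuousMap.coe_mk, smul_eq_mul, Finset.mul_sum]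
          rw [Finset.sum_comm]
          refine Finset.sum_congr rfl fun q _ => Finset.sum_congr rfl fun j _ => ?_
          change B t j x * _ = _
          ring
        simp [this, map_sum, Finset.mul_sum]
      rw [intervalIntegral.integral_congr l1, intervalIntegral.integral_congr l2,
        intervalIntegral.integral_finsetSum, intervalIntegral.integral_finsetSum]
      · refine Finset.sum_congr rfl fun q _ => ?_
        refine integral_mode_duality hT.le σ (σ * β ^ 2) hC hν hB (n q) (hode (n q)) (a q) (c q)
          (fun t => (hc q t).congr_deriv ?_) (hcT q)
        push_cast; ring
      · intro q _
        have hBn : ∀ j, Continuous fun t => ν t (B t j * mFourier (n q)) := fun j =>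
          continuous_clm_apply_of_norm_le hC hν ((hB j).mul continuous_const)
        have hexpc : Continuous fun t : ℝ => (Real.exp (-(σ * β ^ 2 * t)) : ℂ) := by fun_prop
        exact (hexpc.mul ((hcc q).mul (continuous_finsetSum _ fun j _ =>
          continuous_const.mul (hBn j)))).intervalIntegrable _ _
      · intro q _
        have := hν (mFourier (n q))
        exact Continuous.intervalIntegrable (by fun_prop) _ _
    rw [hdual]
    have hsum : ‖∑ j, Bt j * D j‖ ≤ ‖Φ‖ / 2 := by
      calc ‖∑ j, Bt j * D j‖ ≤ ∑ j, ‖Bt j‖ * (‖Φ‖ / (σ * β)) :=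
            norm_sum_le_of_le _ fun j _ => (norm_mul_le _ _).trans
              (mul_le_mul_of_nonneg_left (hDnorm j) (norm_nonneg _))
        _ = b / (2 * b + 1) * ‖Φ‖ := by rw [← Finset.sum_mul, hσβ]; ring
        _ ≤ 1 / 2 * ‖Φ‖ := by
            refine mul_le_mul_of_nonneg_right ?_ (norm_nonneg _)
            rw [div_le_div_iff₀ (by positivity) (by norm_num)]
            linarith
        _ = ‖Φ‖ / 2 := by ring
    calc ‖Λ (∑ j, Bt j * D j)‖ ≤ ‖Λ‖ * (‖Φ‖ / 2) :=
          (Λ.le_opNorm _).trans (mul_le_mul_of_nonneg_left hsum (norm_nonneg _))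
      _ = ‖Λ‖ / 2 * ‖Φ‖ := by ring
  have hall : ∀ Φ, ‖Λ Φ‖ ≤ ‖Λ‖ / 2 * ‖Φ‖ := by
    have hcl : IsClosed {Φ | ‖Λ Φ‖ ≤ ‖Λ‖ / 2 * ‖Φ‖} :=
      isClosed_le (by fun_prop) (by fun_prop)
    intro Φ
    have hmem : Φ ∈ (Submodule.span ℂ (range fun p : C(ℝ, ℂ) × (ι → ℤ) =>
        timeMode T p.1 p.2)).topologicalClosure := by
      rw [span_timeMode_topologicalClosure]; trivial
    exact closure_minimal (fun Φ hΦ => hdense Φ hΦ) hcl hmem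
  have hΛ0 : Λ = 0 := by
    have h1 : ‖Λ‖ ≤ ‖Λ‖ / 2 := Λ.opNorm_le_bound (by positivity) hall
    have h2 : 0 ≤ ‖Λ‖ := norm_nonneg Λ
    have h3 : ‖Λ‖ = 0 := by linarith
    refine ContinuousLinearMap.ext fun Φ => ?_
    simpa [h3] using hall Φ
  -- test with the complex conjugate of `ν_t(eₙ)`
  intro n
  by_contra! hne
  obtain ⟨t₀, ht₀, hne⟩ := hne
  have h1 : Λ (timeMode T ⟨fun t => star (ν t (mFourier n)), (hν _).star⟩ n) = 0 := by simp [hΛ0]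
  rw [hΛ, timeFunctional_apply] at h1
  have h2 : ∀ t ∈ uIcc 0 T, (Real.exp (-(σ * β ^ 2 * t)) : ℂ) * ν t (timeSlice hT.le
      (timeMode T ⟨fun t => star (ν t (mFourier n)), (hν _).star⟩ n) t)
      = ((Real.exp (-(σ * β ^ 2 * t)) * ‖ν t (mFourier n)‖ ^ 2 : ℝ) : ℂ) := by
    intro t ht
    rw [uIcc_of_le hT.le] at ht
    have : timeSlice hT.le (timeMode T ⟨fun t => star (ν t (mFourier n)), (hν _).star⟩ n) t
        = star (ν t (mFourier n)) • mFourier n := by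
      ext x
      rw [hslice _ t ht]
      simp [timeMode]
    rw [this, map_smul, smul_eq_mul, Complex.star_def, Complex.conj_mul']
    push_cast
    rfl
  rw [intervalIntegral.integral_congr h2, intervalIntegral.integral_ofReal,
    Complex.ofReal_eq_zero] at h1
  have h3 : 0 < ∫ t in (0 : ℝ)..T, Real.exp (-(σ * β ^ 2 * t)) * ‖ν t (mFourier n)‖ ^ 2 := by
    refine intervalIntegral.integral_pos hT ?_ (fun t _ => by positivity) ⟨t₀, ht₀, ?_⟩
    · have := hν (mFourier n)
      exact Continuous.continuousOn (by fun_prop)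
    · have : 0 < ‖ν t₀ (mFourier n)‖ := norm_pos_iff.2 hne
      positivity
  exact h3.ne' h1

end FokkerPlanck

/-! ### Partial derivatives on the torus -/

variable {d : ℕ}

lemma isOpenQuotientMap_proj : IsOpenQuotientMap (proj : E d → Torus d) := by
  have h1 : IsOpenQuotientMap (Pi.map fun (_ : Fin d) (r : ℝ) => (r : UnitAddCircle)) :=
    IsOpenQuotientMap.piMap fun _ => QuotientAddGroup.isOpenQuotientMap_mk
  exact h1.comp (EuclideanSpace.equiv (Fin d) ℝ).toHomeomorph.isOpenQuotientMap

lemma proj_add (y z : E d) : proj (y + z) = proj y + proj z := by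
  ext i
  simp [proj]

lemma proj_smul_single (i : Fin d) (r : ℝ) :
    proj (r • EuclideanSpace.single i (1 : ℝ)) = Pi.single i (r : UnitAddCircle) := by
  ext j
  rcases eq_or_ne j i with rfl | h
  · simp [proj]
  · simp [proj, h]

/-- The partial derivative in the direction `i` of a function on the torus, along the line
`r ↦ x + r eᵢ`. -/
def torusPartial (i : Fin d) (g : Torus d → ℝ) (x : Torus d) : ℝ :=
  deriv (fun r : ℝ => g (x + Pi.single i (r : UnitAddCircle))) 0

lemma hasDerivAt_lift_line {g : Torus d → ℝ} (hg : ContDiff ℝ 1 (lift g)) (i : Fin d) (y : E d) :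
    HasDerivAt (fun r : ℝ => g (proj y + Pi.single i (r : UnitAddCircle)))
      (fderiv ℝ (lift g) y (EuclideanSpace.single i 1)) 0 := by
  have h1 : HasDerivAt (fun r : ℝ => y + r • EuclideanSpace.single i (1 : ℝ))
      (EuclideanSpace.single i (1 : ℝ)) 0 := by
    simpa using ((hasDerivAt_id' (0 : ℝ)).smul_const (EuclideanSpace.single i (1 : ℝ))).const_add y
  have h2 : HasFDerivAt (lift g) (fderiv ℝ (lift g) y)
      (y + (0 : ℝ) • EuclideanSpace.single i (1 : ℝ)) := by
    rw [zero_smul, add_zero]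
    exact (hg.differentiable one_ne_zero y).hasFDerivAt
  refine (h2.comp_hasDerivAt (0 : ℝ) h1).congr_of_eventuallyEq (Eventually.of_forall fun r => ?_)
  simp [lift, proj_add, proj_smul_single]

lemma torusPartial_proj {g : Torus d → ℝ} (hg : ContDiff ℝ 1 (lift g)) (i : Fin d) (y : E d) :
    torusPartial i g (proj y) = fderiv ℝ (lift g) y (EuclideanSpace.single i 1) :=
  (hasDerivAt_lift_line hg i y).deriv

lemma hasDerivAt_torusPartial {g : Torus d → ℝ} (hg : ContDiff ℝ 1 (lift g)) (i : Fin d)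
    (x : Torus d) (r : ℝ) :
    HasDerivAt (fun r : ℝ => g (x + Pi.single i (r : UnitAddCircle)))
      (torusPartial i g (x + Pi.single i (r : UnitAddCircle))) r := by
  obtain ⟨y, hy⟩ := isOpenQuotientMap_proj.surjective (x + Pi.single i (r : UnitAddCircle))
  have h := hasDerivAt_lift_line hg i y
  rw [← torusPartial_proj hg, hy] at h
  have h0 : (0 : ℝ) = r - r := by simp
  rw [h0] at h
  have h2 := h.comp_sub_const r r
  refine h2.congr_of_eventuallyEq (Eventually.of_forall fun s => ?_)
  simp only
  rw [add_assoc, ← Pi.single_add, ← AddCircle.coe_add]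
  simp

lemma contDiff_lift_torusPartial {g : Torus d → ℝ} {n : WithTop ℕ∞}
    (hg : ContDiff ℝ (n + 1) (lift g)) (i : Fin d) : ContDiff ℝ n (lift (torusPartial i g)) := by
  have : lift (torusPartial i g) =
      fun y => fderiv ℝ (lift g) y (EuclideanSpace.single i 1) :=
    funext fun y => torusPartial_proj (hg.of_le le_add_self) i y
  rw [this]
  exact (hg.fderiv_right le_rfl).clm_apply contDiff_const

lemma chart_eq (g : Torus d → ℝ) (y : E d) :
    (fun z : E d => g (proj y + proj z)) = fun z => lift g (y + z) := by
  ext z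
  simp [lift, proj_add]

lemma torusGrad_apply {g : Torus d → ℝ} (hg : ContDiff ℝ 1 (lift g)) (x : Torus d) (i : Fin d) :
    torusGrad g x i = torusPartial i g x := by
  obtain ⟨y, rfl⟩ := isOpenQuotientMap_proj.surjective x
  rw [torusPartial_proj hg, torusGrad, chart_eq]
  have h := inner_gradient_left (𝕜 := ℝ) (f := fun z => lift g (y + z)) (x := 0)
    (y := EuclideanSpace.single i (1 : ℝ))
  rw [fderiv_comp_add_left, add_zero] at h
  rw [← h, EuclideanSpace.inner_single_right]
  simp

lemma torusLaplacian_eq {g : Torus d → ℝ} (hg : ContDiff ℝ 2 (lift g)) (x : Torus d) :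
    torusLaplacian g x = ∑ i, torusPartial i (torusPartial i g) x := by
  obtain ⟨y, rfl⟩ := isOpenQuotientMap_proj.surjective x
  rw [torusLaplacian, InnerProductSpace.laplacian_eq_iteratedFDeriv_orthonormalBasis _
    (EuclideanSpace.basisFun (Fin d) ℝ)]
  refine Finset.sum_congr rfl fun i _ => ?_
  have hg1 : ContDiff ℝ 1 (lift g) := hg.of_le (by norm_num)
  rw [torusPartial_proj (contDiff_lift_torusPartial (n := 1) (by rwa [one_add_one_eq_two]) i),
    chart_eq, iteratedFDeriv_two_apply]
  have h1 : lift (torusPartial i g) =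
      fun y => fderiv ℝ (lift g) y (EuclideanSpace.single i 1) :=
    funext fun y => torusPartial_proj hg1 i y
  have h2 : fderiv ℝ (fun z => lift g (y + z)) = fun z => fderiv ℝ (lift g) (y + z) :=
    funext fun z => fderiv_comp_add_left y
  rw [h1, h2, fderiv_comp_add_left, add_zero, fderiv_clm_apply
    ((hg.fderiv_right (m := 1) (by norm_num)).differentiable one_ne_zero y)
    (differentiableAt_const _)]
  simp

lemma inner_torusGrad {g : Torus d → ℝ} (hg : ContDiff ℝ 1 (lift g)) (b : E d) (x : Torus d) :
    inner ℝ b (torusGrad g x) = ∑ i, b i * torusPartial i g x := by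
  rw [PiLp.inner_apply]
  refine Finset.sum_congr rfl fun i _ => ?_
  rw [torusGrad_apply hg]
  simp [mul_comm]

/-! ### Functions of class `𝒞^{1,2}`, extended by constants outside of `[0,T]` -/

/-- Descent of continuity from `Y × ℝ^d` to `Y × 𝕋^d`. -/
lemma continuous_uncurry_of_proj {Y V : Type*} [TopologicalSpace Y] [TopologicalSpace V]
    {F : Y → Torus d → V}
    (hF : Continuous fun p : Y × E d => F p.1 (proj p.2)) : Continuous (Function.uncurry F) :=
  (IsOpenQuotientMap.id.prodMap isOpenQuotientMap_proj).isQuotientMap.continuous_iff.2 hF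

/-- Extension of a continuous function of `t ∈ [0,T]` by constants. -/
lemma continuous_comp_projIcc {Y V : Type*} [TopologicalSpace Y] [TopologicalSpace V] {T : ℝ}
    (hT : 0 ≤ T) {F : ℝ × Y → V} (hF : ContinuousOn F (Icc 0 T ×ˢ univ)) :
    Continuous fun p : ℝ × Y => F ((projIcc 0 T hT p.1 : ℝ), p.2) :=
  hF.comp_continuous (by fun_prop) fun p => ⟨(projIcc 0 T hT p.1).2, mem_univ _⟩

section C12

variable {T : ℝ} {u : ℝ → Torus d → ℝ}

lemma IsC12.continuous (hu : IsC12 T u) (hT : 0 ≤ T) :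
    Continuous (Function.uncurry fun t => u (projIcc 0 T hT t)) := by
  refine continuous_uncurry_of_proj ?_
  have h := continuous_comp_projIcc hT (hu.space_cont 0 (by norm_num))
  have h2 := (ContinuousMultilinearMap.apply ℝ (fun _ : Fin 0 => E d) ℝ 0).continuous.comp h
  refine h2.congr fun p => ?_
  simp [lift]

lemma IsC12.contDiff_one (hu : IsC12 T u) {t : ℝ} (ht : t ∈ Icc 0 T) : ContDiff ℝ 1 (lift (u t)) :=
  (hu.space_diff t ht).of_le (by norm_num)

lemma IsC12.continuous_torusPartial (hu : IsC12 T u) (hT : 0 ≤ T) (i : Fin d) :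
    Continuous (Function.uncurry fun t => torusPartial i (u (projIcc 0 T hT t))) := by
  refine continuous_uncurry_of_proj ?_
  have h := continuous_comp_projIcc hT (hu.space_cont 1 (by norm_num))
  have h2 := (ContinuousMultilinearMap.apply ℝ (fun _ : Fin 1 => E d) ℝ
    fun _ => EuclideanSpace.single i 1).continuous.comp h
  refine h2.congr fun p => ?_
  rw [torusPartial_proj (hu.contDiff_one (projIcc 0 T hT p.1).2)]
  simp

lemma IsC12.continuous_torusPartial_torusPartial (hu : IsC12 T u) (hT : 0 ≤ T) (i : Fin d) :
    Continuous (Function.uncurry fun t =>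
      torusPartial i (torusPartial i (u (projIcc 0 T hT t)))) := by
  refine continuous_uncurry_of_proj ?_
  have h := continuous_comp_projIcc hT (hu.space_cont 2 le_rfl)
  have h2 := (ContinuousMultilinearMap.apply ℝ (fun _ : Fin 2 => E d) ℝ
    fun _ => EuclideanSpace.single i 1).continuous.comp h
  refine h2.congr fun p => ?_
  have hc := hu.space_diff _ (projIcc 0 T hT p.1).2
  rw [torusPartial_proj (contDiff_lift_torusPartial (n := 1) (by rwa [one_add_one_eq_two]) i)]
  have h1 : lift (torusPartial i (u (projIcc 0 T hT p.1))) =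
      fun y => fderiv ℝ (lift (u (projIcc 0 T hT p.1))) y (EuclideanSpace.single i 1) :=
    funext fun y => torusPartial_proj (hc.of_le (by norm_num)) i y
  rw [h1, fderiv_clm_apply ((hc.fderiv_right (m := 1) (by norm_num)).differentiable one_ne_zero _)
    (differentiableAt_const _)]
  simp [iteratedFDeriv_two_apply]

lemma IsC12.continuous_derivWithin (hu : IsC12 T u) (hT : 0 ≤ T) :
    Continuous (Function.uncurry fun t x =>
      derivWithin (fun s => u s x) (Icc 0 T) (projIcc 0 T hT t)) :=
  continuous_comp_projIcc hT hu.time_cont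

end C12

/-! ### Integration of continuous functions against weakly continuous families of measures -/

section Functionals

variable {X Y Z : Type*} [TopologicalSpace X] [CompactSpace X] [MeasurableSpace X]
  [OpensMeasurableSpace X] [TopologicalSpace Y] [CompactSpace Y] [MeasurableSpace Y]
  [OpensMeasurableSpace Y] [TopologicalSpace Z]

lemma integrable_of_continuous {V : Type*} [NormedAddCommGroup V] [SecondCountableTopology V]
    {f : X → V} (hf : Continuous f) (μ : ProbabilityMeasure X) : Integrable f (μ : Measure X) := by
  borelize V
  obtain ⟨C, hC⟩ := (isCompact_range hf).isBounded.exists_norm_le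
  exact Integrable.of_bound hf.measurable.aestronglyMeasurable C
    (Eventually.of_forall fun x => hC _ (mem_range_self x))

/-- Integration against a probability measure, as a functional on the continuous functions. -/
def integralCLM (μ : ProbabilityMeasure X) : C(X, ℂ) →L[ℂ] ℂ :=
  LinearMap.mkContinuous
    { toFun := fun Φ => ∫ x, Φ x ∂(μ : Measure X)
      map_add' := fun Φ Ψ => integral_add (integrable_of_continuous Φ.continuous μ)
        (integrable_of_continuous Ψ.continuous μ)
      map_smul' := fun z Φ => integral_const_mul z _ } 1
    (fun Φ => by
      have h := norm_integral_le_of_norm_le_const (μ := (μ : Measure X))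
        (Eventually.of_forall Φ.norm_coe_le_norm)
      simpa using h)

lemma integralCLM_apply (μ : ProbabilityMeasure X) (Φ : C(X, ℂ)) :
    integralCLM μ Φ = ∫ x, Φ x ∂(μ : Measure X) := rfl

lemma norm_integralCLM_le (μ : ProbabilityMeasure X) : ‖integralCLM μ‖ ≤ 1 :=
  LinearMap.mkContinuous_norm_le _ zero_le_one _

lemma continuous_integralCLM {μ : Z → ProbabilityMeasure X} (hμ : Continuous μ) (Φ : C(X, ℂ)) :
    Continuous fun z => integralCLM (μ z) Φ := by
  rw [continuous_iff_continuousAt]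
  intro z
  exact (ProbabilityMeasure.tendsto_iff_forall_integral_rclike_tendsto ℂ).1 (hμ.tendsto z)
    (BoundedContinuousFunction.mkOfCompact Φ)

lemma continuous_integral {μ : Z → ProbabilityMeasure X} (hμ : Continuous μ) {Ψ : Z → X → ℂ}
    (hΨ : Continuous (Function.uncurry Ψ)) :
    Continuous fun z => ∫ x, Ψ z x ∂(μ z : Measure X) :=
  continuous_clm_apply_of_norm_le (fun z => norm_integralCLM_le (μ z))
    (continuous_integralCLM hμ) (ContinuousMap.curry ⟨_, hΨ⟩).continuous

lemma continuous_integral_real {μ : Z → ProbabilityMeasure X} (hμ : Continuous μ) {Ψ : Z → X → ℝ}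
    (hΨ : Continuous (Function.uncurry Ψ)) :
    Continuous fun z => ∫ x, Ψ z x ∂(μ z : Measure X) := by
  have h := continuous_integral hμ (Ψ := fun z x => (Ψ z x : ℂ))
    (Complex.continuous_ofReal.comp hΨ)
  simp only [integral_complex_ofReal] at h
  exact Complex.continuous_re.comp h

lemma integral_re_of_continuous {m : ProbabilityMeasure X} {F : X → ℂ} (hF : Continuous F) :
    ∫ x, (F x).re ∂(m : Measure X) = (∫ x, F x ∂(m : Measure X)).re :=
  Complex.reCLM.integral_comp_comm (integrable_of_continuous hF m)

/-- The operator `Φ ↦ (y ↦ ∫ Φ dκ_y)` of a weakly continuous family of probability measures. -/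
def kernelCLM (κ : C(Y, ProbabilityMeasure X)) : C(X, ℂ) →L[ℂ] C(Y, ℂ) :=
  LinearMap.mkContinuous
    { toFun := fun Φ => ⟨fun y => integralCLM (κ y) Φ, continuous_integralCLM κ.continuous Φ⟩
      map_add' := fun Φ Ψ => by ext y; simp
      map_smul' := fun z Φ => by ext y; simp } 1
    (fun Φ => (ContinuousMap.norm_le _ (by positivity)).2 fun y =>
      (integralCLM (κ y)).le_of_opNorm_le (norm_integralCLM_le _) Φ)

/-- The functional `Φ ↦ ∫ ∫ Φ dκ_y dμ(y)`. -/
def mixtureCLM (κ : C(Y, ProbabilityMeasure X)) (μ : ProbabilityMeasure Y) : C(X, ℂ) →L[ℂ] ℂ :=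
  (integralCLM μ).comp (kernelCLM κ)

lemma mixtureCLM_apply (κ : C(Y, ProbabilityMeasure X)) (μ : ProbabilityMeasure Y) (Φ : C(X, ℂ)) :
    mixtureCLM κ μ Φ = ∫ y, ∫ x, Φ x ∂(κ y : Measure X) ∂(μ : Measure Y) := rfl

lemma norm_mixtureCLM_le (κ : C(Y, ProbabilityMeasure X)) (μ : ProbabilityMeasure Y) :
    ‖mixtureCLM κ μ‖ ≤ 1 := by
  refine (ContinuousLinearMap.opNorm_comp_le _ _).trans ?_
  have h1 : ‖kernelCLM κ‖ ≤ 1 := LinearMap.mkContinuous_norm_le _ zero_le_one _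
  exact mul_le_one₀ (norm_integralCLM_le μ) (norm_nonneg _) h1

lemma continuous_mixtureCLM (κ : C(Y, ProbabilityMeasure X)) {μ : Z → ProbabilityMeasure Y}
    (hμ : Continuous μ) (Φ : C(X, ℂ)) : Continuous fun z => mixtureCLM κ (μ z) Φ :=
  continuous_integralCLM hμ (kernelCLM κ Φ)

end Functionals

/-! ### Cylindrical test functions -/

/-- The Fourier coefficient `∫ eₙ dm` of a probability measure on the torus. -/
def fourierMean (n : Fin d → ℤ) (m : Distr d) : ℂ := integralCLM m (mFourier n)

lemma continuous_fourierMean (n : Fin d → ℤ) : Continuous (fourierMean n) :=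
  continuous_integralCLM continuous_id (mFourier n)

lemma fourierMean_mixDirac (n : Fin d → ℤ) (m : Distr d) (x : Torus d) (θ : unitInterval) :
    fourierMean n (mixDirac m x θ) =
      fourierMean n m + ((θ : ℝ) : ℂ) * (mFourier n x - fourierMean n m) := by
  have hi : ∀ ν : Measure (Torus d), IsFiniteMeasure ν → Integrable (mFourier n) ν := fun ν _ =>
    Integrable.of_bound (mFourier n).continuous.measurable.aestronglyMeasurable _
      (Eventually.of_forall (mFourier n).norm_coe_le_norm)
  have hmix : fourierMean n (mixDirac m x θ) = ∫ y, mFourier n y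
      ∂(unitInterval.toNNReal θ • Measure.dirac x +
        unitInterval.toNNReal (unitInterval.symm θ) • (m : Measure (Torus d))) := rfl
  rw [hmix, integral_add_measure (hi _ inferInstance) (hi _ inferInstance),
    integral_smul_nnreal_measure, integral_smul_nnreal_measure, integral_dirac]
  simp only [fourierMean, integralCLM_apply, NNReal.smul_def, unitInterval.coe_toNNReal,
    unitInterval.coe_symm_eq, Complex.real_smul]
  push_cast
  ring

lemma mFourier_proj (n : Fin d → ℤ) (y : E d) :
    mFourier n (proj y) = Complex.exp (∑ a, modeSymbol n a * y a) := by
  simp only [mFourier, ContinuousMap.coe_mk, proj, Complex.exp_sum]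
  refine Finset.prod_congr rfl fun a _ => ?_
  rw [fourier_coe_apply, modeSymbol]
  simp

lemma contDiff_mFourier_proj (n : Fin d → ℤ) :
    ContDiff ℝ ∞ fun y : E d => mFourier n (proj y) := by
  simp only [mFourier_proj]
  refine ContDiff.cexp (ContDiff.sum fun a _ => contDiff_const.mul ?_)
  exact Complex.ofRealCLM.contDiff.comp (EuclideanSpace.proj (𝕜 := ℝ) a).contDiff

lemma continuous_iteratedFDeriv_re_mul {Y V : Type*} [TopologicalSpace Y] [NormedAddCommGroup V]
    [NormedSpace ℝ V] {w : Y → ℂ} (hw : Continuous w) {g : V → ℂ} (hg : ContDiff ℝ ∞ g) (k : ℕ) :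
    Continuous fun p : Y × V => iteratedFDeriv ℝ k (fun q => (w p.1 * g q).re) p.2 := by
  let L : ℂ → ℂ →L[ℝ] ℝ := fun z => Complex.reCLM.comp (ContinuousLinearMap.mul ℝ ℂ z)
  have hL : Continuous L := by fun_prop
  have h : ∀ p : Y × V, iteratedFDeriv ℝ k (fun q => (w p.1 * g q).re) p.2 =
      (L (w p.1)).compContinuousMultilinearMap (iteratedFDeriv ℝ k g p.2) := fun p =>
    (L (w p.1)).iteratedFDeriv_comp_left (hg.contDiffAt (x := p.2)) (by exact_mod_cast le_top)
  simp only [h]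
  have h2 : Continuous fun q : (ℂ →L[ℝ] ℝ) × (ContinuousMultilinearMap ℝ (fun _ : Fin k => V) ℂ) =>
      q.1.compContinuousMultilinearMap q.2 :=
    (ContinuousLinearMap.compContinuousMultilinearMapL ℝ (fun _ : Fin k => V) ℂ
      ℝ).isBoundedBilinearMap.continuous
  exact h2.comp ((hL.comp (hw.comp continuous_fst)).prodMk
    ((hg.continuous_iteratedFDeriv (m := k) (by exact_mod_cast le_top)).comp continuous_snd))

lemma torusPartial_trig {Q : Type*} [Fintype Q] (w : Q → ℂ) (n : Q → Fin d → ℤ) (z : ℂ)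
    (a : Fin d) :
    torusPartial a (fun x => (∑ q, w q * mFourier (n q) x + z).re) =
      fun x => (∑ q, w q * modeSymbol (n q) a * mFourier (n q) x + 0).re := by
  ext x
  have h : HasDerivAt (fun r : ℝ =>
      ∑ q, w q * mFourier (n q) (x + Pi.single a (r : UnitAddCircle)) + z) _ 0 :=
    (HasDerivAt.fun_sum fun q _ => (hasDerivAt_mFourier (n q) x a 0).const_mul (w q)).add_const z
  refine (hasDerivAt_re h).deriv.trans ?_
  simp [mul_assoc]

lemma contDiff_lift_trig {Q : Type*} [Fintype Q] (w : Q → ℂ) (n : Q → Fin d → ℤ) (z : ℂ) :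
    ContDiff ℝ ∞ (lift fun x => (∑ q, w q * mFourier (n q) x + z).re) := by
  refine Complex.reCLM.contDiff.comp (ContDiff.add (ContDiff.sum fun q _ => ?_) contDiff_const)
  exact contDiff_const.mul (contDiff_mFourier_proj (n q))

section TestFunction

variable {k : ℕ} (n : Fin k → Fin d → ℤ)

/-- The cylindrical function `m ↦ ∏ᵢ ∫ e_{nᵢ} dm`. -/
def fourierMoment (m : Distr d) : ℂ := ∏ i, fourierMean (n i) m

/-- The cofactors `∏_{j ≠ i} ∫ e_{nⱼ} dm`. -/
def fourierCofactor (i : Fin k) (m : Distr d) : ℂ :=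
  ∏ j ∈ Finset.univ.erase i, fourierMean (n j) m

lemma continuous_fourierMoment : Continuous (fourierMoment n) :=
  continuous_finsetProd _ fun _ _ => continuous_fourierMean _

lemma continuous_fourierCofactor (i : Fin k) : Continuous (fourierCofactor n i) :=
  continuous_finsetProd _ fun _ _ => continuous_fourierMean _

/-- The function `φ(t, m) = c(t) Re(z ∏ᵢ ∫ e_{nᵢ} dm)` is an admissible test function, with
`∇ₘφ(t, m, x) = c(t) Re(z ∑ᵢ (∏_{j ≠ i} ∫ e_{nⱼ} dm) (e_{nᵢ}(x) - ∫ e_{nᵢ} dm))`. -/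
lemma isSmoothTest_fourierMoment {c : ℝ → ℝ} (hc : ContDiff ℝ ∞ c) (z : ℂ) :
    IsSmoothTest (fun t m => (c t * z * fourierMoment n m).re)
      (fun t m x => (∑ i, c t * z * fourierCofactor n i m * mFourier (n i) x
        + -(c t * z * ∑ i, fourierCofactor n i m * fourierMean (n i) m)).re) := by
  have hcC : ContDiff ℝ ∞ fun t => (c t : ℂ) := Complex.ofRealCLM.contDiff.comp hc
  -- `∇ₘφ` is a finite sum of products of functions of `m` and functions of `(t, x)`
  have hsplit : ∀ m : Distr d, (fun q : ℝ × E d =>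
      (∑ i, c q.1 * z * fourierCofactor n i m * mFourier (n i) (proj q.2)
        + -(c q.1 * z * ∑ i, fourierCofactor n i m * fourierMean (n i) m)).re)
      = fun q => ∑ o : Option (Fin k), ((Option.elim o
          (-(z * ∑ i, fourierCofactor n i m * fourierMean (n i) m))
          fun i => z * fourierCofactor n i m) *
          (Option.elim o (c q.1 : ℂ) fun i => c q.1 * mFourier (n i) (proj q.2))).re := by
    intro m
    ext q
    rw [Fintype.sum_option, ← Complex.re_sum, ← Complex.add_re, add_comm]
    simp only [Option.elim]
    congr 2
    · ring
    · exact Finset.sum_congr rfl fun i _ => by ring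
  have hg : ∀ o : Option (Fin k), ContDiff ℝ ∞ fun q : ℝ × E d =>
      (Option.elim o (c q.1 : ℂ) fun i => c q.1 * mFourier (n i) (proj q.2)) := by
    rintro (_ | i)
    · exact hcC.comp contDiff_fst
    · exact (hcC.comp contDiff_fst).mul ((contDiff_mFourier_proj (n i)).comp contDiff_snd)
  have hw : ∀ o : Option (Fin k), Continuous fun m : Distr d => (Option.elim o
      (-(z * ∑ i, fourierCofactor n i m * fourierMean (n i) m))
      fun i => z * fourierCofactor n i m) := by
    rintro (_ | i)
    · exact (continuous_const.mul (continuous_finsetSum _ fun i _ =>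
        (continuous_fourierCofactor n i).mul (continuous_fourierMean (n i)))).neg
    · exact continuous_const.mul (continuous_fourierCofactor n i)
  have hterm : ∀ (m : Distr d) (o : Option (Fin k)), ContDiff ℝ ∞ fun q : ℝ × E d =>
      ((Option.elim o (-(z * ∑ i, fourierCofactor n i m * fourierMean (n i) m))
          fun i => z * fourierCofactor n i m) *
          (Option.elim o (c q.1 : ℂ) fun i => c q.1 * mFourier (n i) (proj q.2))).re :=
    fun m o => Complex.reCLM.contDiff.comp (contDiff_const.mul (hg o))
  refine ⟨fun t m x => ?_, fun m => ?_, fun k' => ?_, fun m => ?_, fun k' => ?_⟩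
  · have h1 : HasDerivAt (fun r : ℝ => (c t * z * ∏ i, (fourierMean (n i) m
        + (r : ℂ) * (mFourier (n i) x - fourierMean (n i) m))).re) _ 0 :=
      hasDerivAt_re ((HasDerivAt.fun_finsetProd (u := Finset.univ) fun i _ =>
        (((hasDerivAt_id' (0 : ℝ)).ofReal_comp.mul_const
          (mFourier (n i) x - fourierMean (n i) m)).const_add (fourierMean (n i) m))).const_mul
          (c t * z))
    have h2 : Tendsto (fun θ : unitInterval => (θ : ℝ)) (𝓝[≠] 0) (𝓝[≠] 0) :=
      tendsto_nhdsWithin_iff.2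
        ⟨(continuous_subtype_val.tendsto' (0 : unitInterval) 0 rfl).mono_left nhdsWithin_le_nhds,
        eventually_nhdsWithin_of_forall fun θ hθ => by simpa using hθ⟩
    have h3 := (hasDerivAt_iff_tendsto_slope.1 h1).comp h2
    refine (h3.congr fun θ => ?_).trans (le_of_eq ?_)
    · simp [slope_def_field, fourierMoment, fourierMean_mixDirac]
    · congr 2
      simp only [Complex.ofReal_zero, zero_mul, add_zero, Complex.ofReal_one, one_mul, smul_eq_mul,
        fourierCofactor]
      simp only [mul_sub, Finset.sum_sub_distrib, Finset.mul_sum]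
      rw [sub_eq_add_neg]
      congr 1
      exact Finset.sum_congr rfl fun i _ => by ring
  · exact Complex.reCLM.contDiff.comp ((hcC.mul contDiff_const).mul contDiff_const)
  · have h : ∀ p : ℝ × Distr d, iteratedDeriv k' (fun s => (c s * z * fourierMoment n p.2).re) p.1
        = (z * fourierMoment n p.2).re * iteratedDeriv k' c p.1 := by
      intro p
      rw [← iteratedDeriv_const_mul _ ((hc.of_le (by exact_mod_cast le_top)).contDiffAt)]
      congr 1
      ext s
      rw [mul_assoc, Complex.re_ofReal_mul, mul_comm]
    simp only [h]
    exact ((Complex.continuous_re.comp (continuous_const.mul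
      ((continuous_fourierMoment n).comp continuous_snd))).mul
      ((hc.continuous_iteratedDeriv k' (by exact_mod_cast le_top)).comp continuous_fst))
  · rw [hsplit]
    exact ContDiff.sum fun o _ => hterm m o
  · simp only [hsplit]
    have h : ∀ p : Distr d × (ℝ × E d), iteratedFDeriv ℝ k' (fun q : ℝ × E d =>
        ∑ o : Option (Fin k), ((Option.elim o
          (-(z * ∑ i, fourierCofactor n i p.1 * fourierMean (n i) p.1))
          fun i => z * fourierCofactor n i p.1) *
          (Option.elim o (c q.1 : ℂ) fun i => c q.1 * mFourier (n i) (proj q.2))).re) p.2 =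
        ∑ o : Option (Fin k), iteratedFDeriv ℝ k' (fun q : ℝ × E d => ((Option.elim o
          (-(z * ∑ i, fourierCofactor n i p.1 * fourierMean (n i) p.1))
          fun i => z * fourierCofactor n i p.1) *
          (Option.elim o (c q.1 : ℂ) fun i => c q.1 * mFourier (n i) (proj q.2))).re) p.2 := by
      intro p
      rw [iteratedFDeriv_sum fun o _ => (hterm p.1 o).of_le (by exact_mod_cast le_top)]
      simp
    simp only [h]
    exact continuous_finsetSum _ fun o _ => continuous_iteratedFDeriv_re_mul (hw o) (hg o) k'

end TestFunction

/-- A continuous function that solves `A' = D` weakly, tested against the smooth functions `c` with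
`c(T) = 0`, is a primitive of `D`. -/
lemma eq_add_integral_of_weak {T : ℝ} (hT : 0 < T) {A D : ℝ → ℂ} (hA : Continuous A)
    (hD : Continuous D)
    (h : ∀ c : ℝ → ℝ, ContDiff ℝ ∞ c → c T = 0 →
      ∫ t in (0 : ℝ)..T, (((deriv c t : ℝ) : ℂ) * A t + c t * D t) = -(c 0 * A 0)) :
    ∀ t ∈ Icc 0 T, A t = A 0 + ∫ s in (0 : ℝ)..t, D s := by
  set P : ℝ → ℂ := fun t => A 0 + ∫ s in (0 : ℝ)..t, D s with hP
  have hPd : ∀ t, HasDerivAt P (D t) t := fun t =>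
    (intervalIntegral.integral_hasDerivAt_right (hD.intervalIntegrable 0 t)
      hD.stronglyMeasurable.stronglyMeasurableAtFilter hD.continuousAt).const_add _
  have hPc : Continuous P := continuous_iff_continuousAt.2 fun t => (hPd t).continuousAt
  have key : ∀ g : ℝ → ℝ, ContDiff ℝ ∞ g → ∫ t in (0 : ℝ)..T, g t • (A t - P t) = 0 := by
    intro g hg
    set c : ℝ → ℝ := fun t => ∫ s in T..t, g s with hc
    have hcd : ∀ t, HasDerivAt c (g t) t := fun t =>
      intervalIntegral.integral_hasDerivAt_right (hg.continuous.intervalIntegrable T t)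
        hg.continuous.stronglyMeasurable.stronglyMeasurableAtFilter hg.continuous.continuousAt
    have hderiv : deriv c = g := funext fun t => (hcd t).deriv
    have hcs : ContDiff ℝ ∞ c := by
      rw [contDiff_infty_iff_deriv, hderiv]
      exact ⟨fun t => (hcd t).differentiableAt, hg⟩
    have hcT : c T = 0 := by simp [hc]
    have h1 := h c hcs hcT
    have hcc : Continuous fun t => (c t : ℂ) := Complex.continuous_ofReal.comp hcs.continuous
    have hgc : Continuous fun t => (g t : ℂ) := Complex.continuous_ofReal.comp hg.continuous
    have h2 := intervalIntegral.integral_mul_deriv_eq_deriv_mul (a := 0) (b := T)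
      (fun t _ => (hcd t).ofReal_comp) (fun t _ => hPd t)
      (hgc.intervalIntegrable _ _) (hD.intervalIntegrable _ _)
    have hP0 : P 0 = A 0 := by simp [hP]
    have i1 : IntervalIntegrable (fun t => (g t : ℂ) * A t) volume 0 T :=
      (hgc.mul hA).intervalIntegrable _ _
    have i2 : IntervalIntegrable (fun t => (c t : ℂ) * D t) volume 0 T :=
      (hcc.mul hD).intervalIntegrable _ _
    have i3 : IntervalIntegrable (fun t => (g t : ℂ) * P t) volume 0 T :=
      (hgc.mul hPc).intervalIntegrable _ _
    rw [hderiv, intervalIntegral.integral_add i1 i2, h2, hcT, hP0] at h1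
    simp only [Complex.real_smul, mul_sub]
    rw [intervalIntegral.integral_sub i1 i3]
    push_cast at h1
    linear_combination h1
  have hae : ∀ᵐ t : ℝ, t ∈ Ioo 0 T → A t - P t = 0 := by
    refine isOpen_Ioo.ae_eq_zero_of_integral_contDiff_smul_eq_zero
      ((hA.sub hPc).locallyIntegrable.locallyIntegrableOn _) fun g hg _ hsupp => ?_
    rw [← key g hg, intervalIntegral.integral_of_le hT.le]
    refine (setIntegral_eq_integral_of_forall_compl_eq_zero fun t ht => ?_).symm
    have : t ∉ tsupport g := fun h' => ht (Ioo_subset_Ioc_self (hsupp h'))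
    rw [image_eq_zero_of_notMem_tsupport this, zero_smul]
  have heq := Measure.eqOn_Icc_of_ae_eq (μ := volume) hT.ne (f := A) (g := P) ?_
    hA.continuousOn hPc.continuousOn
  · exact fun t ht => heq ht
  · rw [← restrict_Ioo_eq_restrict_Icc]
    exact (ae_restrict_iff' measurableSet_Ioo).2 (hae.mono fun t ht h' => sub_eq_zero.1 (ht h'))

/-! ### Evolution of the Fourier moments -/

/-- The time derivative at `m` of the cylindrical function `∏ᵢ ∫ e_{nᵢ} dm` along the flow with
drift `B`. -/
def momentGenerator {k : ℕ} (σ : ℝ) (B : Fin d → C(Torus d, ℂ)) (n : Fin k → Fin d → ℤ)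
    (m : Distr d) : ℂ :=
  ∑ i, fourierCofactor n i m * integralCLM m (modeGenerator σ B (n i))

lemma continuous_modeGenerator {ι Z : Type*} [Fintype ι] [TopologicalSpace Z] (σ : ℝ)
    {B : Z → ι → C(UnitAddTorus ι, ℂ)} (hB : ∀ j, Continuous fun t => B t j) (n : ι → ℤ) :
    Continuous fun t => modeGenerator σ (B t) n :=
  continuous_const.add (continuous_finsetSum _ fun j _ =>
    ((hB j).mul continuous_const).const_smul (modeSymbol n j))

lemma continuous_momentGenerator {k : ℕ} (σ : ℝ) {B : ℝ → Fin d → C(Torus d, ℂ)}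
    (hB : ∀ j, Continuous fun t => B t j) (n : Fin k → Fin d → ℤ) :
    Continuous (Function.uncurry fun t => momentGenerator σ (B t) n) := by
  change Continuous fun p : ℝ × Distr d => ∑ i, fourierCofactor n i p.2 *
    integralCLM p.2 (modeGenerator σ (B p.1) (n i))
  refine continuous_finsetSum _ fun i _ =>
    ((continuous_fourierCofactor n i).comp (continuous_snd (X := ℝ))).mul ?_
  exact continuous_clm_apply_of_norm_le (Z := ℝ × Distr d) (ν := fun p => integralCLM p.2)
    (fun p => norm_integralCLM_le p.2)
    (continuous_integralCLM (continuous_snd (X := ℝ) (Y := Distr d)))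
    ((continuous_modeGenerator σ hB (n i)).comp continuous_fst)

lemma continuous_momentGenerator_right {k : ℕ} (σ : ℝ) (B : Fin d → C(Torus d, ℂ))
    (n : Fin k → Fin d → ℤ) : Continuous (momentGenerator σ B n) :=
  continuous_finsetSum _ fun i _ => (continuous_fourierCofactor n i).mul
    (continuous_integralCLM continuous_id (modeGenerator σ B (n i)))

/-- The second order operator of the continuity equation, applied to `∇ₘ` of a cylindrical
function. -/
lemma generator_trig {k : ℕ} (σ : ℝ) {b : Torus d → E d} {B : Fin d → C(Torus d, ℂ)}
    (hBb : ∀ x i, B i x = b x i) (n : Fin k → Fin d → ℤ) (w : Fin k → ℂ) (z : ℂ) (x : Torus d) :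
    σ * torusLaplacian (fun x => (∑ i, w i * mFourier (n i) x + z).re) x
      + inner ℝ (b x) (torusGrad (fun x => (∑ i, w i * mFourier (n i) x + z).re) x)
      = (∑ i, w i * modeGenerator σ B (n i) x).re := by
  have hC := contDiff_lift_trig w n z
  rw [torusLaplacian_eq (hC.of_le (by norm_cast)),
    inner_torusGrad (hC.of_le (by exact_mod_cast le_top))]
  simp only [torusPartial_trig]
  simp only [add_zero]
  have e1 : σ * ∑ a, (∑ i, w i * modeSymbol (n i) a * modeSymbol (n i) a * mFourier (n i) x).re
      = (∑ i, w i * ((σ * modeLaplace (n i)) * mFourier (n i) x)).re := by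
    rw [← Complex.re_sum, ← Complex.re_ofReal_mul, Finset.sum_comm, Finset.mul_sum]
    congr 1
    refine Finset.sum_congr rfl fun i _ => ?_
    rw [modeLaplace, Finset.mul_sum, Finset.mul_sum, Finset.sum_mul, Finset.mul_sum]
    exact Finset.sum_congr rfl fun a _ => by ring
  have e2 : ∑ a, b x a * (∑ i, w i * modeSymbol (n i) a * mFourier (n i) x).re
      = (∑ i, w i * ∑ a, modeSymbol (n i) a * (B a x * mFourier (n i) x)).re := by
    simp only [← Complex.re_ofReal_mul, ← hBb]
    rw [← Complex.re_sum]
    simp only [Finset.mul_sum]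
    rw [Finset.sum_comm]
    congr 1
    exact Finset.sum_congr rfl fun i _ => Finset.sum_congr rfl fun a _ => by ring
  rw [e1, e2, ← Complex.add_re, ← Finset.sum_add_distrib]
  congr 1
  refine Finset.sum_congr rfl fun i _ => ?_
  simp [modeGenerator, mul_add]

lemma integral_generator_trig {k : ℕ} (σ : ℝ) {b : Torus d → E d} {B : Fin d → C(Torus d, ℂ)}
    (hBb : ∀ x i, B i x = b x i) (n : Fin k → Fin d → ℤ) (w z : ℂ) (m : Distr d) :
    ∫ x, (σ * torusLaplacian (fun x =>
        (∑ i, w * fourierCofactor n i m * mFourier (n i) x + z).re) x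
      + inner ℝ (b x) (torusGrad (fun x =>
        (∑ i, w * fourierCofactor n i m * mFourier (n i) x + z).re) x)) ∂(m : Measure (Torus d))
      = (w * momentGenerator σ B n m).re := by
  simp only [generator_trig σ hBb]
  have hcont : ∀ i, Continuous fun x => w * fourierCofactor n i m * modeGenerator σ B (n i) x :=
    fun i => continuous_const.mul (modeGenerator σ B (n i)).continuous
  rw [integral_re_of_continuous (continuous_finsetSum Finset.univ fun i _ => hcont i),
    integral_finsetSum _ fun i _ => integrable_of_continuous (hcont i) m]
  simp only [integral_const_mul, momentGenerator, integralCLM_apply, Finset.mul_sum]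
  congr 1
  exact Finset.sum_congr rfl fun i _ => by ring

lemma integral_neg_re_combination {F G : Distr d → ℂ} (hF : Continuous F) (hG : Continuous G)
    (z c₁ c₀ : ℂ) (ρ : Belief d) :
    ∫ m, (-(z * (c₁ * F m + c₀ * G m))).re ∂(ρ : Measure (Distr d)) =
      (-(z * (c₁ * (∫ m, F m ∂(ρ : Measure (Distr d)))
        + c₀ * ∫ m, G m ∂(ρ : Measure (Distr d))))).re := by
  rw [integral_re_of_continuous (by fun_prop), integral_neg, integral_const_mul, integral_add
    (integrable_of_continuous (by fun_prop) ρ) (integrable_of_continuous (by fun_prop) ρ),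
    integral_const_mul, integral_const_mul]

/-- The Fourier moments `∫ ∏ᵢ (∫ e_{nᵢ} dm) μₜ(dm)` of a weak solution solve ordinary
differential equations. The curve `ρ` is a continuous extension of `μ` to all times, and `B` one of
the drift. -/
theorem IsWeakSolution.integral_fourierMoment_eq {σ T : ℝ} (hT : 0 < T) {b : ℝ → Torus d → E d}
    {μ₀ : Belief d} {μ ρ : ℝ → Belief d} (hw : IsWeakSolution σ T b μ₀ μ)
    (hρ : Continuous ρ) (hμρ : ∀ t ∈ Icc 0 T, μ t = ρ t) (h0 : ρ 0 = μ₀)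
    {B : ℝ → Fin d → C(Torus d, ℂ)} (hB : ∀ j, Continuous fun t => B t j)
    (hBb : ∀ t ∈ Icc 0 T, ∀ x i, B t i x = b t x i) {k : ℕ} (n : Fin k → Fin d → ℤ) :
    ∀ t ∈ Icc 0 T, ∫ m, fourierMoment n m ∂(ρ t : Measure (Distr d)) =
      ∫ m, fourierMoment n m ∂(ρ 0 : Measure (Distr d)) +
        ∫ s in (0 : ℝ)..t, ∫ m, momentGenerator σ (B s) n m ∂(ρ s : Measure (Distr d)) := by
  have hA : Continuous fun t => ∫ m, fourierMoment n m ∂(ρ t : Measure (Distr d)) :=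
    continuous_integral hρ ((continuous_fourierMoment n).comp continuous_snd)
  have hD : Continuous fun t => ∫ m, momentGenerator σ (B t) n m ∂(ρ t : Measure (Distr d)) :=
    continuous_integral hρ (continuous_momentGenerator σ hB n)
  refine eq_add_integral_of_weak hT hA hD fun c hc hcT => ?_
  have hcd : ∀ t, HasDerivAt c (deriv c t) t := fun t =>
    (hc.differentiable (by simp) t).hasDerivAt
  have hdc : Continuous (deriv c) := hc.continuous_deriv (by exact_mod_cast le_top)
  -- the weak formulation, rotated by an arbitrary complex number `z`
  have hz : ∀ z : ℂ, (z * ((∫ t in (0 : ℝ)..T,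
      (((deriv c t : ℝ) : ℂ) * (∫ m, fourierMoment n m ∂(ρ t : Measure (Distr d)))
        + c t * (∫ m, momentGenerator σ (B t) n m ∂(ρ t : Measure (Distr d)))))
      + c 0 * ∫ m, fourierMoment n m ∂(ρ 0 : Measure (Distr d)))).re = 0 := by
    intro z
    have h := hw _ _ (isSmoothTest_fourierMoment n hc z) (by simp [hcT])
    have hint : ∀ t ∈ uIcc 0 T, ∫ m : Distr d,
        (-deriv (fun s => (c s * z * fourierMoment n m).re) t
          - ∫ x, (σ * torusLaplacian (fun x => (∑ i, c t * z * fourierCofactor n i m *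
              mFourier (n i) x
              + -(c t * z * ∑ i, fourierCofactor n i m * fourierMean (n i) m)).re) x
            + inner ℝ (b t x) (torusGrad (fun x => (∑ i, c t * z * fourierCofactor n i m *
              mFourier (n i) x
              + -(c t * z * ∑ i, fourierCofactor n i m * fourierMean (n i) m)).re) x))
              ∂(m : Measure (Torus d))) ∂(μ t : Measure (Distr d))
        = (-(z * (((deriv c t : ℝ) : ℂ) *
            (∫ m, fourierMoment n m ∂(ρ t : Measure (Distr d)))
          + c t * (∫ m, momentGenerator σ (B t) n m ∂(ρ t : Measure (Distr d)))))).re := by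
      intro t ht
      rw [uIcc_of_le hT.le] at ht
      rw [hμρ t ht]
      have e1 : ∀ m, deriv (fun s => (c s * z * fourierMoment n m).re) t
          = (((deriv c t : ℝ) : ℂ) * z * fourierMoment n m).re := fun m =>
        (hasDerivAt_re (((hcd t).ofReal_comp.mul_const z).mul_const _)).deriv
      rw [← integral_neg_re_combination (continuous_fourierMoment n)
        (continuous_momentGenerator_right σ (B t) n)]
      refine integral_congr_ae (Eventually.of_forall fun m => ?_)
      beta_reduce
      rw [integral_generator_trig σ (hBb t ht), e1, ← Complex.neg_re, ← Complex.sub_re]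
      congr 1
      ring
    have hinit : Continuous fun m : Distr d => c 0 * z * fourierMoment n m :=
      continuous_const.mul (continuous_fourierMoment n)
    rw [intervalIntegral.integral_congr hint, ← h0, integral_re_of_continuous hinit,
      integral_const_mul] at h
    have hcont : Continuous fun t => (((deriv c t : ℝ) : ℂ) *
        (∫ m, fourierMoment n m ∂(ρ t : Measure (Distr d)))
          + c t * (∫ m, momentGenerator σ (B t) n m ∂(ρ t : Measure (Distr d)))) :=
      ((Complex.continuous_ofReal.comp hdc).mul hA).add
        ((Complex.continuous_ofReal.comp hc.continuous).mul hD)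
    have hre : ∀ F : ℝ → ℂ, Continuous F →
        ∫ t in (0 : ℝ)..T, (-(z * F t)).re = (-(z * ∫ t in (0 : ℝ)..T, F t)).re := fun F hF => by
      rw [← intervalIntegral.integral_const_mul, ← intervalIntegral.integral_neg]
      exact Complex.reCLM.intervalIntegral_comp_comm
        ((continuous_const.mul hF).neg.intervalIntegrable _ _)
    rw [hre _ hcont, ← Complex.sub_re] at h
    refine neg_eq_zero.1 (Eq.trans ?_ h)
    rw [← Complex.neg_re]
    congr 1
    ring
  have h1 := hz 1
  have h2 := hz (-Complex.I)
  rw [one_mul] at h1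
  rw [eq_neg_iff_add_eq_zero]
  refine Complex.ext h1 ?_
  simpa using h2

/-! ### Uniqueness for the continuity equation on `𝒫(𝕋^d)` -/

lemma probabilityMeasure_eq_of_dense {X : Type*} [TopologicalSpace X] [CompactSpace X]
    [MeasurableSpace X] [BorelSpace X] [HasOuterApproxClosed X] {S : Set C(X, ℂ)}
    (hS : (Submodule.span ℂ S).topologicalClosure = ⊤) {μ ν : ProbabilityMeasure X}
    (h : ∀ Φ ∈ S, integralCLM μ Φ = integralCLM ν Φ) : μ = ν := by
  have hall : ∀ Φ : C(X, ℂ), integralCLM μ Φ = integralCLM ν Φ := by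
    intro Φ
    have hle : (Submodule.span ℂ S).topologicalClosure ≤
        LinearMap.ker (integralCLM μ - integralCLM ν).toLinearMap := by
      refine Submodule.topologicalClosure_minimal _ (Submodule.span_le.2 fun Φ hΦ => ?_)
        (integralCLM μ - integralCLM ν).isClosed_ker
      simp [h Φ hΦ]
    have hmem := hle (hS ▸ Submodule.mem_top (x := Φ))
    simpa [sub_eq_zero] using hmem
  have heq : (μ : Measure X) = (ν : Measure X) := by
    refine ext_of_forall_integral_eq_of_IsFiniteMeasure fun f => ?_
    have hf := hall ⟨fun x => (f x : ℂ), by fun_prop⟩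
    simp only [integralCLM_apply, ContinuousMap.coe_mk, integral_complex_ofReal] at hf
    exact_mod_cast hf
  exact Subtype.ext heq

lemma continuous_probabilityMeasure_pow {X : Type*} [TopologicalSpace X]
    [SecondCountableTopology X] [TopologicalSpace.PseudoMetrizableSpace X] [MeasurableSpace X]
    [OpensMeasurableSpace X] (k : ℕ) :
    Continuous fun m : ProbabilityMeasure X => ProbabilityMeasure.pi fun _ : Fin k => m :=
  ProbabilityMeasure.continuous_pi.comp (continuous_pi fun _ => continuous_id)

lemma distr_eq_of_fourierMean {m m' : Distr d} (h : ∀ n, fourierMean n m = fourierMean n m') :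
    m = m' :=
  probabilityMeasure_eq_of_dense span_mFourier_closure_eq_top
    (by rintro _ ⟨n, rfl⟩; exact h n)

/-- The cylindrical functions `∏ᵢ ∫ e_{nᵢ} dm` form a multiplicative and conjugation invariant
family that separates points. -/
lemma span_fourierMoment_topologicalClosure :
    (Submodule.span ℂ (range fun p : (Σ k : ℕ, Fin k → Fin d → ℤ) =>
      (⟨fourierMoment p.2, continuous_fourierMoment p.2⟩ : C(Distr d, ℂ)))).topologicalClosure
      = ⊤ := by
  set S : Set C(Distr d, ℂ) := range fun p : (Σ k : ℕ, Fin k → Fin d → ℤ) =>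
    (⟨fourierMoment p.2, continuous_fourierMoment p.2⟩ : C(Distr d, ℂ)) with hS
  let A : StarSubalgebra ℂ C(Distr d, ℂ) :=
    { toSubalgebra := Algebra.adjoin ℂ S
      star_mem' := by
        change Algebra.adjoin ℂ S ≤ star (Algebra.adjoin ℂ S)
        refine Algebra.adjoin_le ?_
        rintro _ ⟨⟨k, n⟩, rfl⟩
        refine Algebra.subset_adjoin ⟨⟨k, -n⟩, ?_⟩
        ext m
        simp only [fourierMoment, ContinuousMap.coe_mk, ContinuousMap.star_apply, star_prod]
        refine Finset.prod_congr rfl fun i _ => ?_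
        simp only [fourierMean, integralCLM_apply, Pi.neg_apply, mFourier_neg]
        exact integral_conj }
  have hspan : A.toSubalgebra.toSubmodule = Submodule.span ℂ S := by
    refine Algebra.adjoin_eq_span_of_subset _ (.trans (fun x =>
      Submonoid.closure_induction (fun _ => id) ⟨⟨0, Fin.elim0⟩, ?_⟩ ?_) Submodule.subset_span)
    · ext m
      simp [fourierMoment]
    · rintro _ _ _ _ ⟨⟨k, n⟩, rfl⟩ ⟨⟨k', n'⟩, rfl⟩
      refine ⟨⟨k + k', Fin.append n n'⟩, ?_⟩
      ext m
      simp [fourierMoment, Fin.prod_univ_add]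
  have hsep : A.SeparatesPoints := by
    intro m m' hmm
    have : ∃ n, fourierMean n m ≠ fourierMean n m' := by
      contrapose! hmm
      exact distr_eq_of_fourierMean hmm
    obtain ⟨n, hn⟩ := this
    refine ⟨_, ⟨⟨fourierMoment fun _ : Fin 1 => n, continuous_fourierMoment _⟩,
      Algebra.subset_adjoin ⟨⟨1, fun _ => n⟩, rfl⟩, rfl⟩, ?_⟩
    simpa [fourierMoment] using hn
  rw [← hspan]
  exact congr_arg (Subalgebra.toSubmodule <| StarSubalgebra.toSubalgebra ·)
    (ContinuousMap.starSubalgebra_topologicalClosure_eq_top_of_separatesPoints A hsep)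

section Power

variable (k : ℕ)

/-- The power `m^{⊗k}` as a probability measure on the torus of dimension `k d`. -/
def powerKernel : C(Distr d, ProbabilityMeasure (UnitAddTorus (Fin k × Fin d))) where
  toFun m := (ProbabilityMeasure.pi fun _ : Fin k => m).map
    (f := fun (x : Fin k → Torus d) (p : Fin k × Fin d) => x p.1 p.2)
    (Continuous.measurable (by fun_prop)).aemeasurable
  continuous_toFun := by
    have h1 : Continuous fun (x : Fin k → Torus d) (p : Fin k × Fin d) => x p.1 p.2 := by fun_prop
    exact (ProbabilityMeasure.continuous_map h1).comp (continuous_probabilityMeasure_pow k)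

/-- The `i`-th component in `𝕋^d` of a point of the torus of dimension `k d`. -/
def component {k : ℕ} (i : Fin k) : C(UnitAddTorus (Fin k × Fin d), Torus d) where
  toFun x a := x (i, a)
  continuous_toFun := by fun_prop

variable {k}

lemma integral_powerKernel (m : Distr d) (h : Fin k → C(Torus d, ℂ)) :
    ∫ x, ∏ i, h i (component i x) ∂(powerKernel k m : Measure (UnitAddTorus (Fin k × Fin d))) =
      ∏ i, integralCLM m (h i) := by
  have hm : Measurable fun (x : Fin k → Torus d) (p : Fin k × Fin d) => x p.1 p.2 :=
    Continuous.measurable (by fun_prop)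
  change ∫ x, ∏ i, h i (component i x) ∂((Measure.pi fun _ : Fin k => (m : Measure (Torus d))).map
    fun (x : Fin k → Torus d) (p : Fin k × Fin d) => x p.1 p.2) = _
  rw [integral_map hm.aemeasurable]
  · exact integral_fintype_prod_eq_prod (fun i => h i)
  · exact (Continuous.measurable (by fun_prop)).aestronglyMeasurable

lemma mFourier_eq_prod_component (N : Fin k × Fin d → ℤ) (x : UnitAddTorus (Fin k × Fin d)) :
    mFourier N x = ∏ i, mFourier (fun a => N (i, a)) (component i x) := by
  simp [mFourier, component, Fintype.prod_prod_type]

/-- The drift with components `b(t, x₁), …, b(t, x_k)`. -/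
def powerDrift (B : Fin d → C(Torus d, ℂ)) (p : Fin k × Fin d) :
    C(UnitAddTorus (Fin k × Fin d), ℂ) := (B p.2).comp (component p.1)

lemma prod_update_apply {Y : Type*} [TopologicalSpace Y] (h : Fin k → C(Y, ℂ)) (i : Fin k)
    (g : C(Y, ℂ)) (F : Fin k → C(Y, ℂ) → ℂ) :
    ∏ j, F j (Function.update h i g j) = F i g * ∏ j ∈ Finset.univ.erase i, F j (h j) := by
  rw [← Finset.mul_prod_erase _ _ (Finset.mem_univ i), Function.update_self]
  congr 1
  refine Finset.prod_congr rfl fun j hj => ?_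
  rw [Function.update_of_ne (Finset.ne_of_mem_erase hj)]

/-- The generator of `k` independent particles acts on a product of modes by Leibniz' rule. -/
lemma modeGenerator_powerDrift (σ : ℝ) (B : Fin d → C(Torus d, ℂ)) (N : Fin k × Fin d → ℤ)
    (x : UnitAddTorus (Fin k × Fin d)) :
    modeGenerator σ (powerDrift B) N x = ∑ i, ∏ j, (Function.update
      (fun j => mFourier fun a => N (j, a)) i (modeGenerator σ B fun a => N (i, a)) j)
        (component j x) := by
  have h : ∀ i, mFourier N x = mFourier (fun a => N (i, a)) (component i x) *
      ∏ j ∈ Finset.univ.erase i, mFourier (fun a => N (j, a)) (component j x) := fun i => by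
    rw [mFourier_eq_prod_component, ← Finset.mul_prod_erase _ _ (Finset.mem_univ i)]
  have hupd := fun i => prod_update_apply (fun j => mFourier fun a => N (j, a)) i
    (modeGenerator σ B fun a => N (i, a)) (fun j Φ => Φ (component j x))
  simp only [hupd]
  simp only [modeGenerator, ContinuousMap.add_apply, ContinuousMap.smul_apply, smul_eq_mul,
    ContinuousMap.sum_apply, ContinuousMap.mul_apply, powerDrift, ContinuousMap.comp_apply,
    modeLaplace, Fintype.sum_prod_type, Finset.mul_sum, Finset.sum_mul]
  rw [← Finset.sum_add_distrib]
  refine Finset.sum_congr rfl fun i _ => ?_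
  rw [add_mul, Finset.sum_mul, Finset.sum_mul]
  congr 1
  · refine Finset.sum_congr rfl fun a _ => ?_
    rw [h i]
    simp only [modeSymbol]
    ring
  · refine Finset.sum_congr rfl fun a _ => ?_
    rw [h i]
    simp only [modeSymbol]
    ring

lemma mixtureCLM_mFourier (N : Fin k × Fin d → ℤ) (μ : Belief d) :
    mixtureCLM (powerKernel k) μ (mFourier N) =
      ∫ m, fourierMoment (fun i a => N (i, a)) m ∂(μ : Measure (Distr d)) := by
  rw [mixtureCLM_apply]
  refine integral_congr_ae (Eventually.of_forall fun m => ?_)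
  simp only [mFourier_eq_prod_component]
  exact integral_powerKernel m fun i => mFourier fun a => N (i, a)

lemma mixtureCLM_modeGenerator (σ : ℝ) (B : Fin d → C(Torus d, ℂ)) (N : Fin k × Fin d → ℤ)
    (μ : Belief d) :
    mixtureCLM (powerKernel k) μ (modeGenerator σ (powerDrift B) N) =
      ∫ m, momentGenerator σ B (fun i a => N (i, a)) m ∂(μ : Measure (Distr d)) := by
  rw [mixtureCLM_apply]
  refine integral_congr_ae (Eventually.of_forall fun m => ?_)
  simp only [modeGenerator_powerDrift]
  rw [integral_finsetSum]
  · simp only [integral_powerKernel, momentGenerator]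
    refine Finset.sum_congr rfl fun i _ => ?_
    rw [prod_update_apply _ i _ fun _ => integralCLM m, mul_comm]
    rfl
  · intro i _
    exact integrable_of_continuous (by fun_prop) _

end Power

/-- Two weak solutions of the continuity equation with the same continuous drift and the same
initial condition coincide: for every `k` the measures `∫ m^{⊗k} μₜ(dm)` solve the Fokker–Planck
equation of `k` independent particles, which has a unique solution. The curves `ρ₁`, `ρ₂` and `B`
are continuous extensions to all times of `μ₁`, `μ₂` and of the drift. -/
theorem IsWeakSolution.unique {σ T : ℝ} (hσ : 0 < σ) (hT : 0 < T) {b : ℝ → Torus d → E d}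
    {μ₀ : Belief d} {μ₁ μ₂ ρ₁ ρ₂ : ℝ → Belief d}
    (hw₁ : IsWeakSolution σ T b μ₀ μ₁) (hw₂ : IsWeakSolution σ T b μ₀ μ₂)
    (hρ₁ : Continuous ρ₁) (hμρ₁ : ∀ t ∈ Icc 0 T, μ₁ t = ρ₁ t) (h0₁ : ρ₁ 0 = μ₀)
    (hρ₂ : Continuous ρ₂) (hμρ₂ : ∀ t ∈ Icc 0 T, μ₂ t = ρ₂ t) (h0₂ : ρ₂ 0 = μ₀)
    {B : ℝ → Fin d → C(Torus d, ℂ)} (hB : ∀ j, Continuous fun t => B t j)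
    (hBb : ∀ t ∈ Icc 0 T, ∀ x i, B t i x = b t x i) :
    ∀ t ∈ Icc 0 T, μ₁ t = μ₂ t := by
  intro t ht
  rw [hμρ₁ t ht, hμρ₂ t ht]
  refine probabilityMeasure_eq_of_dense span_fourierMoment_topologicalClosure ?_
  rintro _ ⟨⟨k, n⟩, rfl⟩
  have hBk : ∀ p : Fin k × Fin d, Continuous fun t => powerDrift (B t) p := fun p =>
    (ContinuousMap.continuous_precomp (component p.1)).comp (hB p.2)
  have hcont : ∀ {ρ : ℝ → Belief d}, Continuous ρ → ∀ N, Continuous fun s =>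
      mixtureCLM (powerKernel k) (ρ s) (modeGenerator σ (powerDrift (B s)) N) := fun hρ N =>
    continuous_clm_apply_of_norm_le (fun s => norm_mixtureCLM_le _ _)
      (continuous_mixtureCLM _ hρ) (continuous_modeGenerator σ hBk N)
  have hzero := fokkerPlanck_unique hT hσ (C := 1 + 1)
    (ν := fun t => mixtureCLM (powerKernel k) (ρ₁ t) - mixtureCLM (powerKernel k) (ρ₂ t))
    (fun t => (mixtureCLM (powerKernel k) (ρ₁ t)
      - mixtureCLM (powerKernel k) (ρ₂ t)).opNorm_le_bound (by norm_num) fun Φ => ?_)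
    (fun Φ => (continuous_mixtureCLM _ hρ₁ Φ).sub (continuous_mixtureCLM _ hρ₂ Φ))
    (B := fun t => powerDrift (B t)) hBk ?_ (fun p => n p.1 p.2) t ht
  · simp only [sub_apply, mixtureCLM_mFourier] at hzero
    exact sub_eq_zero.1 hzero
  · rw [sub_apply, add_mul]
    exact (norm_sub_le _ _).trans (add_le_add
      (ContinuousLinearMap.le_of_opNorm_le _ (norm_mixtureCLM_le _ _) Φ)
      (ContinuousLinearMap.le_of_opNorm_le _ (norm_mixtureCLM_le _ _) Φ))
  · intro N t ht
    simp only [sub_apply]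
    rw [intervalIntegral.integral_sub ((hcont hρ₁ N).intervalIntegrable _ _)
      ((hcont hρ₂ N).intervalIntegrable _ _)]
    simp only [mixtureCLM_mFourier, mixtureCLM_modeGenerator]
    rw [hw₁.integral_fourierMoment_eq hT hρ₁ hμρ₁ h0₁ hB hBb _ t ht,
      hw₂.integral_fourierMoment_eq hT hρ₂ hμρ₂ h0₂ hB hBb _ t ht, h0₁, h0₂]
    ring

/-! ### From Fourier modes to test functions of class `𝒞²` -/

/-- The Haar probability measure of the torus. -/
def torusHaar (d : ℕ) : Measure (Torus d) := Measure.pi fun _ => AddCircle.haarAddCircle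

instance : IsProbabilityMeasure (torusHaar d) := by unfold torusHaar; infer_instance

instance : (torusHaar d).IsAddHaarMeasure := by unfold torusHaar; infer_instance

lemma integrable_torusHaar {f : Torus d → ℂ} (hf : Continuous f) : Integrable f (torusHaar d) :=
  integrable_of_continuous hf (⟨torusHaar d, inferInstance⟩ : Distr d)

lemma continuous_integral_torusHaar {f : Torus d → Torus d → ℂ}
    (hf : Continuous (Function.uncurry f)) : Continuous fun x => ∫ y, f x y ∂torusHaar d :=
  continuous_integral (μ := fun _ => (⟨torusHaar d, inferInstance⟩ : Distr d))
    continuous_const hf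

/-- The convolution `x ↦ ∫ h(y) K(x - y) dy`. -/
def torusConvFun (h K : C(Torus d, ℂ)) : C(Torus d, ℂ) :=
  ⟨fun x => ∫ y, h y * K (x - y) ∂torusHaar d, continuous_integral_torusHaar (by fun_prop)⟩

lemma torusConvFun_apply (h K : C(Torus d, ℂ)) (x : Torus d) :
    torusConvFun h K x = ∫ y, h y * K (x - y) ∂torusHaar d := rfl

/-- The convolution operator `K ↦ h * K`. -/
def torusConv (h : C(Torus d, ℂ)) : C(Torus d, ℂ) →L[ℂ] C(Torus d, ℂ) :=
  LinearMap.mkContinuous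
    { toFun := torusConvFun h
      map_add' := fun K K' => by
        ext x
        simp only [torusConvFun_apply, ContinuousMap.add_apply, mul_add]
        exact integral_add (integrable_torusHaar (by fun_prop)) (integrable_torusHaar (by fun_prop))
      map_smul' := fun z K => by
        ext x
        simp only [torusConvFun_apply, ContinuousMap.smul_apply, smul_eq_mul, RingHom.id_apply]
        rw [← integral_const_mul]
        exact integral_congr_ae (Eventually.of_forall fun y => by ring) } ‖h‖
    (fun K => (ContinuousMap.norm_le _ (by positivity)).2 fun x => by
      have := norm_integral_le_of_norm_le_const (μ := torusHaar d)
        (f := fun y => h y * K (x - y)) (C := ‖h‖ * ‖K‖) (Eventually.of_forall fun y => by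
          rw [norm_mul]
          exact mul_le_mul (h.norm_coe_le_norm _) (K.norm_coe_le_norm _) (norm_nonneg _)
            (norm_nonneg _))
      simpa [torusConvFun_apply] using this)

lemma torusConv_apply (h K : C(Torus d, ℂ)) (x : Torus d) :
    torusConv h K x = ∫ y, h y * K (x - y) ∂torusHaar d := rfl

/-- The Fourier coefficient of a function. -/
def torusCoeff (h : C(Torus d, ℂ)) (n : Fin d → ℤ) : ℂ := ∫ y, h y * mFourier n (-y) ∂torusHaar d

lemma torusConv_mFourier (h : C(Torus d, ℂ)) (n : Fin d → ℤ) :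
    torusConv h (mFourier n) = torusCoeff h n • mFourier n := by
  ext x
  simp only [torusConv_apply, sub_eq_add_neg, mFourier_apply_add, ContinuousMap.smul_apply,
    torusCoeff, smul_eq_mul]
  rw [← integral_mul_const]
  exact integral_congr_ae (Eventually.of_forall fun y => by ring)

/-- Integration by parts on the torus, obtained by differentiating the invariance under
translations. -/
lemma torusCoeff_deriv {g g' : C(Torus d, ℂ)} {j : Fin d}
    (hg : ∀ x : Torus d, HasDerivAt (fun r : ℝ => g (x + Pi.single j (r : UnitAddCircle))) (g' x) 0)
    (n : Fin d → ℤ) : torusCoeff g' n = modeSymbol n j * torusCoeff g n := by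
  have hg' : ∀ (x : Torus d) (r : ℝ),
      HasDerivAt (fun r : ℝ => g (x + Pi.single j (r : UnitAddCircle)))
      (g' (x + Pi.single j (r : UnitAddCircle))) r := by
    intro x r
    have h := hg (x + Pi.single j (r : UnitAddCircle))
    have h0 : (0 : ℝ) = r - r := by simp
    rw [h0] at h
    refine (h.comp_sub_const r r).congr_of_eventuallyEq (Eventually.of_forall fun s => ?_)
    simp only
    rw [add_assoc, ← Pi.single_add, ← AddCircle.coe_add]
    simp
  obtain ⟨F, hF⟩ : ∃ F : ℝ → Torus d → ℂ, F = fun (r : ℝ) (y : Torus d) =>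
    g (y + Pi.single j (r : UnitAddCircle)) * mFourier n (-y) := ⟨_, rfl⟩
  obtain ⟨F', hF'⟩ : ∃ F' : ℝ → Torus d → ℂ, F' = fun (r : ℝ) (y : Torus d) =>
    g' (y + Pi.single j (r : UnitAddCircle)) * mFourier n (-y) := ⟨_, rfl⟩
  have hFc : ∀ r, Continuous (F r) := fun r => by rw [hF]; fun_prop
  have hFc' : ∀ r, Continuous (F' r) := fun r => by rw [hF']; fun_prop
  have hFd : ∀ y r, HasDerivAt (fun r => F r y) (F' r y) r := fun y r => by
    rw [hF, hF']
    exact (hg' y r).mul_const _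
  have hFb : ∀ y r, ‖F' r y‖ ≤ ‖g'‖ := fun y r => by
    rw [hF', norm_mul]
    have h1 : ‖mFourier n (-y)‖ ≤ 1 :=
      ((mFourier n).norm_coe_le_norm _).trans mFourier_norm.le
    exact (mul_le_mul (g'.norm_coe_le_norm _) h1 (norm_nonneg _) (norm_nonneg _)).trans
      (mul_one _).le
  have h1 : HasDerivAt (fun r : ℝ => ∫ y, F r y ∂torusHaar d) (∫ y, F' 0 y ∂torusHaar d) 0 :=
    (hasDerivAt_integral_of_dominated_loc_of_deriv_le (bound := fun _ => ‖g'‖)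
      (s := (univ : Set ℝ)) (F := F) (F' := F') Filter.univ_mem
      (Eventually.of_forall fun r => (integrable_torusHaar (hFc r)).aestronglyMeasurable)
      (integrable_torusHaar (hFc 0)) (integrable_torusHaar (hFc' 0)).aestronglyMeasurable
      (Eventually.of_forall fun y r _ => hFb y r) (integrable_const _)
      (Eventually.of_forall fun y r _ => hFd y r)).2
  rw [hF, hF'] at h1
  have h2 : ∀ r : ℝ, ∫ y, g (y + Pi.single j (r : UnitAddCircle)) * mFourier n (-y) ∂torusHaar d
      = Complex.exp (modeSymbol n j * r) * torusCoeff g n := by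
    intro r
    have := integral_add_right_eq_self (μ := torusHaar d)
      (fun y => g y * mFourier n (-(y - Pi.single j (r : UnitAddCircle))))
      (Pi.single j (r : UnitAddCircle))
    simp only [add_sub_cancel_right] at this
    rw [this, torusCoeff, ← integral_const_mul]
    refine integral_congr_ae (Eventually.of_forall fun y => ?_)
    have : -(y - Pi.single j (r : UnitAddCircle)) = -y + Pi.single j (r : UnitAddCircle) := by abel
    simp only [this, mFourier_apply_add, mFourier_single_coe]
    ring
  simp only [h2] at h1
  have h3 : HasDerivAt (fun r : ℝ => Complex.exp (modeSymbol n j * r) * torusCoeff g n)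
      (modeSymbol n j * torusCoeff g n) 0 := by
    have := (((Complex.hasDerivAt_exp _).comp (0 : ℝ)
      (((hasDerivAt_id' (0 : ℝ)).ofReal_comp).const_mul (modeSymbol n j)))).mul_const
        (torusCoeff g n)
    exact this.congr_deriv (by simp)
  have := h1.unique h3
  simpa [torusCoeff] using this

/-- An approximate identity made of normalized bumps. -/
lemma exists_approximate_identity (d : ℕ) : ∃ K : ℕ → C(Torus d, ℂ),
    ∀ h : C(Torus d, ℂ), Tendsto (fun N => torusConv h (K N)) atTop (𝓝 h) := by
  set k : ℕ → C(Torus d, ℝ) := fun N =>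
    ⟨fun y => max 0 (1 / ((N : ℝ) + 1) - ‖y‖), by fun_prop⟩ with hk
  have hpos : ∀ N, 0 < ∫ y, k N y ∂torusHaar d := by
    intro N
    refine (k N).continuous.integral_pos_of_hasCompactSupport_nonneg_nonzero
      (HasCompactSupport.of_compactSpace _) (fun y => le_max_left _ _) (x := 0) ?_
    have : (0 : ℝ) < 1 / ((N : ℝ) + 1) := by positivity
    simp only [hk, ContinuousMap.coe_mk, norm_zero, sub_zero]
    rw [max_eq_right this.le]
    exact this.ne'
  set c : ℕ → ℝ := fun N => (∫ y, k N y ∂torusHaar d)⁻¹ with hc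
  have hc0 : ∀ N, 0 < c N := fun N => inv_pos.2 (hpos N)
  have hone : ∀ N x, ∫ y, c N * k N (x - y) ∂torusHaar d = 1 := by
    intro N x
    have hsymm : ∀ y, k N (x - y) = k N (y - x) := fun y => by
      simp only [hk, ContinuousMap.coe_mk, norm_sub_rev]
    simp only [hsymm]
    rw [integral_const_mul, integral_sub_right_eq_self (fun y => k N y) x]
    exact inv_mul_cancel₀ (hpos N).ne'
  refine ⟨fun N => ⟨fun y => ((c N * k N y : ℝ) : ℂ), by fun_prop⟩, fun h => ?_⟩
  rw [Metric.tendsto_atTop]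
  intro ε hε
  obtain ⟨δ, hδ, huc⟩ := Metric.uniformContinuous_iff.1
    (CompactSpace.uniformContinuous_of_continuous h.continuous) (ε / 2) (half_pos hε)
  obtain ⟨N₀, hN₀⟩ := exists_nat_one_div_lt hδ
  refine ⟨N₀, fun N hN => lt_of_le_of_lt ?_ (half_lt_self hε)⟩
  rw [ContinuousMap.dist_le (half_pos hε).le]
  intro x
  have hi : Integrable (fun y => ((c N * k N (x - y) : ℝ) : ℂ)) (torusHaar d) :=
    integrable_torusHaar (by fun_prop)
  have hi2 : Integrable (fun y => h y * ((c N * k N (x - y) : ℝ) : ℂ)) (torusHaar d) :=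
    integrable_torusHaar (by fun_prop)
  have e1 : torusConv h ⟨fun y => ((c N * k N y : ℝ) : ℂ), by fun_prop⟩ x - h x
      = ∫ y, (h y - h x) * ((c N * k N (x - y) : ℝ) : ℂ) ∂torusHaar d := by
    simp only [sub_mul]
    rw [integral_sub hi2 (hi.const_mul _), integral_const_mul, integral_complex_ofReal, hone]
    simp [torusConv_apply]
  rw [dist_eq_norm, e1]
  calc ‖∫ y, (h y - h x) * ((c N * k N (x - y) : ℝ) : ℂ) ∂torusHaar d‖
      ≤ ∫ y, ε / 2 * (c N * k N (x - y)) ∂torusHaar d := by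
        refine norm_integral_le_of_norm_le ?_ (Eventually.of_forall fun y => ?_)
        · exact integrable_of_continuous (by fun_prop) (⟨torusHaar d, inferInstance⟩ : Distr d)
        · have hknn : 0 ≤ k N (x - y) := le_max_left _ _
          rw [norm_mul, Complex.norm_real, Real.norm_of_nonneg (mul_nonneg (hc0 N).le hknn)]
          rcases lt_or_ge (dist y x) δ with hlt | hge
          · refine mul_le_mul_of_nonneg_right ?_ (mul_nonneg (hc0 N).le hknn)
            rw [← dist_eq_norm]
            exact (huc hlt).le
          · -- outside of the ball of radius `δ` the bump vanishes
            have : k N (x - y) = 0 := by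
              simp only [hk, ContinuousMap.coe_mk]
              refine max_eq_left (sub_nonpos.2 ?_)
              rw [← dist_eq_norm, dist_comm]
              exact ((one_div_le_one_div_of_le (by positivity)
                (by exact_mod_cast Nat.succ_le_succ hN)).trans hN₀.le).trans hge
            rw [this]
            simp
    _ = ε / 2 := by rw [integral_const_mul, hone, mul_one]

/-- A relation between continuous functionals of a function and of its first and second partial
derivatives that holds for all Fourier modes holds for all functions of class `𝒞²`: it is inherited
by the convolutions of `g` with continuous functions, and the convolutions with an approximate
identity converge to `g` together with their derivatives. -/
lemma functional_eq_zero_of_modes {L₀ : C(Torus d, ℂ) →L[ℂ] ℂ}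
    {L₁ L₂ : Fin d → C(Torus d, ℂ) →L[ℂ] ℂ}
    (hL : ∀ n, L₀ (mFourier n) + ∑ j, modeSymbol n j * L₁ j (mFourier n)
      + ∑ j, modeSymbol n j ^ 2 * L₂ j (mFourier n) = 0)
    {g : C(Torus d, ℂ)} {g₁ g₂ : Fin d → C(Torus d, ℂ)}
    (h₁ : ∀ j (x : Torus d),
      HasDerivAt (fun r : ℝ => g (x + Pi.single j (r : UnitAddCircle))) (g₁ j x) 0)
    (h₂ : ∀ j (x : Torus d), HasDerivAt (fun r : ℝ => g₁ j (x + Pi.single j (r : UnitAddCircle)))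
      (g₂ j x) 0) :
    L₀ g + ∑ j, L₁ j (g₁ j) + ∑ j, L₂ j (g₂ j) = 0 := by
  set Ψ : C(Torus d, ℂ) →L[ℂ] ℂ := L₀.comp (torusConv g) + ∑ j, (L₁ j).comp (torusConv (g₁ j))
    + ∑ j, (L₂ j).comp (torusConv (g₂ j)) with hΨ
  have hΨa : ∀ K, Ψ K = L₀ (torusConv g K) + ∑ j, L₁ j (torusConv (g₁ j) K)
      + ∑ j, L₂ j (torusConv (g₂ j) K) := fun K => by simp [hΨ]
  have hΨ0 : ∀ K, Ψ K = 0 := by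
    have hle : (Submodule.span ℂ (range <| mFourier (d := Fin d))).topologicalClosure ≤
        LinearMap.ker Ψ.toLinearMap := by
      refine Submodule.topologicalClosure_minimal _ (Submodule.span_le.2 ?_) Ψ.isClosed_ker
      rintro _ ⟨n, rfl⟩
      change Ψ (mFourier n) = 0
      rw [hΨa]
      simp only [torusConv_mFourier, map_smul, smul_eq_mul, torusCoeff_deriv (h₁ _),
        torusCoeff_deriv (h₂ _)]
      calc _ = torusCoeff g n * (L₀ (mFourier n) + ∑ j, modeSymbol n j * L₁ j (mFourier n)
            + ∑ j, modeSymbol n j ^ 2 * L₂ j (mFourier n)) := by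
            rw [mul_add, mul_add, Finset.mul_sum, Finset.mul_sum]
            congr 1
            · congr 1
              exact Finset.sum_congr rfl fun j _ => by ring
            · exact Finset.sum_congr rfl fun j _ => by ring
        _ = 0 := by rw [hL, mul_zero]
    intro K
    exact hle (by rw [span_mFourier_closure_eq_top]; trivial)
  obtain ⟨K, hK⟩ := exists_approximate_identity d
  have hlim : Tendsto (fun N => Ψ (K N)) atTop
      (𝓝 (L₀ g + ∑ j, L₁ j (g₁ j) + ∑ j, L₂ j (g₂ j))) := by
    simp only [hΨa]
    refine ((L₀.continuous.tendsto _).comp (hK g)).add ?_ |>.add ?_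
    · exact tendsto_finsetSum _ fun j _ => ((L₁ j).continuous.tendsto _).comp (hK (g₁ j))
    · exact tendsto_finsetSum _ fun j _ => ((L₂ j).continuous.tendsto _).comp (hK (g₂ j))
  simp only [hΨ0] at hlim
  exact (tendsto_nhds_unique hlim tendsto_const_nhds)

/-! ### Evolution of the mean distribution -/

/-- Integration against the mean distribution `∫ m μ(dm)`. -/
def meanCLM (μ : Belief d) : C(Torus d, ℂ) →L[ℂ] ℂ :=
  mixtureCLM (ContinuousMap.id (Distr d)) μ

lemma meanCLM_apply (μ : Belief d) (Φ : C(Torus d, ℂ)) :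
    meanCLM μ Φ = ∫ m : Distr d, ∫ x, Φ x ∂(m : Measure (Torus d)) ∂(μ : Measure (Distr d)) := rfl

lemma norm_meanCLM_le (μ : Belief d) : ‖meanCLM μ‖ ≤ 1 := norm_mixtureCLM_le _ _

lemma continuous_meanCLM {ρ : ℝ → Belief d} (hρ : Continuous ρ) (Φ : C(Torus d, ℂ)) :
    Continuous fun t => meanCLM (ρ t) Φ := continuous_mixtureCLM _ hρ Φ

lemma continuous_meanCLM_apply {ρ : ℝ → Belief d} (hρ : Continuous ρ) {Φ : ℝ → C(Torus d, ℂ)}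
    (hΦ : Continuous Φ) : Continuous fun t => meanCLM (ρ t) (Φ t) :=
  continuous_clm_apply_of_norm_le (fun t => norm_meanCLM_le (ρ t)) (continuous_meanCLM hρ) hΦ

/-- The time integral of `Φ ↦ ∫ ∫ A_s Φ dm ρ_s(dm)` is a continuous functional of `Φ`. -/
lemma exists_integral_meanCLM {ρ : ℝ → Belief d} (hρ : Continuous ρ) {A : ℝ → C(Torus d, ℂ)}
    (hA : Continuous A) (t : ℝ) : ∃ L : C(Torus d, ℂ) →L[ℂ] ℂ,
      ∀ Φ, L Φ = ∫ s in (0 : ℝ)..t, meanCLM (ρ s) (A s * Φ) := by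
  have hc : ∀ Φ, Continuous fun s => meanCLM (ρ s) (A s * Φ) := fun Φ =>
    continuous_meanCLM_apply hρ (hA.mul continuous_const)
  obtain ⟨C, hC⟩ := (isCompact_uIcc (a := (0 : ℝ)) (b := t)).exists_bound_of_continuousOn
    hA.continuousOn
  refine ⟨LinearMap.mkContinuousOfExistsBound
    { toFun := fun Φ => ∫ s in (0 : ℝ)..t, meanCLM (ρ s) (A s * Φ)
      map_add' := fun Φ Ψ => by
        simp only [mul_add, map_add]
        exact intervalIntegral.integral_add ((hc Φ).intervalIntegrable _ _)
          ((hc Ψ).intervalIntegrable _ _)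
      map_smul' := fun z Φ => by
        simp only [mul_smul_comm, map_smul]
        exact intervalIntegral.integral_smul z _ } ⟨C * |t - 0|, fun Φ => ?_⟩, fun Φ => rfl⟩
  have h := intervalIntegral.norm_integral_le_of_norm_le_const (a := (0 : ℝ)) (b := t)
    (C := C * ‖Φ‖) (f := fun s => meanCLM (ρ s) (A s * Φ)) fun s hs => by
      have h1 := (meanCLM (ρ s)).le_of_opNorm_le (norm_meanCLM_le (ρ s)) (A s * Φ)
      rw [one_mul] at h1
      exact h1.trans ((norm_mul_le _ _).trans
        (mul_le_mul_of_nonneg_right (hC s (uIoc_subset_uIcc hs)) (norm_nonneg _)))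
  calc _ ≤ _ := h
    _ = _ := by ring

/-- The mean distribution of a weak solution solves the Fokker–Planck equation, tested against
functions of class `𝒞²`. -/
theorem IsWeakSolution.meanCLM_eq {σ T : ℝ} (hT : 0 < T) {b : ℝ → Torus d → E d}
    {μ₀ : Belief d} {μ ρ : ℝ → Belief d} (hw : IsWeakSolution σ T b μ₀ μ)
    (hρ : Continuous ρ) (hμρ : ∀ t ∈ Icc 0 T, μ t = ρ t) (h0 : ρ 0 = μ₀)
    {B : ℝ → Fin d → C(Torus d, ℂ)} (hB : ∀ j, Continuous fun t => B t j)
    (hBb : ∀ t ∈ Icc 0 T, ∀ x i, B t i x = b t x i)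
    {g : C(Torus d, ℂ)} {g₁ g₂ : Fin d → C(Torus d, ℂ)}
    (h₁ : ∀ j (x : Torus d),
      HasDerivAt (fun r : ℝ => g (x + Pi.single j (r : UnitAddCircle))) (g₁ j x) 0)
    (h₂ : ∀ j (x : Torus d),
      HasDerivAt (fun r : ℝ => g₁ j (x + Pi.single j (r : UnitAddCircle))) (g₂ j x) 0) :
    ∀ t ∈ Icc 0 T, meanCLM (ρ t) g = meanCLM (ρ 0) g +
      ∫ s in (0 : ℝ)..t, meanCLM (ρ s) (∑ j, ((σ : ℂ) • g₂ j + B s j * g₁ j)) := by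
  intro t ht
  have hBc : ∀ j, ∃ L : C(Torus d, ℂ) →L[ℂ] ℂ,
      ∀ Φ, L Φ = ∫ s in (0 : ℝ)..t, meanCLM (ρ s) (B s j * Φ) := fun j =>
    exists_integral_meanCLM hρ (hB j) t
  choose L₁ hL₁ using hBc
  obtain ⟨L₂, hL₂⟩ := exists_integral_meanCLM hρ (A := fun _ => (σ : ℂ) • (1 : C(Torus d, ℂ)))
    continuous_const t
  have hL₂' : ∀ Φ, L₂ Φ = ∫ s in (0 : ℝ)..t, meanCLM (ρ s) ((σ : ℂ) • Φ) := fun Φ => by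
    rw [hL₂]
    simp only [smul_mul_assoc, one_mul]
  have hi₁ : ∀ j Φ, IntervalIntegrable (fun s => meanCLM (ρ s) (B s j * Φ)) volume 0 t :=
    fun j Φ => (continuous_meanCLM_apply hρ ((hB j).mul continuous_const)).intervalIntegrable _ _
  have hi₂ : ∀ Φ, IntervalIntegrable (fun s => meanCLM (ρ s) ((σ : ℂ) • Φ)) volume 0 t :=
    fun Φ => (continuous_meanCLM hρ _).intervalIntegrable _ _
  have hsplit : ∀ Φ₁ Φ₂ : Fin d → C(Torus d, ℂ),
      ∫ s in (0 : ℝ)..t, meanCLM (ρ s) (∑ j, ((σ : ℂ) • Φ₂ j + B s j * Φ₁ j)) =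
        ∑ j, L₁ j (Φ₁ j) + ∑ j, L₂ (Φ₂ j) := by
    intro Φ₁ Φ₂
    simp only [map_sum, map_add]
    rw [intervalIntegral.integral_finsetSum fun j _ => (hi₂ _).add (hi₁ j _),
      ← Finset.sum_add_distrib]
    refine Finset.sum_congr rfl fun j _ => ?_
    rw [intervalIntegral.integral_add (hi₂ _) (hi₁ j _), hL₁, hL₂', add_comm]
  have key := functional_eq_zero_of_modes (L₀ := meanCLM (ρ t) - meanCLM (ρ 0))
    (L₁ := fun j => -L₁ j) (L₂ := fun _ => -L₂) (fun n => ?_) h₁ h₂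
  · rw [hsplit]
    simp only [sub_apply, neg_apply, Finset.sum_neg_distrib] at key
    linear_combination key
  · have h := hw.integral_fourierMoment_eq hT hρ hμρ h0 hB hBb (fun _ : Fin 1 => n) t ht
    have e1 : ∀ s, ∫ m, fourierMoment (fun _ : Fin 1 => n) m ∂(ρ s : Measure (Distr d))
        = meanCLM (ρ s) (mFourier n) := fun s => by
      rw [meanCLM_apply]
      refine integral_congr_ae (Eventually.of_forall fun m => ?_)
      simp [fourierMoment, fourierMean, integralCLM_apply]
    have e2 : ∀ s, ∫ m, momentGenerator σ (B s) (fun _ : Fin 1 => n) m ∂(ρ s : Measure (Distr d))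
        = meanCLM (ρ s) (∑ j, ((σ : ℂ) • (modeSymbol n j ^ 2 • mFourier n)
          + B s j * (modeSymbol n j • mFourier n))) := fun s => by
      have e3 : ∑ j, ((σ : ℂ) • (modeSymbol n j ^ 2 • mFourier n)
          + B s j * (modeSymbol n j • mFourier n)) = modeGenerator σ (B s) n := by
        rw [modeGenerator, modeLaplace, Finset.sum_add_distrib, ← Finset.smul_sum,
          ← Finset.sum_smul, mul_smul]
        simp only [mul_smul_comm]
      rw [e3, meanCLM_apply]
      refine integral_congr_ae (Eventually.of_forall fun m => ?_)
      simp [momentGenerator, fourierCofactor, integralCLM_apply]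
    simp only [e1, e2] at h
    rw [hsplit] at h
    simp only [map_smul, smul_eq_mul] at h
    simp only [sub_apply, neg_apply, mul_neg, Finset.sum_neg_distrib]
    linear_combination h

/-! ### Differentiable curves of functions and of functionals -/

/-- The product rule for `s ↦ ν_s(W_s)`, where `ν` is only differentiable in the weak sense. -/
lemma hasDerivAt_clm_apply_of_norm_le {V : Type*} [NormedAddCommGroup V] [NormedSpace ℂ V]
    {ν : ℝ → V →L[ℂ] ℂ} {C : ℝ} (hC : ∀ s, ‖ν s‖ ≤ C) (hν : ∀ v, Continuous fun s => ν s v)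
    {W : ℝ → V} {W' : V} {a : ℂ} {t : ℝ} (hW : HasDerivAt W W' t)
    (ha : HasDerivAt (fun s => ν s (W t)) a t) :
    HasDerivAt (fun s => ν s (W s)) (a + ν t W') t := by
  rw [hasDerivAt_iff_tendsto_slope] at hW ha ⊢
  have h1 : Tendsto (fun s => ν s (slope W t s - W')) (𝓝[≠] t) (𝓝 0) := by
    refine squeeze_zero_norm (a := fun s => C * ‖slope W t s - W'‖) (fun s => ?_) ?_
    · exact (ν s).le_of_opNorm_le (hC s) _
    · have := ((hW.sub_const W').norm).const_mul C
      simpa using this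
  have h2 : Tendsto (fun s => ν s W') (𝓝[≠] t) (𝓝 (ν t W')) :=
    ((hν W').tendsto t).mono_left nhdsWithin_le_nhds
  have h3 := ha.add (h1.add h2)
  rw [zero_add] at h3
  refine h3.congr fun s => ?_
  simp only [slope, vsub_eq_sub, map_sub, ContinuousLinearMap.map_smul_of_tower, smul_sub]
  abel

/-- A continuous real function on `ℝ × 𝕋^d` as a curve of complex functions on the torus. -/
def realCurve (F : ℝ → Torus d → ℝ) (hF : Continuous (Function.uncurry F)) :
    C(ℝ, C(Torus d, ℂ)) :=
  ContinuousMap.curry ⟨fun p => ((Function.uncurry F p : ℝ) : ℂ), by fun_prop⟩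

lemma realCurve_apply (F : ℝ → Torus d → ℝ) (hF : Continuous (Function.uncurry F)) (t : ℝ)
    (x : Torus d) : realCurve F hF t x = (F t x : ℂ) := rfl

/-- Pointwise time derivatives that are jointly continuous are derivatives for the uniform norm. -/
lemma hasDerivAt_realCurve {T : ℝ} {F F' : ℝ → Torus d → ℝ}
    (hF : Continuous (Function.uncurry F)) (hF' : Continuous (Function.uncurry F'))
    (h : ∀ t ∈ Ioo 0 T, ∀ x, HasDerivAt (fun s => F s x) (F' t x) t) {t : ℝ} (ht : t ∈ Ioo 0 T) :
    HasDerivAt (realCurve F hF) (realCurve F' hF' t) t := by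
  have hc : Continuous (realCurve F' hF') := (realCurve F' hF').continuous
  have hI : HasDerivAt (fun s => ∫ r in t..s, realCurve F' hF' r) (realCurve F' hF' t) t :=
    intervalIntegral.integral_hasDerivAt_right (hc.intervalIntegrable _ _)
      (hc.stronglyMeasurableAtFilter _ _) hc.continuousAt
  refine (hI.const_add (realCurve F hF t)).congr_of_eventuallyEq ?_
  filter_upwards [Ioo_mem_nhds ht.1 ht.2] with s hs
  ext x
  have hsub : uIcc t s ⊆ Ioo 0 T := (convex_Ioo 0 T).ordConnected.uIcc_subset ht hs
  have e1 : (∫ r in t..s, realCurve F' hF' r) x = ∫ r in t..s, ((F' r x : ℝ) : ℂ) :=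
    ((ContinuousMap.evalCLM ℂ x).intervalIntegral_comp_comm (hc.intervalIntegrable t s)).symm
  have hcx : Continuous fun r => F' r x := hF'.comp (Continuous.prodMk_left x)
  rw [ContinuousMap.add_apply, e1, intervalIntegral.integral_ofReal,
    intervalIntegral.integral_eq_sub_of_hasDerivAt (fun r hr => h r (hsub hr) x)
      (hcx.intervalIntegrable _ _)]
  simp [realCurve_apply]

/-! ### Evolution of the mean of a function of class `𝒞^{1,2}` -/

lemma continuous_torusGrad_of {Y : Type*} [TopologicalSpace Y] {v : Y → Torus d → ℝ}
    (hv : ∀ y, ContDiff ℝ 1 (lift (v y)))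
    (hc : ∀ i, Continuous (Function.uncurry fun y => torusPartial i (v y))) :
    Continuous (Function.uncurry fun y => torusGrad (v y)) := by
  have h : (Function.uncurry fun y => torusGrad (v y)) = fun p : Y × Torus d =>
      WithLp.toLp 2 (fun i => torusPartial i (v p.1) p.2) := by
    ext p i
    exact torusGrad_apply (hv p.1) p.2 i
  rw [h]
  exact (PiLp.continuous_toLp 2 _).comp (continuous_pi hc)

lemma IsC12.continuous_torusGrad {T : ℝ} {u : ℝ → Torus d → ℝ} (hu : IsC12 T u) (hT : 0 ≤ T) :
    Continuous (Function.uncurry fun t => torusGrad (u (projIcc 0 T hT t))) :=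
  continuous_torusGrad_of (fun t => hu.contDiff_one (projIcc 0 T hT t).2)
    (hu.continuous_torusPartial hT)

lemma IsC12.continuous_torusLaplacian {T : ℝ} {u : ℝ → Torus d → ℝ} (hu : IsC12 T u)
    (hT : 0 ≤ T) :
    Continuous (Function.uncurry fun t => torusLaplacian (u (projIcc 0 T hT t))) := by
  have h : (Function.uncurry fun t => torusLaplacian (u (projIcc 0 T hT t))) = fun p =>
      ∑ i, torusPartial i (torusPartial i (u (projIcc 0 T hT p.1))) p.2 := by
    ext p
    exact torusLaplacian_eq (hu.space_diff _ (projIcc 0 T hT p.1).2) p.2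
  rw [h]
  exact continuous_finsetSum _ fun i _ => hu.continuous_torusPartial_torusPartial hT i

lemma IsC12.hasDerivAt {T : ℝ} {u : ℝ → Torus d → ℝ} (hu : IsC12 T u) {t : ℝ} (ht : t ∈ Ioo 0 T)
    (x : Torus d) :
    HasDerivAt (fun s => u s x) (derivWithin (fun s => u s x) (Icc 0 T) t) t :=
  ((hu.time_diff x) t (Ioo_subset_Icc_self ht)).hasDerivWithinAt.hasDerivAt
    (Icc_mem_nhds ht.1 ht.2)

lemma continuous_gradient_hamiltonian {H : Torus d → E d → ℝ}
    (hH : ContDiff ℝ ∞ (fun q : E d × E d => H (proj q.1) q.2)) :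
    Continuous fun q : Torus d × E d => gradient (H q.1) q.2 := by
  refine (isOpenQuotientMap_proj.prodMap IsOpenQuotientMap.id).isQuotientMap.continuous_iff.2 ?_
  have h1 : ContDiff ℝ ∞ fun q : E d × E d => fderiv ℝ (H (proj q.1)) q.2 :=
    ContDiff.fderiv (n := ∞) (f := fun (q : E d × E d) (p : E d) => H (proj q.1) p)
      (hH.comp ((contDiff_fst.comp contDiff_fst).prodMk contDiff_snd)) contDiff_snd (by simp)
  exact (InnerProductSpace.toDual ℝ (E d)).symm.continuous.comp h1.continuous

lemma continuous_hamiltonian {H : Torus d → E d → ℝ}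
    (hH : ContDiff ℝ ∞ (fun q : E d × E d => H (proj q.1) q.2)) :
    Continuous fun q : Torus d × E d => H q.1 q.2 :=
  (isOpenQuotientMap_proj.prodMap IsOpenQuotientMap.id).isQuotientMap.continuous_iff.2
    hH.continuous

lemma differentiable_hamiltonian {H : Torus d → E d → ℝ}
    (hH : ContDiff ℝ ∞ (fun q : E d × E d => H (proj q.1) q.2)) (x : Torus d) :
    Differentiable ℝ (H x) := by
  obtain ⟨y, rfl⟩ := isOpenQuotientMap_proj.surjective x
  exact (hH.comp (contDiff_prodMk_right y)).differentiable (by simp)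

lemma meanCLM_realCurve {F : ℝ → Torus d → ℝ} (hF : Continuous (Function.uncurry F))
    (μ : Belief d) (t : ℝ) : meanCLM μ (realCurve F hF t) =
      ((∫ m : Distr d, ∫ x, F t x ∂(m : Measure (Torus d)) ∂(μ : Measure (Distr d)) : ℝ) : ℂ) := by
  rw [meanCLM_apply]
  simp only [realCurve_apply, integral_complex_ofReal]

lemma continuous_mean_integral {ρ : ℝ → Belief d} (hρ : Continuous ρ) {F : ℝ → Torus d → ℝ}
    (hF : Continuous (Function.uncurry F)) : Continuous fun t =>
      ∫ m : Distr d, ∫ x, F t x ∂(m : Measure (Torus d)) ∂(ρ t : Measure (Distr d)) := by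
  have h := continuous_meanCLM_apply hρ (realCurve F hF).continuous
  simp only [meanCLM_realCurve] at h
  exact Complex.continuous_re.comp h

/-- The time derivative of `∫ ∫ u(t, x) m(dx) μₜ(dm)` along a weak solution. -/
theorem IsWeakSolution.hasDerivAt_mean {σ T : ℝ} (hT : 0 < T) {b : ℝ → Torus d → E d}
    {μ₀ : Belief d} {μ ρ : ℝ → Belief d} (hw : IsWeakSolution σ T b μ₀ μ)
    (hρ : Continuous ρ) (hμρ : ∀ t ∈ Icc 0 T, μ t = ρ t) (h0 : ρ 0 = μ₀)
    {B : ℝ → Fin d → C(Torus d, ℂ)} (hB : ∀ j, Continuous fun t => B t j)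
    (hBb : ∀ t ∈ Icc 0 T, ∀ x i, B t i x = b t x i)
    {u : ℝ → Torus d → ℝ} (hu : IsC12 T u) {t : ℝ} (ht : t ∈ Ioo 0 T) :
    HasDerivAt (fun s => ∫ m : Distr d, ∫ x, u (projIcc 0 T hT.le s) x ∂(m : Measure (Torus d))
        ∂(ρ s : Measure (Distr d)))
      (∫ m : Distr d, ∫ x, (derivWithin (fun s => u s x) (Icc 0 T) t + σ * torusLaplacian (u t) x
        + inner ℝ (b t x) (torusGrad (u t) x)) ∂(m : Measure (Torus d))
        ∂(ρ t : Measure (Distr d))) t := by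
  have htI := Ioo_subset_Icc_self ht
  have hp : ∀ s ∈ Icc 0 T, (projIcc 0 T hT.le s : ℝ) = s := fun s hs => by
    rw [projIcc_of_mem hT.le hs]
  set g := realCurve _ (hu.continuous hT.le) with hg
  set g' := realCurve _ (hu.continuous_derivWithin hT.le) with hg'
  set g₁ := fun j => realCurve _ (hu.continuous_torusPartial hT.le j) with hg₁
  set g₂ := fun j => realCurve _ (hu.continuous_torusPartial_torusPartial hT.le j) with hg₂
  have hcd := hu.space_diff t htI
  have d₁ : ∀ j (x : Torus d),
      HasDerivAt (fun r : ℝ => g t (x + Pi.single j (r : UnitAddCircle))) (g₁ j t x) 0 := by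
    intro j x
    have h := (hasDerivAt_torusPartial (hu.contDiff_one htI) j x 0).ofReal_comp
    simpa [hg, hg₁, realCurve_apply, hp t htI] using h
  have d₂ : ∀ j (x : Torus d),
      HasDerivAt (fun r : ℝ => g₁ j t (x + Pi.single j (r : UnitAddCircle))) (g₂ j t x) 0 := by
    intro j x
    have h := (hasDerivAt_torusPartial (contDiff_lift_torusPartial (n := 1)
      (by rwa [one_add_one_eq_two]) j) j x 0).ofReal_comp
    simpa [hg₁, hg₂, realCurve_apply, hp t htI] using h
  have hmean := hw.meanCLM_eq hT hρ hμρ h0 hB hBb d₁ d₂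
  have hc : Continuous fun s => meanCLM (ρ s) (∑ j, ((σ : ℂ) • g₂ j t + B s j * g₁ j t)) :=
    continuous_meanCLM_apply hρ (continuous_finsetSum _ fun j _ =>
      continuous_const.add ((hB j).mul continuous_const))
  have ha : HasDerivAt (fun s => meanCLM (ρ s) (g t))
      (meanCLM (ρ t) (∑ j, ((σ : ℂ) • g₂ j t + B t j * g₁ j t))) t := by
    refine ((intervalIntegral.integral_hasDerivAt_right (hc.intervalIntegrable 0 t)
      (hc.stronglyMeasurableAtFilter _ _) hc.continuousAt).const_add
        (meanCLM (ρ 0) (g t))).congr_of_eventuallyEq ?_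
    filter_upwards [Icc_mem_nhds ht.1 ht.2] with s hs using hmean s hs
  have hgd : HasDerivAt g (g' t) t := by
    refine hasDerivAt_realCurve (T := T) _ _ (fun s hs x => ?_) ht
    rw [hp s (Ioo_subset_Icc_self hs)]
    refine (hu.hasDerivAt hs x).congr_of_eventuallyEq ?_
    filter_upwards [Icc_mem_nhds hs.1 hs.2] with r hr
    rw [hp r hr]
  have h := hasDerivAt_re (hasDerivAt_clm_apply_of_norm_le (fun s => norm_meanCLM_le (ρ s))
    (continuous_meanCLM hρ) hgd ha)
  rw [← map_add] at h
  simp only [hg, meanCLM_realCurve, Complex.ofReal_re] at h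
  refine h.congr_deriv ?_
  have hreal : ∀ x, (∑ j, ((σ : ℂ) • g₂ j t + B t j * g₁ j t) + g' t) x =
      ((derivWithin (fun s => u s x) (Icc 0 T) t + σ * torusLaplacian (u t) x
        + inner ℝ (b t x) (torusGrad (u t) x) : ℝ) : ℂ) := by
    intro x
    rw [torusLaplacian_eq hcd, inner_torusGrad (hu.contDiff_one htI)]
    simp only [hg', hg₁, hg₂, ContinuousMap.add_apply, ContinuousMap.sum_apply,
      ContinuousMap.smul_apply, ContinuousMap.mul_apply, realCurve_apply, hp t htI, hBb t htI,
      smul_eq_mul, Finset.sum_add_distrib, ← Finset.mul_sum]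
    push_cast
    ring
  rw [meanCLM_apply]
  simp only [hreal, integral_complex_ofReal, Complex.ofReal_re]

/-! ### Comparison principle for the Hamilton–Jacobi–Bellman equation -/

/-- The comparison principle. At a maximum of `u - v - ε (T - t)` with `t < T` the gradients of
`u` and `v` coincide, so that the Hamiltonians cancel. -/
theorem hjb_comparison {σ T : ℝ} (hσ : 0 ≤ σ) (hT : 0 < T) {H : Torus d → E d → ℝ}
    {u v : ℝ → Torus d → ℝ} (hu : IsC12 T u) (hv : IsC12 T v)
    (h : ∀ t ∈ Icc 0 T, ∀ x,
      -derivWithin (fun s => u s x) (Icc 0 T) t - σ * torusLaplacian (u t) x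
        + H x (torusGrad (u t) x) ≤
      -derivWithin (fun s => v s x) (Icc 0 T) t - σ * torusLaplacian (v t) x
        + H x (torusGrad (v t) x))
    (hTe : ∀ x, u T x ≤ v T x) : ∀ t ∈ Icc 0 T, ∀ x, u t x ≤ v t x := by
  have key : ∀ ε > 0, ∀ t ∈ Icc 0 T, ∀ x, u t x - v t x ≤ ε * (T - t) := by
    intro ε hε
    have hcont : Continuous fun p : Icc (0 : ℝ) T × Torus d =>
        u p.1 p.2 - v p.1 p.2 - ε * (T - p.1) := by
      have hproj : ∀ p : Icc (0 : ℝ) T × Torus d, projIcc 0 T hT.le (p.1 : ℝ) = p.1 := fun p =>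
        projIcc_val hT.le p.1
      have e1 : Continuous fun p : Icc (0 : ℝ) T × Torus d => ((p.1 : ℝ), p.2) := by fun_prop
      have e2 := (hu.continuous hT.le).comp e1
      have e3 := (hv.continuous hT.le).comp e1
      simp only [Function.comp_def, Function.uncurry_apply_pair, hproj] at e2 e3
      exact (e2.sub e3).sub (by fun_prop)
    have : Nonempty (Icc (0 : ℝ) T) := ⟨⟨0, le_rfl, hT.le⟩⟩
    obtain ⟨⟨⟨t₀, ht₀⟩, x₀⟩, -, hmax⟩ := isCompact_univ.exists_isMaxOn univ_nonempty
      hcont.continuousOn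
    have hmax' : ∀ t ∈ Icc 0 T, ∀ x, u t x - v t x - ε * (T - t)
        ≤ u t₀ x₀ - v t₀ x₀ - ε * (T - t₀) := fun t ht x =>
      hmax (mem_univ ((⟨t, ht⟩ : Icc (0 : ℝ) T), x))
    have hx : ∀ x, u t₀ x - v t₀ x ≤ u t₀ x₀ - v t₀ x₀ := fun x => by
      have := hmax' t₀ ht₀ x
      linarith
    rcases ht₀.2.eq_or_lt with rfl | hlt
    · intro t ht x
      have h1 := hmax' t ht x
      have h2 := hTe x₀
      linarith
    · exfalso
      have htime : derivWithin (fun s => u s x₀) (Icc 0 T) t₀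
          - derivWithin (fun s => v s x₀) (Icc 0 T) t₀ + ε ≤ 0 := by
        refine hasDerivWithinAt_nonpos_of_le (f := fun t => u t x₀ - v t x₀ - ε * (T - t)) hlt ?_
          fun t ht => hmax' t ⟨ht₀.1.trans ht.1, ht.2⟩ x₀
        have h1 := ((hu.time_diff x₀) t₀ ht₀).hasDerivWithinAt
        have h2 := ((hv.time_diff x₀) t₀ ht₀).hasDerivWithinAt
        have h3 : HasDerivWithinAt (fun t => ε * (T - t)) (ε * (-1)) (Icc 0 T) t₀ :=
          (((hasDerivAt_id' t₀).const_sub T).const_mul ε).hasDerivWithinAt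
        exact (((h1.sub h2).sub h3).congr_deriv (by ring)).mono (Icc_subset_Icc_left ht₀.1)
      have hu1 := hu.contDiff_one ht₀
      have hv1 := hv.contDiff_one ht₀
      have hd : ∀ i (r : ℝ), HasDerivAt (fun r : ℝ => u t₀ (x₀ + Pi.single i (r : UnitAddCircle))
          - v t₀ (x₀ + Pi.single i (r : UnitAddCircle)))
          (torusPartial i (u t₀) (x₀ + Pi.single i (r : UnitAddCircle))
            - torusPartial i (v t₀) (x₀ + Pi.single i (r : UnitAddCircle))) r := fun i r =>
        (hasDerivAt_torusPartial hu1 i x₀ r).sub (hasDerivAt_torusPartial hv1 i x₀ r)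
      have hloc : ∀ i, IsLocalMax (fun r : ℝ => u t₀ (x₀ + Pi.single i (r : UnitAddCircle))
          - v t₀ (x₀ + Pi.single i (r : UnitAddCircle))) 0 := fun i =>
        Eventually.of_forall fun r => by simpa using hx (x₀ + Pi.single i (r : UnitAddCircle))
      have hgrad : torusGrad (u t₀) x₀ = torusGrad (v t₀) x₀ := by
        ext i
        rw [torusGrad_apply hu1, torusGrad_apply hv1]
        have := (hloc i).hasDerivAt_eq_zero (hd i 0)
        simpa [sub_eq_zero] using this
      have hlap : torusLaplacian (u t₀) x₀ ≤ torusLaplacian (v t₀) x₀ := by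
        rw [torusLaplacian_eq (hu.space_diff _ ht₀), torusLaplacian_eq (hv.space_diff _ ht₀)]
        refine Finset.sum_le_sum fun i _ => sub_nonpos.1 ?_
        have hu2 : ContDiff ℝ 1 (lift (torusPartial i (u t₀))) :=
          contDiff_lift_torusPartial (n := 1)
            (by rw [one_add_one_eq_two]; exact hu.space_diff _ ht₀) i
        have hv2 : ContDiff ℝ 1 (lift (torusPartial i (v t₀))) :=
          contDiff_lift_torusPartial (n := 1)
            (by rw [one_add_one_eq_two]; exact hv.space_diff _ ht₀) i
        have := second_deriv_nonpos_of_isLocalMax (Eventually.of_forall (hd i))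
          ((hasDerivAt_torusPartial hu2 i x₀ 0).sub (hasDerivAt_torusPartial hv2 i x₀ 0)) (hloc i)
        simpa using this
      have heq := h t₀ ht₀ x₀
      rw [hgrad] at heq
      have := mul_le_mul_of_nonneg_left hlap hσ
      linarith
  intro t ht x
  refine sub_nonpos.1 (le_of_forall_pos_le_add fun δ hδ => ?_)
  have h1 := key (δ / (T + 1)) (by positivity) t ht x
  have h2 : δ / (T + 1) * (T - t) ≤ δ := by
    rw [div_mul_eq_mul_div, div_le_iff₀ (by positivity)]
    exact mul_le_mul_of_nonneg_left (by linarith [ht.1]) hδ.le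
  linarith

/-! ### The energy estimate -/

lemma ConvexOn.add_inner_gradient_le {V : Type*} [NormedAddCommGroup V] [InnerProductSpace ℝ V]
    [CompleteSpace V] {h : V → ℝ} (hc : ConvexOn ℝ univ h) {p : V} (hd : DifferentiableAt ℝ h p)
    (q : V) : h p + inner ℝ (gradient h p) (q - p) ≤ h q := by
  have h1 : ConvexOn ℝ univ (h ∘ AffineMap.lineMap (k := ℝ) p q) := by
    simpa using hc.comp_affineMap (AffineMap.lineMap (k := ℝ) p q)
  have h2 : HasDerivAt (h ∘ AffineMap.lineMap (k := ℝ) p q) (inner ℝ (gradient h p) (q - p)) 0 := by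
    have hf : HasFDerivAt h (fderiv ℝ h p) (AffineMap.lineMap (k := ℝ) p q (0 : ℝ)) := by
      simpa using hd.hasFDerivAt
    have := hf.comp_hasDerivAt (0 : ℝ) (AffineMap.hasDerivAt_lineMap (a := p) (b := q))
    rwa [← inner_gradient_left] at this
  have := h1.le_slope_of_hasDerivAt (mem_univ 0) (mem_univ 1) zero_lt_one h2
  rw [slope_def_field] at this
  simp only [Function.comp_apply, AffineMap.lineMap_apply_one, AffineMap.lineMap_apply_zero,
    sub_zero, div_one] at this
  linarith

lemma continuous_integral_distr {F : Torus d → ℝ} (hF : Continuous F) :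
    Continuous fun m : Distr d => ∫ x, F x ∂(m : Measure (Torus d)) :=
  continuous_integral_real (μ := fun m : Distr d => m) continuous_id (Ψ := fun _ => F)
    (hF.comp continuous_snd)

lemma mean_sub {F G : Torus d → ℝ} (hF : Continuous F) (hG : Continuous G) (μ : Belief d) :
    ∫ m : Distr d, ∫ x, (F x - G x) ∂(m : Measure (Torus d)) ∂(μ : Measure (Distr d)) =
      ∫ m : Distr d, ∫ x, F x ∂(m : Measure (Torus d)) ∂(μ : Measure (Distr d))
        - ∫ m : Distr d, ∫ x, G x ∂(m : Measure (Torus d)) ∂(μ : Measure (Distr d)) := by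
  rw [← integral_sub (integrable_of_continuous (continuous_integral_distr hF) μ)
    (integrable_of_continuous (continuous_integral_distr hG) μ)]
  refine integral_congr_ae (Eventually.of_forall fun m => ?_)
  exact integral_sub (integrable_of_continuous hF m) (integrable_of_continuous hG m)

lemma mean_mono {F G : Torus d → ℝ} (hF : Continuous F) (hG : Continuous G) (h : ∀ x, F x ≤ G x)
    (μ : Belief d) :
    ∫ m : Distr d, ∫ x, F x ∂(m : Measure (Torus d)) ∂(μ : Measure (Distr d)) ≤
      ∫ m : Distr d, ∫ x, G x ∂(m : Measure (Torus d)) ∂(μ : Measure (Distr d)) :=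
  integral_mono (integrable_of_continuous (continuous_integral_distr hF) μ)
    (integrable_of_continuous (continuous_integral_distr hG) μ) fun m =>
      integral_mono (integrable_of_continuous hF m) (integrable_of_continuous hG m) h

/-- Under the strict monotonicity hypothesis the pairing is nonnegative: where it is negative the
averages coincide, and then it vanishes. -/
lemma pairing_nonneg {F : Distr d → Torus d → ℝ}
    (hF : ∀ μ₁ μ₂ : Belief d, pairing F μ₁ μ₂ ≤ 0 → averaged F μ₁ = averaged F μ₂)
    (μ₁ μ₂ : Belief d) : 0 ≤ pairing F μ₁ μ₂ := by
  by_contra! h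
  have := hF μ₁ μ₂ h.le
  simp [pairing, this] at h

/-- The drift of a solution, as a continuous curve of functions on the torus. -/
lemma exists_drift_curve {T : ℝ} (hT : 0 ≤ T) {H : Torus d → E d → ℝ}
    (hH : ContDiff ℝ ∞ (fun q : E d × E d => H (proj q.1) q.2)) {u : ℝ → Torus d → ℝ}
    (hu : IsC12 T u) : ∃ B : ℝ → Fin d → C(Torus d, ℂ), (∀ j, Continuous fun t => B t j) ∧
      ∀ t ∈ Icc 0 T, ∀ x i, B t i x = ((-gradient (H x) (torusGrad (u t) x)) i : ℝ) := by
  have hc : ∀ i, Continuous (Function.uncurry fun (t : ℝ) (x : Torus d) =>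
      (-gradient (H x) (torusGrad (u (projIcc 0 T hT t)) x)) i) := fun i => by
    have h1 := (continuous_gradient_hamiltonian hH).comp
      ((continuous_snd (X := ℝ)).prodMk (hu.continuous_torusGrad hT))
    exact (EuclideanSpace.proj (𝕜 := ℝ) i).continuous.comp h1.neg
  refine ⟨fun t i => realCurve _ (hc i) t, fun j => (realCurve _ (hc j)).continuous,
    fun t ht x i => ?_⟩
  rw [realCurve_apply, projIcc_of_mem hT ht]

section Solutions

variable {σ T : ℝ} {H : Torus d → E d → ℝ} {f U₀ : Distr d → Torus d → ℝ} {μ₀ : Belief d}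
  {u u₁ u₂ : ℝ → Torus d → ℝ} {μ μ₁ μ₂ : ℝ → Belief d}

/-- The averaged coupling is continuous in `(t, x)` because it is the left-hand side of the
Hamilton–Jacobi–Bellman equation. -/
lemma IsSolution.continuous_averaged (h : IsSolution σ T H f U₀ μ₀ u μ) (hT : 0 ≤ T)
    (hH : ContDiff ℝ ∞ (fun q : E d × E d => H (proj q.1) q.2)) :
    Continuous (Function.uncurry fun t => averaged f (μ (projIcc 0 T hT t))) := by
  have h1 := (continuous_hamiltonian hH).comp
    ((continuous_snd (X := ℝ)).prodMk (h.regular.continuous_torusGrad hT))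
  refine ((((h.regular.continuous_derivWithin hT).neg).sub
    ((h.regular.continuous_torusLaplacian hT).const_mul σ)).add h1).congr fun p => ?_
  exact h.hjb _ (projIcc 0 T hT p.1).2 p.2

lemma IsSolution.continuous_path (h : IsSolution σ T H f U₀ μ₀ u μ) (hT : 0 ≤ T) :
    Continuous fun t => μ (projIcc 0 T hT t) :=
  h.continuousOn.comp_continuous (by fun_prop) fun t => (projIcc 0 T hT t).2

/-- The Hamilton–Jacobi–Bellman equations and the convexity of the Hamiltonian bound the
derivative of `u₁ - u₂` along the flow of the first solution. -/
lemma IsSolution.flow_sub_le (h₁ : IsSolution σ T H f U₀ μ₀ u₁ μ₁)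
    (h₂ : IsSolution σ T H f U₀ μ₀ u₂ μ₂)
    (hH : ContDiff ℝ ∞ (fun q : E d × E d => H (proj q.1) q.2))
    (hHc : ∀ x, ConvexOn ℝ univ (H x)) {t : ℝ} (ht : t ∈ Icc 0 T) (x : Torus d) :
    (derivWithin (fun s => u₁ s x) (Icc 0 T) t + σ * torusLaplacian (u₁ t) x
        + inner ℝ (-gradient (H x) (torusGrad (u₁ t) x)) (torusGrad (u₁ t) x))
      - (derivWithin (fun s => u₂ s x) (Icc 0 T) t + σ * torusLaplacian (u₂ t) x
        + inner ℝ (-gradient (H x) (torusGrad (u₁ t) x)) (torusGrad (u₂ t) x))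
      ≤ averaged f (μ₂ t) x - averaged f (μ₁ t) x := by
  have hc := ConvexOn.add_inner_gradient_le (hHc x)
    (differentiable_hamiltonian hH x (torusGrad (u₁ t) x)) (torusGrad (u₂ t) x)
  rw [← h₁.hjb t ht x, ← h₂.hjb t ht x]
  rw [inner_sub_right] at hc
  rw [inner_neg_left, inner_neg_left]
  linarith

/-- The quantity `t ↦ ∫ ∫ (u₁ - u₂)(t, x) m(dx) (μ₁(t) - μ₂(t))(dm)`, extended by constants
outside of `[0,T]`. The terms are grouped by the flow along which they are differentiated. -/
def energy (hT : 0 ≤ T) (u₁ u₂ : ℝ → Torus d → ℝ) (μ₁ μ₂ : ℝ → Belief d) (t : ℝ) : ℝ :=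
  ((∫ m : Distr d, ∫ x, u₁ (projIcc 0 T hT t) x ∂(m : Measure (Torus d))
        ∂(μ₁ (projIcc 0 T hT t) : Measure (Distr d)))
      - ∫ m : Distr d, ∫ x, u₂ (projIcc 0 T hT t) x ∂(m : Measure (Torus d))
        ∂(μ₁ (projIcc 0 T hT t) : Measure (Distr d)))
    + ((∫ m : Distr d, ∫ x, u₂ (projIcc 0 T hT t) x ∂(m : Measure (Torus d))
        ∂(μ₂ (projIcc 0 T hT t) : Measure (Distr d)))
      - ∫ m : Distr d, ∫ x, u₁ (projIcc 0 T hT t) x ∂(m : Measure (Torus d))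
        ∂(μ₂ (projIcc 0 T hT t) : Measure (Distr d)))

lemma IsSolution.continuous_flow (h₁ : IsSolution σ T H f U₀ μ₀ u₁ μ₁) (hu : IsC12 T u)
    (hT : 0 ≤ T) (hH : ContDiff ℝ ∞ (fun q : E d × E d => H (proj q.1) q.2)) {t : ℝ}
    (ht : t ∈ Icc 0 T) :
    Continuous fun x => derivWithin (fun s => u s x) (Icc 0 T) t + σ * torusLaplacian (u t) x
        + inner ℝ (-gradient (H x) (torusGrad (u₁ t) x)) (torusGrad (u t) x) := by
  have e : ∀ {V : Type} [TopologicalSpace V] {F : ℝ → Torus d → V},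
      Continuous (Function.uncurry fun s => F (projIcc 0 T hT s)) → Continuous (F t) :=
    fun {V} _ F hF => by
      have := hF.comp (Continuous.prodMk_right t)
      simpa [Function.comp_def, projIcc_of_mem hT ht] using this
  refine ((e (F := fun t x => derivWithin (fun s => u s x) (Icc 0 T) t)
    (hu.continuous_derivWithin hT)).add
    ((e (F := fun t => torusLaplacian (u t)) (hu.continuous_torusLaplacian hT)).const_mul σ)).add ?_
  have h1 := e (F := fun t => torusGrad (u₁ t)) (h₁.regular.continuous_torusGrad hT)
  have h2 := e (F := fun t => torusGrad (u t)) (hu.continuous_torusGrad hT)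
  exact (((continuous_gradient_hamiltonian hH).comp (continuous_id.prodMk h1)).neg).inner h2

/-- The derivative of `∫ ∫ (u₁ - u₂)(t, x) m(dx) μ₁(t)(dm)`. -/
lemma IsSolution.hasDerivAt_mean_sub (hT : 0 < T) (h₁ : IsSolution σ T H f U₀ μ₀ u₁ μ₁)
    (h₂ : IsSolution σ T H f U₀ μ₀ u₂ μ₂)
    (hH : ContDiff ℝ ∞ (fun q : E d × E d => H (proj q.1) q.2))
    (hHc : ∀ x, ConvexOn ℝ univ (H x)) {t : ℝ} (ht : t ∈ Ioo 0 T) :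
    ∃ a, a ≤ ∫ m : Distr d, ∫ x, (averaged f (μ₂ t) x - averaged f (μ₁ t) x)
        ∂(m : Measure (Torus d)) ∂(μ₁ t : Measure (Distr d)) ∧
      HasDerivAt (fun t =>
        (∫ m : Distr d, ∫ x, u₁ (projIcc 0 T hT.le t) x ∂(m : Measure (Torus d))
          ∂(μ₁ (projIcc 0 T hT.le t) : Measure (Distr d)))
        - ∫ m : Distr d, ∫ x, u₂ (projIcc 0 T hT.le t) x ∂(m : Measure (Torus d))
          ∂(μ₁ (projIcc 0 T hT.le t) : Measure (Distr d))) a t := by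
  have htI := Ioo_subset_Icc_self ht
  have hp : ∀ s ∈ Icc 0 T, (projIcc 0 T hT.le s : ℝ) = s := fun s hs => by
    rw [projIcc_of_mem hT.le hs]
  obtain ⟨B, hB, hBb⟩ := exists_drift_curve hT.le hH h₁.regular
  have hav : ∀ {u μ}, IsSolution σ T H f U₀ μ₀ u μ → Continuous (averaged f (μ t)) :=
    fun h => by
      have := (h.continuous_averaged hT.le hH).comp (Continuous.prodMk_right t)
      simpa [Function.comp_def, projIcc_of_mem hT.le htI] using this
  have hd := fun {u} (hu : IsC12 T u) => h₁.continuity.hasDerivAt_mean hT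
    (h₁.continuous_path hT.le) (fun s hs => by rw [hp s hs])
    (by rw [hp 0 ⟨le_rfl, hT.le⟩, h₁.initial]) hB hBb hu ht
  refine ⟨_, ?_, (hd h₁.regular).sub (hd h₂.regular)⟩
  have hc₁ := h₁.continuous_flow h₁.regular hT.le hH htI
  have hc₂ := h₁.continuous_flow h₂.regular hT.le hH htI
  rw [hp t htI, ← mean_sub hc₁ hc₂]
  exact mean_mono (hc₁.sub hc₂) ((hav h₂).sub (hav h₁)) (h₁.flow_sub_le h₂ hH hHc htI) _

/-- Two solutions see the same couplings: the energy vanishes at time `0`, is nonincreasing, and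
is nonnegative at time `T`. It is therefore constant, and its derivative and its terminal value
give the equality case in the monotonicity of `f` and of `U₀`. -/
theorem IsSolution.averaged_eq (hT : 0 < T) (h₁ : IsSolution σ T H f U₀ μ₀ u₁ μ₁)
    (h₂ : IsSolution σ T H f U₀ μ₀ u₂ μ₂)
    (hH : ContDiff ℝ ∞ (fun q : E d × E d => H (proj q.1) q.2))
    (hHc : ∀ x, ConvexOn ℝ univ (H x))
    (hU₀ : ∀ μ₁ μ₂ : Belief d, pairing U₀ μ₁ μ₂ ≤ 0 → averaged U₀ μ₁ = averaged U₀ μ₂)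
    (hf : ∀ μ₁ μ₂ : Belief d, pairing f μ₁ μ₂ ≤ 0 → averaged f μ₁ = averaged f μ₂) :
    averaged U₀ (μ₁ T) = averaged U₀ (μ₂ T) ∧
      ∀ t ∈ Icc 0 T, averaged f (μ₁ t) = averaged f (μ₂ t) := by
  have hp : ∀ s ∈ Icc 0 T, (projIcc 0 T hT.le s : ℝ) = s := fun s hs => by
    rw [projIcc_of_mem hT.le hs]
  have h0 : (0 : ℝ) ∈ Icc 0 T := ⟨le_rfl, hT.le⟩
  have hTT : T ∈ Icc 0 T := ⟨hT.le, le_rfl⟩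
  set e := energy hT.le u₁ u₂ μ₁ μ₂ with he
  have hec : Continuous e :=
    ((continuous_mean_integral (h₁.continuous_path hT.le) (h₁.regular.continuous hT.le)).sub
      (continuous_mean_integral (h₁.continuous_path hT.le) (h₂.regular.continuous hT.le))).add
    ((continuous_mean_integral (h₂.continuous_path hT.le) (h₂.regular.continuous hT.le)).sub
      (continuous_mean_integral (h₂.continuous_path hT.le) (h₁.regular.continuous hT.le)))
  have hav : ∀ {u μ}, IsSolution σ T H f U₀ μ₀ u μ → ∀ t ∈ Icc 0 T,
      Continuous (averaged f (μ t)) := fun h t ht => by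
    have := (h.continuous_averaged hT.le hH).comp (Continuous.prodMk_right t)
    simpa [Function.comp_def, projIcc_of_mem hT.le ht] using this
  have hed : ∀ t ∈ Ioo 0 T, ∃ a, a ≤ -pairing f (μ₁ t) (μ₂ t) ∧ HasDerivAt e a t := by
    intro t ht
    obtain ⟨a₁, ha₁, hd₁⟩ := h₁.hasDerivAt_mean_sub hT h₂ hH hHc ht
    obtain ⟨a₂, ha₂, hd₂⟩ := h₂.hasDerivAt_mean_sub hT h₁ hH hHc ht
    refine ⟨a₁ + a₂, ?_, hd₁.add hd₂⟩
    have c₁ := hav h₁ t (Ioo_subset_Icc_self ht)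
    have c₂ := hav h₂ t (Ioo_subset_Icc_self ht)
    rw [pairing, mean_sub c₁ c₂, mean_sub c₁ c₂]
    rw [mean_sub c₂ c₁] at ha₁
    rw [mean_sub c₁ c₂] at ha₂
    linarith
  have hanti : AntitoneOn e (Icc 0 T) := by
    refine antitoneOn_of_deriv_nonpos (convex_Icc 0 T) hec.continuousOn ?_ ?_ <;>
      rw [interior_Icc] <;> intro t ht <;> obtain ⟨a, ha, hd⟩ := hed t ht
    · exact hd.differentiableAt.differentiableWithinAt
    · rw [hd.deriv]
      linarith [pairing_nonneg hf (μ₁ t) (μ₂ t)]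
  have he0 : e 0 = 0 := by
    rw [he, energy, hp 0 h0, h₁.initial, h₂.initial]
    ring
  have heT : e T = pairing U₀ (μ₁ T) (μ₂ T) := by
    have hc : ∀ {u μ}, IsSolution σ T H f U₀ μ₀ u μ → Continuous (averaged U₀ (μ T)) :=
      fun {u μ} h => by
        have h1 := (h.regular.continuous hT.le).comp (Continuous.prodMk_right T)
        refine h1.congr fun x => ?_
        simp [h.terminal]
    rw [he, energy, hp T hTT, pairing, mean_sub (hc h₁) (hc h₂), mean_sub (hc h₁) (hc h₂)]
    simp only [h₁.terminal, h₂.terminal]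
    ring
  have heT0 : 0 ≤ e T := heT ▸ pairing_nonneg hU₀ _ _
  have hzero : ∀ t ∈ Icc 0 T, e t = 0 := fun t ht =>
    le_antisymm (he0 ▸ hanti h0 ht ht.1) (heT0.trans (hanti ht hTT ht.2))
  refine ⟨hU₀ _ _ (by rw [← heT, hzero T hTT]), fun t ht => funext fun x => ?_⟩
  have hIoo : EqOn (fun t => averaged f (μ₁ (projIcc 0 T hT.le t)) x)
      (fun t => averaged f (μ₂ (projIcc 0 T hT.le t)) x) (Ioo 0 T) := by
    intro t ht
    obtain ⟨a, ha, hd⟩ := hed t ht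
    have h1 : HasDerivAt e 0 t := (hasDerivAt_const t (0 : ℝ)).congr_of_eventuallyEq (by
      filter_upwards [Icc_mem_nhds ht.1 ht.2] with s hs using hzero s hs)
    rw [hd.unique h1] at ha
    simp only [hp t (Ioo_subset_Icc_self ht)]
    rw [hf (μ₁ t) (μ₂ t) (by linarith)]
  -- the end points of `[0,T]` are reached by continuity
  have hclos := hIoo.closure
    ((h₁.continuous_averaged hT.le hH).comp (Continuous.prodMk_left x))
    ((h₂.continuous_averaged hT.le hH).comp (Continuous.prodMk_left x))
  rw [closure_Ioo hT.ne] at hclos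
  simpa only [hp t ht] using hclos ht

lemma IsWeakSolution.congr_drift {b b' : ℝ → Torus d → E d} (hT : 0 ≤ T)
    (h : IsWeakSolution σ T b μ₀ μ) (hb : ∀ t ∈ Icc 0 T, b t = b' t) :
    IsWeakSolution σ T b' μ₀ μ := by
  intro φ Dφ hφ hφT
  refine Eq.trans (congrArg₂ (· - ·) (intervalIntegral.integral_congr (E := ℝ) fun t ht => ?_) rfl)
    (h φ Dφ hφ hφT)
  rw [uIcc_of_le hT] at ht
  simp only [hb t ht]

end Solutions

end BlindMFG

end

theorem mainTheorem2 (d : ℕ) (σ T : ℝ) (hσ : 0 < σ) (hT : 0 < T)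
    (H : Torus d → E d → ℝ)
    (hH_smooth : ContDiff ℝ ∞ (fun q : E d × E d => H (proj q.1) q.2))
    (hH_convex : ∀ x, ConvexOn ℝ univ (H x))
    (hH_lip : ∃ K : ℝ≥0, ∀ x, LipschitzWith K (H x))
    (α : ℝ≥0) (hα : 0 < α) (hα' : α ≤ 1)
    (f U₀ : Distr d → Torus d → ℝ)
    (hf : ContinuousIntoHolder 0 α f) (hU₀ : ContinuousIntoHolder 2 α U₀)
    (hU₀_mono : ∀ μ₁ μ₂ : Belief d,
      pairing U₀ μ₁ μ₂ ≤ 0 → averaged U₀ μ₁ = averaged U₀ μ₂)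
    (hf_mono : ∀ μ₁ μ₂ : Belief d,
      pairing f μ₁ μ₂ ≤ 0 → averaged f μ₁ = averaged f μ₂)
    (μ₀ : Belief d)
    (u₁ u₂ : ℝ → Torus d → ℝ) (μ₁ μ₂ : ℝ → Belief d)
    (h₁ : IsSolution σ T H f U₀ μ₀ u₁ μ₁)
    (h₂ : IsSolution σ T H f U₀ μ₀ u₂ μ₂) :
    ∀ t ∈ Icc 0 T, u₁ t = u₂ t ∧ μ₁ t = μ₂ t := by
  obtain ⟨hU, hF⟩ := h₁.averaged_eq hT h₂ hH_smooth hH_convex hU₀_mono hf_mono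
  have hu : ∀ t ∈ Icc 0 T, u₁ t = u₂ t := fun t ht => funext fun x => le_antisymm
    (hjb_comparison hσ.le hT h₁.regular h₂.regular
      (fun s hs y => by rw [h₁.hjb s hs y, h₂.hjb s hs y, hF s hs])
      (fun y => by rw [h₁.terminal, h₂.terminal, hU]) t ht x)
    (hjb_comparison hσ.le hT h₂.regular h₁.regular
      (fun s hs y => by rw [h₁.hjb s hs y, h₂.hjb s hs y, hF s hs])
      (fun y => by rw [h₁.terminal, h₂.terminal, hU]) t ht x)
  obtain ⟨B, hB, hBb⟩ := exists_drift_curve hT.le hH_smooth h₁.regular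
  have hw₂ := h₂.continuity.congr_drift hT.le
    (b' := fun t x => -gradient (H x) (torusGrad (u₁ t) x)) fun t ht => by simp only [hu t ht]
  have hp : ∀ s ∈ Icc 0 T, (projIcc 0 T hT.le s : ℝ) = s := fun s hs => by
    rw [projIcc_of_mem hT.le hs]
  have hμ := h₁.continuity.unique hσ hT hw₂
    (h₁.continuous_path hT.le) (fun s hs => by rw [hp s hs])
    (by rw [hp 0 ⟨le_rfl, hT.le⟩, h₁.initial])
    (h₂.continuous_path hT.le) (fun s hs => by rw [hp s hs])
    (by rw [hp 0 ⟨le_rfl, hT.le⟩, h₂.initial]) hB hBb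
  exact fun t ht => ⟨hu t ht, hμ t ht⟩
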